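/- Let $\mathbf{E}_1^3$ be $\mathbb{R}^3$ with the scalar product $\langle\,,\rangle=(dx_1)^2+(dx_2)^2-(dx_3)^2$. A *circle* is the image, under an isometry of $\mathbf{E}_1^3$, of one of the planar curves $$s\mapsto r\big(\cos\tfrac sr,\sin\tfrac sr,0\big),\qquad s\mapsto r\big(0,\sinh\tfrac sr,\cosh\tfrac sr\big),\qquad s\mapsto\big(s,\tfrac{r s^2}{2},\tfrac{r s^2}{2}\big)\qquad(s\in\mathbb{R}),$$ with $r>0$, which lie respectively in a spacelike, a timelike and a lightlike plane. Let $M$ be a spacelike cyclic surface in $\mathbf{E}_1^3$, that is, a smooth immersion $X:D\to\mathbf{E}_1^3$ of a connected nonempty open set $D\subset\mathbb{R}^2$ whose induced metric is Riemannian and such that, for each $u$ in the projection $I$ of $D$ to the first factor, the parameter curve $v\mapsto X(u,v)$ runs in a circle $C_u$. Assume that the circles $C_u$, $u\in I$, lie in parallel planes (of spacelike, timelike or lightlike type). Let $\mathbf{N}=(X_u\wedge X_v)/|X_u\wedge X_v|$, where $\wedge$ is the Lorentzian cross product, let $E,F,G$ be the coefficients of the first fundamental form, and put $e=\langle\mathbf{N},X_{uu}\rangle$,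 $f=\langle\mathbf{N},X_{uv}\rangle$, $g=\langle\mathbf{N},X_{vv}\rangle$, and $$H=\frac12\,\frac{eG-2fF+gE}{EG-F^2},\qquad K=\frac{eg-f^2}{EG-F^2}.$$ If $M$ is a linear Weingarten surface, i.e. there are real constants $a,b,c$ with $a^2+b^2\neq0$ and $aH+bK=c$ on $M$, then at least one of the following holds: 1. $M$ is (an open piece of) a surface of revolution: there is a straight line $\ell$ such that every rotation about $\ell$ (an isometry of $\mathbf{E}_1^3$ that fixes $\ell$ pointwise and whose linear part has determinant $1$ and preserves the time orientation) maps each circle $C_u$, $u\in I$, onto itself; 2. $H=0$ on all of $M$; 3. $K=0$ on all of $M$. -/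

import Mathlib

open scoped ContDiff

noncomputable section

namespace Minkowski

/-- The vector space underlying Minkowski three-space; coordinates `0, 1, 2` are `x₁, x₂, x₃`. -/
abbrev E31 : Type := Fin 3 → ℝ

/-- The Lorentzian scalar product `(dx₁)² + (dx₂)² - (dx₃)²`. -/
def mink (x y : E31) : ℝ := x 0 * y 0 + x 1 * y 1 - x 2 * y 2

/-- The Lorentzian cross product, characterized by `⟨a ∧ b, w⟩ = det (a, b, w)`. -/
def lcross (a b : E31) : E31 :=
  ![a 1 * b 2 - a 2 * b 1, a 2 * b 0 - a 0 * b 2, a 1 * b 0 - a 0 * b 1]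

/-- Linear isometries of the scalar product. -/
def IsLorentz (L : E31 →ₗ[ℝ] E31) : Prop :=
  ∀ x y : E31, mink (L x) (L y) = mink x y

/-- Isometries (rigid motions) of Minkowski space: a linear isometry followed by a translation. -/
def IsRigidMotion (Φ : E31 → E31) : Prop :=
  ∃ (L : E31 →ₗ[ℝ] E31) (b : E31), IsLorentz L ∧ ∀ x, Φ x = L x + b

/-- The circle of radius `r` in the spacelike plane `x₃ = 0`, by arc length. -/
def circleS (r s : ℝ) : E31 :=
  ![r * Real.cos (s / r), r * Real.sin (s / r), 0]

/-- The spacelike circle of radius `r` in the timelike plane `x₁ = 0`, by arc length. -/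
def circleT (r s : ℝ) : E31 :=
  ![0, r * Real.sinh (s / r), r * Real.cosh (s / r)]

/-- The spacelike circle with parameter `r` in the lightlike plane `x₂ - x₃ = 0`,
by arc length. -/
def circleL (r s : ℝ) : E31 :=
  ![s, r * s ^ 2 / 2, r * s ^ 2 / 2]

/-- A (complete, spacelike) circle of Minkowski space: up to an isometry, one of the planar
curves of constant curvature in a spacelike, timelike or lightlike plane. -/
def IsCircle (C : Set E31) : Prop :=
  ∃ (Φ : E31 → E31) (r : ℝ), IsRigidMotion Φ ∧ 0 < r ∧
    (C = Φ '' Set.range (circleS r) ∨ C = Φ '' Set.range (circleT r) ∨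
      C = Φ '' Set.range (circleL r))

/-- `Φ` is a rotation about the straight line `{p + t d}`: an isometry that leaves every point
of the line fixed and whose linear part lies in the identity component of the Lorentz group
(determinant one, preserving the time orientation). -/
def IsRotationAbout (p d : E31) (Φ : E31 → E31) : Prop :=
  (∃ (L : E31 →ₗ[ℝ] E31) (b : E31), IsLorentz L ∧ LinearMap.det L = 1 ∧
      0 < L ![0, 0, 1] 2 ∧ ∀ x, Φ x = L x + b) ∧
    ∀ t : ℝ, Φ (p + t • d) = p + t • d

/-- Partial derivative with respect to the first parameter. -/
def du (X : ℝ × ℝ → E31) (q : ℝ × ℝ) : E31 := fderiv ℝ X q (1, 0)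

/-- Partial derivative with respect to the second parameter. -/
def dv (X : ℝ × ℝ → E31) (q : ℝ × ℝ) : E31 := fderiv ℝ X q (0, 1)

/-- Coefficient `E` of the first fundamental form. -/
def ffE (X : ℝ × ℝ → E31) (q : ℝ × ℝ) : ℝ := mink (du X q) (du X q)

/-- Coefficient `F` of the first fundamental form. -/
def ffF (X : ℝ × ℝ → E31) (q : ℝ × ℝ) : ℝ := mink (du X q) (dv X q)

/-- Coefficient `G` of the first fundamental form. -/
def ffG (X : ℝ × ℝ → E31) (q : ℝ × ℝ) : ℝ := mink (dv X q) (dv X q)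

/-- The unit normal `(X_u ∧ X_v) / |X_u ∧ X_v|`, where `|w| = |⟨w, w⟩|^{1/2}`. -/
def unitNormal (X : ℝ × ℝ → E31) (q : ℝ × ℝ) : E31 :=
  (Real.sqrt |mink (lcross (du X q) (dv X q)) (lcross (du X q) (dv X q))|)⁻¹ •
    lcross (du X q) (dv X q)

/-- Coefficient `e` of the second fundamental form. -/
def sfe (X : ℝ × ℝ → E31) (q : ℝ × ℝ) : ℝ := mink (unitNormal X q) (du (du X) q)

/-- Coefficient `f` of the second fundamental form. -/
def sff (X : ℝ × ℝ → E31) (q : ℝ × ℝ) : ℝ := mink (unitNormal X q) (dv (du X) q)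

/-- Coefficient `g` of the second fundamental form. -/
def sfg (X : ℝ × ℝ → E31) (q : ℝ × ℝ) : ℝ := mink (unitNormal X q) (dv (dv X) q)

/-- The mean curvature `H`. -/
def meanCurvature (X : ℝ × ℝ → E31) (q : ℝ × ℝ) : ℝ :=
  (1 / 2) * ((sfe X q * ffG X q - 2 * sff X q * ffF X q + sfg X q * ffE X q) /
    (ffE X q * ffG X q - ffF X q ^ 2))

/-- The Gauss curvature `K`. -/
def gaussCurvature (X : ℝ × ℝ → E31) (q : ℝ × ℝ) : ℝ :=
  (sfe X q * sfg X q - sff X q ^ 2) / (ffE X q * ffG X q - ffF X q ^ 2)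

/-- `X` is a smooth immersion of the parameter domain `D` whose induced metric is Riemannian. -/
structure IsSpacelikeSurface (D : Set (ℝ × ℝ)) (X : ℝ × ℝ → E31) : Prop where
  isOpen : IsOpen D
  isConnected : IsConnected D
  smooth : ContDiffOn ℝ ∞ X D
  spacelike : ∀ q ∈ D, ∀ w : ℝ × ℝ, w ≠ 0 → 0 < mink (fderiv ℝ X q w) (fderiv ℝ X q w)

/-- The surface `X` is foliated by (pieces of) the circles `C u` of a one-parameter family: the
parameter curve `v ↦ X (u, v)` runs in the circle `C u`. The circles vary smoothly with `u`
because `X` is a smooth immersion. -/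
structure IsCyclic (D : Set (ℝ × ℝ)) (X : ℝ × ℝ → E31) (C : ℝ → Set E31) : Prop where
  isCircle : ∀ u ∈ Prod.fst '' D, IsCircle (C u)
  mem_circle : ∀ q ∈ D, X q ∈ C q.1

/-- The circles of the foliation lie in parallel planes, all with the direction plane `P`. -/
def CirclesInParallelPlanes (D : Set (ℝ × ℝ)) (C : ℝ → Set E31) : Prop :=
  ∃ P : Submodule ℝ E31, Module.finrank ℝ P = 2 ∧
    ∀ u ∈ Prod.fst '' D, ∀ x ∈ C u, ∀ y ∈ C u, x - y ∈ P

/-- The linear Weingarten relation `a H + b K = c` for constants `a`, `b`, not both zero. -/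
def IsLinearWeingarten (D : Set (ℝ × ℝ)) (X : ℝ × ℝ → E31) : Prop :=
  ∃ a b c : ℝ, a ^ 2 + b ^ 2 ≠ 0 ∧
    ∀ q ∈ D, a * meanCurvature X q + b * gaussCurvature X q = c

/-- The surface foliated by the circles `C u` is (an open piece of) a surface of revolution: there
is a straight line such that all rotations about it leave every circle `C u` invariant, and hence
leave invariant the surface swept out by the complete circles. If the surface contains the
complete circles, it is that invariant surface. -/
def IsSurfaceOfRevolution (D : Set (ℝ × ℝ)) (C : ℝ → Set E31) : Prop :=
  ∃ p d : E31, d ≠ 0 ∧ ∀ Φ : E31 → E31, IsRotationAbout p d Φ →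
    ∀ u ∈ Prod.fst '' D, Φ '' C u = C u

end Minkowski

end

/-!
Let `n` be a normal of the parallel planes, scaled so that `⟨n, n⟩` is `-1`, `1` or `0` for spacelike,
timelike or lightlike planes. Each circle `C u` is cut out of the plane `⟨x, n⟩ = h u` by a sphere
`⟨x - c u, x - c u⟩ = ρ u` (one branch of the intersection, if the plane is timelike). The point `c u`
is the center of the circle; in a lightlike plane, it is the vertex of the light cone through the
parabola, so that `ρ = 0` there. In all three cases, the rotations about the line through `c u` with
direction `n` preserve `C u`. Hence the surface is one of revolution as soon as `c'` is everywhere a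
multiple of `n` (`isSurfaceOfRevolution_of_deriv_center`). The function `c` is smooth because it can be
computed from `X`, `X_v` and `X_vv`.

Differentiating the two equations twice gives the scalar products of the two-jet of `X` with `n` and
`Z = X - c`. They determine the curvatures without a special choice of the parameter on the circles
(`CircleJet.curvatures`):
`H = ± P₁ / (2 Δ ^ (3 / 2))` and `K = h' P₂ / Δ ^ 2`.
Here `-Δ` is the square of the normal vector `⟨X_u, Z⟩ n - h' Z`. It is essential that, for fixed `u`,
the expressions `P₁` and `P₂` (`meanNum`, `gaussNum`) have low degree on the circle: they are affine in
`Z` if the planes are not lightlike, and at most quadratic in the parameter of the parabola if they are.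
The relation `a H + b K = k` becomes
`a² P₁² Δ = 4 (k Δ² - b h' P₂)²`,
an identity between Laurent polynomials (in `exp (i θ)` for circles, in `exp t` for hyperbolas) or between
polynomials (for parabolas), since it holds at infinitely many points. Suppose that `c'` is not a multiple
of `n`, and `h' ≠ 0`. If `k ≠ 0`, the degrees of the two sides do not match (for parabolas, this first
gives `⟨c', n⟩ = 0` for all `u`, which lowers the degree of `P₂`). If `k = 0` and `a b ≠ 0`, the
two sides agree only if `P₁ = P₂ = 0`, and then `Δ ≤ 0`, which contradicts that the surface is spacelike
(`elliptic_rigidity`, `hyperbolic_rigidity`, `parabolic_const_zero`).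

The derivative `h'` can vanish only if the planes are spacelike. If `h' = 0` on an interval, then
`H = K = 0` there, so `k = 0`. Therefore `h' ≠ 0` on a dense set if `k ≠ 0`, and `c'` is a multiple of `n`
everywhere by continuity. If `k = 0` and `a b ≠ 0`, the relation implies `|h''| ≤ C |h'|` near a zero of
`h'`, and by the Grönwall inequality `h'` vanishes identically or nowhere (`elliptic_case`).
-/

noncomputable section

namespace Minkowski

/-! ### The scalar product and the cross product -/

theorem mink_comm (x y : E31) : mink x y = mink y x := by simp only [mink]; ring
theorem mink_add_left (x y z : E31) : mink (x + y) z = mink x z + mink y z := by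
  simp only [mink, Pi.add_apply]; ring
theorem mink_sub_left (x y z : E31) : mink (x - y) z = mink x z - mink y z := by
  simp only [mink, Pi.sub_apply]; ring
theorem mink_smul_left (t : ℝ) (x y : E31) : mink (t • x) y = t * mink x y := by
  simp only [mink, Pi.smul_apply, smul_eq_mul]; ring
theorem mink_add_right (x y z : E31) : mink x (y + z) = mink x y + mink x z := by
  simp only [mink, Pi.add_apply]; ring
theorem mink_sub_right (x y z : E31) : mink x (y - z) = mink x y - mink x z := by
  simp only [mink, Pi.sub_apply]; ring
theorem mink_smul_right (t : ℝ) (x y : E31) : mink x (t • y) = t * mink x y := by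
  simp only [mink, Pi.smul_apply, smul_eq_mul]; ring

theorem lcross_apply_zero (a b : E31) : lcross a b 0 = a 1 * b 2 - a 2 * b 1 := rfl
theorem lcross_apply_one (a b : E31) : lcross a b 1 = a 2 * b 0 - a 0 * b 2 := rfl
theorem lcross_apply_two (a b : E31) : lcross a b 2 = a 1 * b 0 - a 0 * b 1 := rfl

theorem mink_lcross_self (a b : E31) :
    mink (lcross a b) (lcross a b) = mink a b ^ 2 - mink a a * mink b b := by
  simp only [mink, lcross_apply_zero, lcross_apply_one, lcross_apply_two]; ring

theorem lcross_lcross (a b c : E31) : lcross a (lcross b c) = mink a b • c - mink a c • b := by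
  ext i
  fin_cases i <;>
    simp [mink, lcross_apply_zero, lcross_apply_one, lcross_apply_two] <;> ring

theorem lcross_smul_right (a b : E31) (t : ℝ) : lcross a (t • b) = t • lcross a b := by
  ext i
  fin_cases i <;>
    simp [lcross_apply_zero, lcross_apply_one, lcross_apply_two] <;> ring

/-- Expansion of the scalar product in the basis `n, Z, n ∧ Z`. -/
theorem mink_gram (n Z w w' : E31) :
    (mink n Z ^ 2 - mink n n * mink Z Z) * mink w w' =
      mink w (lcross n Z) * mink w' (lcross n Z) -
        (mink Z Z * mink w n * mink w' n
          - mink n Z * (mink w n * mink w' Z + mink w' n * mink w Z)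
          + mink n n * mink w Z * mink w' Z) := by
  simp only [mink, lcross_apply_zero, lcross_apply_one, lcross_apply_two]; ring

/-- Expansion of a vector in the basis `n, Z, n ∧ Z`. -/
theorem gram_expansion (n Z w : E31) :
    (mink n Z ^ 2 - mink n n * mink Z Z) • w =
      mink w (lcross n Z) • lcross n Z -
        ((mink Z Z * mink w n - mink n Z * mink w Z) • n
          + (mink n n * mink w Z - mink n Z * mink w n) • Z) := by
  ext i
  fin_cases i <;>
    simp [mink, lcross_apply_zero, lcross_apply_one, lcross_apply_two] <;> ring

/-- A vector orthogonal to the vectors `n` and `Z`, which span a nondegenerate plane, is a multiple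
of their cross product. -/
theorem exists_eq_smul_lcross {n Z w : E31} (hG : mink n Z ^ 2 - mink n n * mink Z Z ≠ 0)
    (hn : mink w n = 0) (hZ : mink w Z = 0) : ∃ t : ℝ, w = t • lcross n Z := by
  have h := gram_expansion n Z w
  rw [hn, hZ] at h
  simp only [mul_zero, sub_zero, zero_smul, add_zero] at h
  refine ⟨(mink n Z ^ 2 - mink n n * mink Z Z)⁻¹ * mink w (lcross n Z), ?_⟩
  rw [mul_smul, ← h, smul_smul, inv_mul_cancel₀ hG, one_smul]

theorem hasDerivAt_mink {f g : ℝ → E31} {f' g' : E31} {t : ℝ} (hf : HasDerivAt f f' t)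
    (hg : HasDerivAt g g' t) :
    HasDerivAt (fun s => mink (f s) (g s)) (mink f' (g t) + mink (f t) g') t := by
  have hf' := hasDerivAt_pi.1 hf
  have hg' := hasDerivAt_pi.1 hg
  have := (((hf' 0).mul (hg' 0)).add ((hf' 1).mul (hg' 1))).sub ((hf' 2).mul (hg' 2))
  refine this.congr_deriv ?_
  simp only [mink]; ring

theorem _root_.ContDiffOn.mink {E : Type*} [NormedAddCommGroup E] [NormedSpace ℝ E] {f g : E → E31}
    {s : Set E} {k : WithTop ℕ∞} (hf : ContDiffOn ℝ k f s) (hg : ContDiffOn ℝ k g s) :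
    ContDiffOn ℝ k (fun x => Minkowski.mink (f x) (g x)) s := by
  have hf' := contDiffOn_pi.1 hf
  have hg' := contDiffOn_pi.1 hg
  exact (((hf' 0).mul (hg' 0)).add ((hf' 1).mul (hg' 1))).sub ((hf' 2).mul (hg' 2))

theorem _root_.ContDiffOn.lcross {E : Type*} [NormedAddCommGroup E] [NormedSpace ℝ E]
    {f g : E → E31} {s : Set E} {k : WithTop ℕ∞} (hf : ContDiffOn ℝ k f s)
    (hg : ContDiffOn ℝ k g s) : ContDiffOn ℝ k (fun x => Minkowski.lcross (f x) (g x)) s := by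
  have hf' := contDiffOn_pi.1 hf
  have hg' := contDiffOn_pi.1 hg
  refine contDiffOn_pi.2 fun i => ?_
  fin_cases i
  · exact ((hf' 1).mul (hg' 2)).sub ((hf' 2).mul (hg' 1))
  · exact ((hf' 2).mul (hg' 0)).sub ((hf' 0).mul (hg' 2))
  · exact ((hf' 1).mul (hg' 0)).sub ((hf' 0).mul (hg' 1))

theorem continuous_mink : Continuous fun p : E31 × E31 => mink p.1 p.2 := by
  unfold mink; fun_prop

/-! ### The curvatures in terms of the family of circles -/

/-- The relations between the two-jet of a surface and the two-jets of a family of circles which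
result from differentiating `⟨X, n⟩ = h` and `⟨X - c, X - c⟩ = ρ`, where `h`, `c`, `ρ` depend on `u`
only. Here `Z = X - c`, and the subscripts of `h`, `c`, `ρ` stand for the order of derivation. -/
structure CircleJet (n Z Xu Xv Xuu Xuv Xvv c₁ c₂ : E31) (h₁ h₂ ρ₁ ρ₂ : ℝ) : Prop where
  u_n : mink Xu n = h₁
  v_n : mink Xv n = 0
  uu_n : mink Xuu n = h₂
  uv_n : mink Xuv n = 0
  vv_n : mink Xvv n = 0
  u_Z : mink (Xu - c₁) Z = ρ₁ / 2
  v_Z : mink Xv Z = 0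
  uu_Z : mink (Xuu - c₂) Z + mink (Xu - c₁) (Xu - c₁) = ρ₂ / 2
  uv_Z : mink Xuv Z + mink (Xu - c₁) Xv = 0
  vv_Z : mink Xvv Z + mink Xv Xv = 0

/-- The component `⟨X_u, X - c⟩` in terms of the family of circles. -/
def radial (Z c₁ : E31) (ρ₁ : ℝ) : ℝ := ρ₁ / 2 + mink c₁ Z

/-- Minus the square of the normal `⟨X_u, Z⟩ n - h₁ Z` of the surface, `Z = X - c`. -/
def normalSq (n Z c₁ : E31) (h₁ ρ₁ : ℝ) : ℝ :=
  2 * mink n Z * h₁ * radial Z c₁ ρ₁ - mink Z Z * h₁ ^ 2 - mink n n * radial Z c₁ ρ₁ ^ 2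

/-- The numerator of the mean curvature. -/
def meanNum (n Z c₁ c₂ : E31) (h₁ h₂ ρ₁ ρ₂ : ℝ) : ℝ :=
  (mink n Z ^ 2 - mink n n * mink Z Z) * radial Z c₁ ρ₁ * h₂ -
    h₁ * ((mink n Z ^ 2 - mink n n * mink Z Z) * (ρ₂ / 2 + mink c₂ Z - mink c₁ c₁)
      + 2 * (mink n Z * radial Z c₁ ρ₁ - mink Z Z * h₁) * mink c₁ n
      + 2 * (mink n Z * h₁ - mink n n * radial Z c₁ ρ₁) * mink c₁ Z
      - 2 * normalSq n Z c₁ h₁ ρ₁)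

/-- The numerator of the Gauss curvature, up to the factor `h₁`. -/
def gaussNum (n Z c₁ c₂ : E31) (h₁ h₂ ρ₁ ρ₂ : ℝ) : ℝ :=
  meanNum n Z c₁ c₂ h₁ h₂ ρ₁ ρ₂ - h₁ * normalSq n Z c₁ h₁ ρ₁ -
    h₁ * ((mink n Z ^ 2 - mink n n * mink Z Z) * mink c₁ c₁ + mink Z Z * mink c₁ n ^ 2
      - 2 * mink n Z * mink c₁ n * mink c₁ Z + mink n n * mink c₁ Z ^ 2)

/-- The fundamental forms of a surface foliated by circles, computed with the unnormalized normal
`X_u ∧ X_v`. -/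
theorem CircleJet.fundamentalForms {n Z Xu Xv Xuu Xuv Xvv c₁ c₂ : E31} {h₁ h₂ ρ₁ ρ₂ : ℝ}
    (J : CircleJet n Z Xu Xv Xuu Xuv Xvv c₁ c₂ h₁ h₂ ρ₁ ρ₂)
    (hG : mink n Z ^ 2 - mink n n * mink Z Z ≠ 0) :
    ∃ τ : ℝ, mink Xv Xv = τ ^ 2 * (mink n Z ^ 2 - mink n n * mink Z Z) ∧
      mink Xu Xu * mink Xv Xv - mink Xu Xv ^ 2 = τ ^ 2 * normalSq n Z c₁ h₁ ρ₁ ∧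
      mink (lcross Xu Xv) Xuu * mink Xv Xv - 2 * mink (lcross Xu Xv) Xuv * mink Xu Xv
        + mink (lcross Xu Xv) Xvv * mink Xu Xu = -τ ^ 3 * meanNum n Z c₁ c₂ h₁ h₂ ρ₁ ρ₂ ∧
      mink (lcross Xu Xv) Xuu * mink (lcross Xu Xv) Xvv - mink (lcross Xu Xv) Xuv ^ 2
        = τ ^ 4 * (h₁ * gaussNum n Z c₁ c₂ h₁ h₂ ρ₁ ρ₂) := by
  obtain ⟨τ, hτ⟩ := exists_eq_smul_lcross hG J.v_n J.v_Z
  refine ⟨τ, ?_⟩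
  have huZ : mink Xu Z = radial Z c₁ ρ₁ := by
    have := J.u_Z; rw [mink_sub_left] at this; rw [radial]; linarith
  have hcr : lcross Xu Xv = -τ • (radial Z c₁ ρ₁ • n - h₁ • Z) := by
    rw [hτ, lcross_smul_right, lcross_lcross, J.u_n, huZ, neg_smul, ← smul_neg, neg_sub]
  have hT : mink (lcross n Z) (lcross n Z) = mink n Z ^ 2 - mink n n * mink Z Z :=
    mink_lcross_self n Z
  have hvv : mink Xv Xv = τ ^ 2 * (mink n Z ^ 2 - mink n n * mink Z Z) := by
    rw [hτ, mink_smul_left, mink_smul_right, hT]; ring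
  have huv : mink Xu Xv = τ * mink Xu (lcross n Z) := by rw [hτ, mink_smul_right]
  have hcv : mink c₁ Xv = τ * mink c₁ (lcross n Z) := by rw [hτ, mink_smul_right]
  have hE := mink_gram n Z Xu Xu
  have hF := mink_gram n Z Xu c₁
  have hC := mink_gram n Z c₁ c₁
  rw [J.u_n, huZ] at hE hF
  have hUU : mink Xuu Z = ρ₂ / 2 + mink c₂ Z - (mink Xu Xu - 2 * mink Xu c₁ + mink c₁ c₁) := by
    have := J.uu_Z
    simp only [mink_sub_left, mink_sub_right] at this
    rw [mink_comm c₁ Xu] at this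
    linarith
  have hUV : mink Xuv Z = -(τ * mink Xu (lcross n Z) - τ * mink c₁ (lcross n Z)) := by
    have := J.uv_Z
    simp only [mink_sub_left] at this
    rw [huv, hcv] at this
    linarith
  have hVV : mink Xvv Z = -(τ ^ 2 * (mink n Z ^ 2 - mink n n * mink Z Z)) := by
    have := J.vv_Z
    rw [hvv] at this
    linarith
  have e1 : mink (lcross Xu Xv) Xuu = -τ * (radial Z c₁ ρ₁ * h₂ - h₁ * mink Xuu Z) := by
    rw [hcr, mink_smul_left, mink_sub_left, mink_smul_left, mink_smul_left, mink_comm n, J.uu_n,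
      mink_comm Z]
  have f1 : mink (lcross Xu Xv) Xuv = -τ * (-h₁ * mink Xuv Z) := by
    rw [hcr, mink_smul_left, mink_sub_left, mink_smul_left, mink_smul_left, mink_comm n, J.uv_n,
      mink_comm Z]; ring
  have g1 : mink (lcross Xu Xv) Xvv = -τ * (-h₁ * mink Xvv Z) := by
    rw [hcr, mink_smul_left, mink_sub_left, mink_smul_left, mink_smul_left, mink_comm n, J.vv_n,
      mink_comm Z]; ring
  rw [e1, f1, g1, hUU, hUV, hVV, hvv, huv]
  unfold gaussNum meanNum normalSq
  set G := mink n Z ^ 2 - mink n n * mink Z Z with hGdef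
  generalize mink Xu (lcross n Z) = φ at *
  generalize mink c₁ (lcross n Z) = μ at *
  generalize mink Xu Xu = E at *
  generalize mink Xu c₁ = F at *
  generalize mink c₁ c₁ = c at *
  generalize radial Z c₁ ρ₁ = l at *
  generalize mink c₁ n = p at *
  generalize mink c₁ Z = x at *
  generalize mink c₂ Z = y at *
  generalize mink Z Z = ρ at *
  generalize mink n n = ε at *
  generalize mink n Z = m at *
  refine ⟨rfl, ?_, ?_, ?_⟩
  · linear_combination τ ^ 2 * hE
  · linear_combination (-τ ^ 3 * 2 * h₁) * hE + (2 * τ ^ 3 * h₁) * hF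
  · linear_combination (τ ^ 4 * h₁ ^ 2) * hE - (2 * τ ^ 4 * h₁ ^ 2) * hF + (τ ^ 4 * h₁ ^ 2) * hC

/-- The mean and Gauss curvatures of a spacelike surface foliated by circles. -/
theorem CircleJet.curvatures {X : ℝ × ℝ → E31} {q : ℝ × ℝ} {n Z c₁ c₂ : E31} {h₁ h₂ ρ₁ ρ₂ : ℝ}
    (J : CircleJet n Z (du X q) (dv X q) (du (du X) q) (dv (du X) q) (dv (dv X) q) c₁ c₂ h₁ h₂ ρ₁ ρ₂)
    (hG : mink n Z ^ 2 - mink n n * mink Z Z ≠ 0)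
    (hI : 0 < ffE X q * ffG X q - ffF X q ^ 2) :
    0 < normalSq n Z c₁ h₁ ρ₁ ∧
    (∃ σ : ℝ, σ ^ 2 = 1 ∧ meanCurvature X q = σ * meanNum n Z c₁ c₂ h₁ h₂ ρ₁ ρ₂ /
      (2 * (normalSq n Z c₁ h₁ ρ₁ * √(normalSq n Z c₁ h₁ ρ₁)))) ∧
    gaussCurvature X q = h₁ * gaussNum n Z c₁ c₂ h₁ h₂ ρ₁ ρ₂ / normalSq n Z c₁ h₁ ρ₁ ^ 2 := by
  obtain ⟨τ, hGG, hdet, hH, hK⟩ := J.fundamentalForms hG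
  rw [ffE, ffG, ffF, hdet] at hI
  have hτ : τ ≠ 0 := by rintro rfl; simp at hI
  have hτ2 : 0 < τ ^ 2 := by positivity
  have hΔ : 0 < normalSq n Z c₁ h₁ ρ₁ := (mul_pos_iff_of_pos_left hτ2).1 hI
  have hN : √|mink (lcross (du X q) (dv X q)) (lcross (du X q) (dv X q))| =
      |τ| * √(normalSq n Z c₁ h₁ ρ₁) := by
    rw [mink_lcross_self, abs_sub_comm, hdet, abs_of_pos hI, Real.sqrt_mul (sq_nonneg τ),
      Real.sqrt_sq_eq_abs]
  have hs : 0 < √(normalSq n Z c₁ h₁ ρ₁) := Real.sqrt_pos.2 hΔ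
  have hs2 : √(normalSq n Z c₁ h₁ ρ₁) ^ 2 = normalSq n Z c₁ h₁ ρ₁ := Real.sq_sqrt hΔ.le
  have ha : 0 < |τ| := abs_pos.2 hτ
  refine ⟨hΔ, ⟨-(τ / |τ|), ?_, ?_⟩, ?_⟩
  · rw [neg_sq, div_pow, sq_abs, div_self hτ2.ne']
  · have hnum : sfe X q * ffG X q - 2 * sff X q * ffF X q + sfg X q * ffE X q =
        (|τ| * √(normalSq n Z c₁ h₁ ρ₁))⁻¹ * (-τ ^ 3 * meanNum n Z c₁ c₂ h₁ h₂ ρ₁ ρ₂) := by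
      rw [← hH, sfe, sff, sfg, unitNormal, hN, mink_smul_left, mink_smul_left, mink_smul_left,
        ffE, ffF, ffG]
      ring
    rw [meanCurvature, hnum, ffE, ffF, ffG, hdet]
    field_simp
  · have hnum : sfe X q * sfg X q - sff X q ^ 2 = ((|τ| * √(normalSq n Z c₁ h₁ ρ₁)) ^ 2)⁻¹ *
        (τ ^ 4 * (h₁ * gaussNum n Z c₁ c₂ h₁ h₂ ρ₁ ρ₂)) := by
      rw [← hK, sfe, sff, sfg, unitNormal, hN, mink_smul_left, mink_smul_left, mink_smul_left]
      ring
    rw [gaussCurvature, hnum, ffE, ffF, ffG, hdet, mul_pow, sq_abs, hs2]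
    field_simp

/-- The linear Weingarten relation, freed from the square root. -/
theorem weingarten_sq {a b k σ Δ A B h : ℝ} (hΔ : 0 < Δ) (hσ : σ ^ 2 = 1)
    (hW : a * (σ * A / (2 * (Δ * √Δ))) + b * (h * B / Δ ^ 2) = k) :
    a ^ 2 * A ^ 2 * Δ = 4 * (k * Δ ^ 2 - b * h * B) ^ 2 := by
  have hs : 0 < √Δ := Real.sqrt_pos.2 hΔ
  have hs2 : √Δ ^ 2 = Δ := Real.sq_sqrt hΔ.le
  have h1 : a * σ * A * √Δ = 2 * (k * Δ ^ 2 - b * h * B) := by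
    rw [← hW]
    field_simp
    rw [hs2]
    ring
  calc a ^ 2 * A ^ 2 * Δ = (a * σ * A * √Δ) ^ 2 := by
        rw [mul_pow, mul_pow, mul_pow, hσ, hs2]; ring
    _ = _ := by rw [h1]; ring

/-! ### Circles in an orthonormal frame -/

/-- An orthonormal frame of Minkowski space, with `e₃` timelike. -/
structure IsFrame (e₁ e₂ e₃ : E31) : Prop where
  m11 : mink e₁ e₁ = 1
  m22 : mink e₂ e₂ = 1
  m33 : mink e₃ e₃ = -1
  m12 : mink e₁ e₂ = 0
  m13 : mink e₁ e₃ = 0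
  m23 : mink e₂ e₃ = 0
  expand : ∀ w, w = mink w e₁ • e₁ + mink w e₂ • e₂ - mink w e₃ • e₃

theorem IsFrame.mink_eq {e₁ e₂ e₃ : E31} (h : IsFrame e₁ e₂ e₃) (v w : E31) :
    mink v w = mink v e₁ * mink w e₁ + mink v e₂ * mink w e₂ - mink v e₃ * mink w e₃ := by
  conv_lhs => rw [h.expand w]
  rw [mink_sub_right, mink_add_right, mink_smul_right, mink_smul_right, mink_smul_right]
  ring

theorem IsLorentz.surjective {L : E31 →ₗ[ℝ] E31} (hL : IsLorentz L) : Function.Surjective L := by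
  refine LinearMap.injective_iff_surjective.1 ((injective_iff_map_eq_zero L).2 fun x hx => ?_)
  have key : ∀ y, mink x y = 0 := fun y => by rw [← hL, hx]; simp [mink]
  ext i
  fin_cases i
  · simpa [mink] using key ![1, 0, 0]
  · simpa [mink] using key ![0, 1, 0]
  · simpa [mink] using key ![0, 0, 1]

theorem IsLorentz.isFrame {L : E31 →ₗ[ℝ] E31} (hL : IsLorentz L) :
    IsFrame (L ![1, 0, 0]) (L ![0, 1, 0]) (L ![0, 0, 1]) := by
  refine ⟨?_, ?_, ?_, ?_, ?_, ?_, fun w => ?_⟩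
  iterate 6 rw [hL]; simp [mink]
  obtain ⟨w, rfl⟩ := hL.surjective w
  rw [hL, hL, hL, ← map_smul, ← map_smul, ← map_smul, ← map_add, ← map_sub]
  congr 1
  ext i
  fin_cases i <;> simp [mink]

/-- The circle of radius `r` about `c` in a spacelike plane. -/
def ellipticCircle (c e₁ e₂ : E31) (r : ℝ) : Set E31 :=
  Set.range fun θ : ℝ => c + ((r * Real.cos θ) • e₁ + (r * Real.sin θ) • e₂)

/-- The circle of radius `r` about `c` in a timelike plane. -/
def hyperbolicCircle (c e₂ e₃ : E31) (r : ℝ) : Set E31 :=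
  Set.range fun t : ℝ => c + ((r * Real.sinh t) • e₂ + (r * Real.cosh t) • e₃)

/-- The parabola in which a lightlike plane intersects the light cone with vertex `c`. -/
def parabolicCircle (c e₁ e₂ e₃ : E31) (r : ℝ) : Set E31 :=
  Set.range fun s : ℝ => c + (s • e₁ + (r * s ^ 2 / 2) • (e₂ + e₃) - (1 / (2 * r)) • (e₂ - e₃))

/-- Every circle is the image of a standard circle under a rigid motion, described by the images of
the origin and of the standard basis. -/
theorem IsCircle.exists_frame {C : Set E31} (hC : IsCircle C) :
    ∃ (e₁ e₂ e₃ c : E31) (r : ℝ), IsFrame e₁ e₂ e₃ ∧ 0 < r ∧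
      (C = ellipticCircle c e₁ e₂ r ∨ C = hyperbolicCircle c e₂ e₃ r ∨
        C = parabolicCircle c e₁ e₂ e₃ r) := by
  obtain ⟨Φ, r, ⟨L, b, hL, hΦ⟩, hr, h⟩ := hC
  have hvec : ∀ x y z : ℝ, L ![x, y, z] =
      x • L ![1, 0, 0] + y • L ![0, 1, 0] + z • L ![0, 0, 1] := fun x y z => by
    rw [← map_smul, ← map_smul, ← map_smul, ← map_add, ← map_add]
    congr 1
    ext i
    fin_cases i <;> simp
  have hS : ∀ s, L (circleS r s) = (r * Real.cos (s / r)) • L ![1, 0, 0] +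
      (r * Real.sin (s / r)) • L ![0, 1, 0] + (0 : ℝ) • L ![0, 0, 1] := fun s => hvec _ _ _
  have hT : ∀ s, L (circleT r s) = (0 : ℝ) • L ![1, 0, 0] + (r * Real.sinh (s / r)) • L ![0, 1, 0] +
      (r * Real.cosh (s / r)) • L ![0, 0, 1] := fun s => hvec _ _ _
  have hl : ∀ s, L (circleL r s) = s • L ![1, 0, 0] + (r * s ^ 2 / 2) • L ![0, 1, 0] +
      (r * s ^ 2 / 2) • L ![0, 0, 1] := fun s => hvec _ _ _
  have hrange : ∀ f g : ℝ → E31, (∀ s, f s = g (s / r)) → Set.range f = Set.range g := by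
    intro f g hfg
    ext x
    constructor
    · rintro ⟨s, rfl⟩
      exact ⟨s / r, (hfg s).symm⟩
    · rintro ⟨s, rfl⟩
      exact ⟨r * s, by rw [hfg, mul_div_cancel_left₀ _ hr.ne']⟩
  rcases h with h | h | h
  · refine ⟨_, _, _, b, r, hL.isFrame, hr, Or.inl ?_⟩
    rw [h, ellipticCircle, ← Set.range_comp]
    refine hrange _ _ fun s => ?_
    simp only [Function.comp, hΦ, hS]; module
  · refine ⟨_, _, _, b, r, hL.isFrame, hr, Or.inr (Or.inl ?_)⟩
    rw [h, hyperbolicCircle, ← Set.range_comp]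
    refine hrange _ _ fun s => ?_
    simp only [Function.comp, hΦ, hT]; module
  · refine ⟨_, _, _, b + (1 / (2 * r)) • (L ![0, 1, 0] - L ![0, 0, 1]), r, hL.isFrame, hr,
      Or.inr (Or.inr ?_)⟩
    rw [h, parabolicCircle, ← Set.range_comp]
    congr 1
    ext1 s
    simp only [Function.comp, hΦ, hl]; module

theorem ellipticCircle.normal {e₁ e₂ e₃ c n : E31} {r : ℝ} (hf : IsFrame e₁ e₂ e₃) (hr : 0 < r)
    (h : ∀ x ∈ ellipticCircle c e₁ e₂ r, ∀ y ∈ ellipticCircle c e₁ e₂ r, mink (x - y) n = 0) :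
    n = -mink n e₃ • e₃ := by
  have h1 := h _ ⟨0, rfl⟩ _ ⟨Real.pi, rfl⟩
  have h2 := h _ ⟨0, rfl⟩ _ ⟨Real.pi / 2, rfl⟩
  simp only [mink_sub_left, mink_add_left, mink_smul_left, Real.cos_zero, Real.sin_zero,
    Real.cos_pi, Real.sin_pi, Real.cos_pi_div_two, Real.sin_pi_div_two] at h1 h2
  have k1 : mink e₁ n = 0 := by
    have : r * mink e₁ n = 0 := by linarith
    simpa [hr.ne'] using this
  have k2 : mink e₂ n = 0 := by
    have : r * mink e₂ n = 0 := by rw [k1] at h2; linarith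
    simpa [hr.ne'] using this
  conv_lhs => rw [hf.expand n, mink_comm n, mink_comm n e₂, k1, k2]
  module

theorem hyperbolicCircle.normal {e₁ e₂ e₃ c n : E31} {r : ℝ} (hf : IsFrame e₁ e₂ e₃) (hr : 0 < r)
    (h : ∀ x ∈ hyperbolicCircle c e₂ e₃ r, ∀ y ∈ hyperbolicCircle c e₂ e₃ r, mink (x - y) n = 0) :
    n = mink n e₁ • e₁ := by
  have h1 := h _ ⟨1, rfl⟩ _ ⟨-1, rfl⟩
  have h2 := h _ ⟨1, rfl⟩ _ ⟨0, rfl⟩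
  simp only [mink_sub_left, mink_add_left, mink_smul_left, Real.cosh_zero, Real.sinh_zero,
    Real.cosh_neg, Real.sinh_neg] at h1 h2
  have hs : 0 < Real.sinh 1 := Real.sinh_pos_iff.2 one_pos
  have hc : 0 < Real.cosh 1 - 1 := sub_pos.2 (Real.one_lt_cosh.2 one_ne_zero)
  have k1 : mink e₂ n = 0 := by
    have : (r * Real.sinh 1) * mink e₂ n = 0 := by linarith
    simpa [hr.ne', hs.ne'] using this
  have k2 : mink e₃ n = 0 := by
    have : (r * (Real.cosh 1 - 1)) * mink e₃ n = 0 := by rw [k1] at h2; linarith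
    simpa [hr.ne', hc.ne'] using this
  conv_lhs => rw [hf.expand n, mink_comm n e₃, mink_comm n e₂, k1, k2]
  module

theorem parabolicCircle.normal {e₁ e₂ e₃ c n : E31} {r : ℝ} (hf : IsFrame e₁ e₂ e₃) (hr : 0 < r)
    (h : ∀ x ∈ parabolicCircle c e₁ e₂ e₃ r, ∀ y ∈ parabolicCircle c e₁ e₂ e₃ r,
      mink (x - y) n = 0) :
    n = mink n e₂ • (e₂ + e₃) := by
  have h1 := h _ ⟨1, rfl⟩ _ ⟨-1, rfl⟩
  have h2 := h _ ⟨1, rfl⟩ _ ⟨0, rfl⟩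
  simp only [mink_sub_left, mink_add_left, mink_smul_left] at h1 h2
  have k1 : mink e₁ n = 0 := by linarith
  have k2 : mink e₃ n = -mink e₂ n := by
    have : r * (mink e₃ n + mink e₂ n) = 0 := by rw [k1] at h2; linarith
    have : mink e₃ n + mink e₂ n = 0 := by simpa [hr.ne'] using this
    linarith
  conv_lhs => rw [hf.expand n, mink_comm n e₁, mink_comm n e₃, k1, k2, mink_comm]
  rw [mink_comm n]
  module

theorem mem_ellipticCircle_iff {e₁ e₂ e₃ c x : E31} {r : ℝ} (hf : IsFrame e₁ e₂ e₃) (hr : 0 < r) :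
    x ∈ ellipticCircle c e₁ e₂ r ↔ mink (x - c) e₃ = 0 ∧ mink (x - c) (x - c) = r ^ 2 := by
  constructor
  · rintro ⟨θ, rfl⟩
    simp only [add_sub_cancel_left]
    rw [hf.mink_eq (_ + _) (_ + _)]
    simp only [mink_add_left, mink_smul_left, hf.m11, hf.m12, hf.m13, hf.m22, hf.m23,
      mink_comm e₂ e₁]
    refine ⟨by ring, ?_⟩
    linear_combination r ^ 2 * Real.sin_sq_add_cos_sq θ
  · rintro ⟨h3, hr2⟩
    rw [hf.mink_eq, h3] at hr2
    set α := mink (x - c) e₁ with hα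
    set β := mink (x - c) e₂ with hβ
    have hnorm : ‖(⟨α, β⟩ : ℂ)‖ = r := by
      rw [← Real.sqrt_sq hr.le, ← hr2, Complex.norm_def, Complex.normSq_mk]
      congr 1; ring
    refine ⟨Complex.arg ⟨α, β⟩, ?_⟩
    have h1 := Complex.norm_mul_cos_arg ⟨α, β⟩
    have h2 := Complex.norm_mul_sin_arg ⟨α, β⟩
    rw [hnorm] at h1 h2
    simp only [h1, h2]
    have := hf.expand (x - c)
    rw [h3, zero_smul, sub_zero, ← hα, ← hβ] at this
    rw [← this, add_sub_cancel]

theorem mem_hyperbolicCircle_iff {e₁ e₂ e₃ c x : E31} {r : ℝ} (hf : IsFrame e₁ e₂ e₃)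
    (hr : 0 < r) :
    x ∈ hyperbolicCircle c e₂ e₃ r ↔
      mink (x - c) e₁ = 0 ∧ mink (x - c) (x - c) = -r ^ 2 ∧ mink (x - c) e₃ < 0 := by
  constructor
  · rintro ⟨θ, rfl⟩
    simp only [add_sub_cancel_left]
    rw [hf.mink_eq (_ + _) (_ + _)]
    simp only [mink_add_left, mink_smul_left, hf.m33, hf.m12, hf.m13, hf.m22, hf.m23,
      mink_comm e₂ e₁, mink_comm e₃ e₁, mink_comm e₃ e₂]
    refine ⟨by ring, ?_, ?_⟩
    · linear_combination -r ^ 2 * Real.cosh_sq θ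
    · have := mul_pos hr (Real.cosh_pos θ)
      linarith
  · rintro ⟨h3, hr2, hneg⟩
    rw [hf.mink_eq, h3] at hr2
    set α := mink (x - c) e₂ with hα
    set β := mink (x - c) e₃ with hβ
    have h1 : r * Real.sinh (Real.arsinh (α / r)) = α := by
      rw [Real.sinh_arsinh]; field_simp
    have h2 : r * Real.cosh (Real.arsinh (α / r)) = -β := by
      refine (pow_left_inj₀ (mul_pos hr (Real.cosh_pos _)).le (by linarith) two_ne_zero).1 ?_
      rw [mul_pow, Real.cosh_sq, mul_add, ← mul_pow, h1]
      linarith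
    refine ⟨Real.arsinh (α / r), ?_⟩
    simp only [h1, h2]
    have := hf.expand (x - c)
    rw [h3, zero_smul, zero_add, ← hα, ← hβ] at this
    rw [neg_smul, ← sub_eq_add_neg, ← this, add_sub_cancel]

theorem mem_parabolicCircle_iff {e₁ e₂ e₃ c x : E31} {r : ℝ} (hf : IsFrame e₁ e₂ e₃)
    (hr : 0 < r) :
    x ∈ parabolicCircle c e₁ e₂ e₃ r ↔
      mink (x - c) (e₂ + e₃) = -1 / r ∧ mink (x - c) (x - c) = 0 := by
  have hr' := hr.ne'
  constructor
  · rintro ⟨s, rfl⟩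
    simp only [add_sub_cancel_left]
    rw [hf.mink_eq (_ - _) (_ - _)]
    simp only [mink_add_left, mink_sub_left, mink_smul_left, hf.m33, hf.m12, hf.m13, hf.m22,
      hf.m23, hf.m11, mink_comm e₂ e₁, mink_comm e₃ e₁, mink_comm e₃ e₂, mink_add_right]
    constructor
    · field_simp; ring
    · field_simp; ring
  · rintro ⟨h3, h0⟩
    rw [mink_add_right] at h3
    rw [hf.mink_eq] at h0
    refine ⟨mink (x - c) e₁, ?_⟩
    have hx := hf.expand (x - c)
    set α := mink (x - c) e₁ with hα
    set β := mink (x - c) e₂ with hβ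
    set γ := mink (x - c) e₃ with hγ
    have hd : β - γ = r * α ^ 2 := by
      have : (β - γ) * (β + γ) = -α ^ 2 := by linear_combination h0
      rw [h3] at this
      field_simp at this
      linarith
    have hb : β = r * α ^ 2 / 2 - 1 / (2 * r) := by
      have : β = ((β - γ) + (β + γ)) / 2 := by ring
      rw [this, hd, h3]; field_simp; ring
    have hc : γ = -(r * α ^ 2 / 2) - 1 / (2 * r) := by
      have : γ = ((β + γ) - (β - γ)) / 2 := by ring
      rw [this, hd, h3]; field_simp; ring
    have : x = c + (x - c) := by abel
    conv_rhs => rw [this, hx, hb, hc]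
    module

/-! ### Rotations and normal vectors -/

/-- `C` is a circle in a plane orthogonal to `n` with center `c`; for a lightlike plane, `c` is the
vertex of the light cone that meets the plane in `C`. -/
def IsCircleAbout (n c : E31) (C : Set E31) : Prop :=
  ∃ (e₁ e₂ e₃ : E31) (r t : ℝ), IsFrame e₁ e₂ e₃ ∧ 0 < r ∧ t ≠ 0 ∧
    ((n = t • e₃ ∧ C = ellipticCircle c e₁ e₂ r) ∨ (n = t • e₁ ∧ C = hyperbolicCircle c e₂ e₃ r) ∨
      (n = t • (e₂ + e₃) ∧ C = parabolicCircle c e₁ e₂ e₃ r))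

theorem IsCircle.exists_isCircleAbout {C : Set E31} (hC : IsCircle C) {n : E31} (hn : n ≠ 0)
    (h : ∀ x ∈ C, ∀ y ∈ C, mink (x - y) n = 0) : ∃ c, IsCircleAbout n c C := by
  obtain ⟨e₁, e₂, e₃, c, r, hf, hr, rfl | rfl | rfl⟩ := hC.exists_frame
  · have hn' := ellipticCircle.normal hf hr h
    refine ⟨c, e₁, e₂, e₃, r, _, hf, hr, fun h0 => hn ?_, Or.inl ⟨hn', rfl⟩⟩
    rw [hn', h0, zero_smul]
  · have hn' := hyperbolicCircle.normal hf hr h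
    refine ⟨c, e₁, e₂, e₃, r, _, hf, hr, fun h0 => hn ?_, Or.inr (Or.inl ⟨hn', rfl⟩)⟩
    rw [hn', h0, zero_smul]
  · have hn' := parabolicCircle.normal hf hr h
    refine ⟨c, e₁, e₂, e₃, r, _, hf, hr, fun h0 => hn ?_, Or.inr (Or.inr ⟨hn', rfl⟩)⟩
    rw [hn', h0, zero_smul]

/-- Timelike vectors have negative scalar product if and only if they lie in the same half of the
light cone; this is the reversed Cauchy-Schwarz inequality. -/
theorem mink_neg_iff_of_timelike {z w : E31} (hz : mink z z < 0) (hw : mink w w < 0) :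
    mink z w < 0 ↔ 0 < z 2 * w 2 := by
  simp only [mink] at *
  have h1 : (z 0 * w 0 + z 1 * w 1) ^ 2 < (z 2 * w 2) ^ 2 := by
    have hw2 : 0 < w 2 ^ 2 := by nlinarith [sq_nonneg (w 0), sq_nonneg (w 1)]
    calc (z 0 * w 0 + z 1 * w 1) ^ 2 ≤ (z 0 ^ 2 + z 1 ^ 2) * (w 0 ^ 2 + w 1 ^ 2) := by
          nlinarith [sq_nonneg (z 0 * w 1 - z 1 * w 0)]
      _ ≤ (z 0 ^ 2 + z 1 ^ 2) * w 2 ^ 2 :=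
          mul_le_mul_of_nonneg_left (by nlinarith) (by positivity)
      _ < z 2 ^ 2 * w 2 ^ 2 := mul_lt_mul_of_pos_right (by nlinarith) hw2
      _ = _ := by ring
  have h2 := abs_lt.1 (sq_lt_sq.1 h1)
  constructor
  · intro h
    by_contra hcon
    rw [abs_of_nonpos (not_lt.1 hcon)] at h2
    linarith
  · intro h
    rw [abs_of_pos h] at h2
    linarith

/-- An orthochronous Lorentz transformation preserves the two halves of the light cone. -/
theorem IsLorentz.mink_map_neg_iff {L : E31 →ₗ[ℝ] E31} (hL : IsLorentz L)
    (ht : 0 < L ![0, 0, 1] 2) {z w : E31} (hz : mink z z < 0) (hw : mink w w < 0) :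
    mink (L z) w < 0 ↔ mink z w < 0 := by
  have hLz : mink (L z) (L z) < 0 := by rwa [hL]
  have hf : mink ![0, 0, 1] ![0, 0, 1] < 0 := by simp [mink]
  have hLf : mink (L ![0, 0, 1]) (L ![0, 0, 1]) < 0 := by rwa [hL]
  have key := mink_neg_iff_of_timelike hLz hLf
  rw [hL, mink_neg_iff_of_timelike hz hf, mul_pos_iff_of_pos_right ht] at key
  simp only [Matrix.cons_val, mul_one] at key
  have hz2 : z 2 ≠ 0 := fun h => by
    simp only [mink, h] at hz; nlinarith [sq_nonneg (z 0), sq_nonneg (z 1)]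
  have hLz2 : L z 2 ≠ 0 := fun h => by
    simp only [mink, h] at hLz; nlinarith [sq_nonneg (L z 0), sq_nonneg (L z 1)]
  rw [mink_neg_iff_of_timelike hLz hw, mink_neg_iff_of_timelike hz hw]
  rcases lt_or_gt_of_ne hz2 with h | h
  · have h' : L z 2 < 0 := lt_of_le_of_ne (not_lt.1 fun h' => absurd (key.2 h') h.not_gt) hLz2
    rw [mul_pos_iff, mul_pos_iff]
    simp [h, h', h.not_gt, h'.not_gt]
  · have h' := key.1 h
    rw [mul_pos_iff_of_pos_left h, mul_pos_iff_of_pos_left h']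

/-- A circle with normal `n` and center on the line `p + ℝ n` is invariant under the rotations
about this line. -/
theorem IsCircleAbout.image_rotation {n c p : E31} {C : Set E31} (hC : IsCircleAbout n c C)
    {s : ℝ} (hc : c = p + s • n) {Φ : E31 → E31} (hΦ : IsRotationAbout p n Φ) : Φ '' C = C := by
  obtain ⟨⟨L, b, hL, -, ht, hLb⟩, hfix⟩ := hΦ
  have hcfix : Φ c = c := by rw [hc, hfix]
  have hLn : L n = n := by
    have h0 := hfix 0
    have h1 := hfix 1
    simp only [hLb, zero_smul, add_zero, one_smul, map_add] at h0 h1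
    rw [add_right_comm, h0] at h1
    exact add_left_cancel h1
  have hsub : ∀ x, Φ x - c = L (x - c) := fun x => by
    rw [map_sub]
    conv_lhs => rw [← hcfix, hLb, hLb]
    abel
  have hsurj : ∀ y, ∃ x, Φ x = y := fun y => by
    obtain ⟨x, hx⟩ := hL.surjective (y - b)
    exact ⟨x, by rw [hLb, hx, sub_add_cancel]⟩
  have himage : (∀ x, Φ x ∈ C ↔ x ∈ C) → Φ '' C = C := fun h => by
    ext y
    constructor
    · rintro ⟨x, hx, rfl⟩
      exact (h x).2 hx
    · intro hy
      obtain ⟨x, rfl⟩ := hsurj y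
      exact ⟨x, (h x).1 hy, rfl⟩
  refine himage fun x => ?_
  have hnormal : ∀ {v : E31} {t : ℝ}, t ≠ 0 → n = t • v → mink (L (x - c)) v = mink (x - c) v := by
    intro v t ht0 hv
    have : mink (L (x - c)) n = mink (x - c) n := by
      conv_lhs => rw [← hLn]
      rw [hL]
    rw [hv, mink_smul_right, mink_smul_right] at this
    exact mul_left_cancel₀ ht0 this
  obtain ⟨e₁, e₂, e₃, r, t, hf, hr, ht0, ⟨hn, rfl⟩ | ⟨hn, rfl⟩ | ⟨hn, rfl⟩⟩ := hC
  · rw [mem_ellipticCircle_iff hf hr, mem_ellipticCircle_iff hf hr, hsub, hL, hnormal ht0 hn]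
  · rw [mem_hyperbolicCircle_iff hf hr, mem_hyperbolicCircle_iff hf hr, hsub, hL, hnormal ht0 hn]
    refine and_congr_right fun _ => and_congr_right fun hQ => ?_
    exact hL.mink_map_neg_iff ht (by rw [hQ]; nlinarith) (by rw [hf.m33]; norm_num)
  · rw [mem_parabolicCircle_iff hf hr, mem_parabolicCircle_iff hf hr, hsub, hL, hnormal ht0 hn]

/-- Every plane has a normal vector. -/
theorem exists_normal (P : Submodule ℝ E31) (hP : Module.finrank ℝ P = 2) :
    ∃ n : E31, n ≠ 0 ∧ ∀ x ∈ P, mink x n = 0 := by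
  have hlt : P < ⊤ := by
    refine lt_top_iff_ne_top.2 fun h => ?_
    rw [h, finrank_top] at hP
    simp at hP
  obtain ⟨f, hf, hle⟩ := Submodule.exists_le_ker_of_lt_top P hlt
  have hfx : ∀ x : E31, f x = mink x ![f ![1, 0, 0], f ![0, 1, 0], -f ![0, 0, 1]] := fun x => by
    have hx : x = x 0 • ![1, 0, 0] + x 1 • ![0, 1, 0] + x 2 • ![0, 0, 1] := by
      ext i; fin_cases i <;> simp
    conv_lhs => rw [hx]
    simp only [map_add, map_smul, smul_eq_mul, mink, Matrix.cons_val]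
    ring
  refine ⟨_, fun h0 => hf ?_, fun x hx => (hfx x).symm.trans (hle hx)⟩
  refine LinearMap.ext fun x => ?_
  rw [hfx, h0]
  simp [mink]

/-- The normal vector can be normalized unless it is lightlike. -/
theorem exists_unit_normal (P : Submodule ℝ E31) (hP : Module.finrank ℝ P = 2) :
    ∃ n : E31, n ≠ 0 ∧ (∀ x ∈ P, mink x n = 0) ∧
      (mink n n = -1 ∨ mink n n = 1 ∨ mink n n = 0) := by
  obtain ⟨n, hn, h⟩ := exists_normal P hP
  by_cases h0 : mink n n = 0
  · exact ⟨n, hn, h, Or.inr (Or.inr h0)⟩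
  have hs : √|mink n n| ≠ 0 := (Real.sqrt_pos.2 (abs_pos.2 h0)).ne'
  have hs2 : √|mink n n| * √|mink n n| = |mink n n| := Real.mul_self_sqrt (abs_nonneg _)
  refine ⟨(√|mink n n|)⁻¹ • n, smul_ne_zero (inv_ne_zero hs) hn,
    fun x hx => by rw [mink_smul_right, h x hx, mul_zero], ?_⟩
  rw [mink_smul_left, mink_smul_right, ← mul_assoc, ← mul_inv, hs2]
  rcases lt_or_gt_of_ne h0 with hneg | hpos
  · left; rw [abs_of_neg hneg]; field_simp
  · right; left; rw [abs_of_pos hpos]; field_simp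

/-! ### Identities between Laurent polynomials -/

open Polynomial in
theorem coeffs_eq_zero_of_infinite {K : Type*} [Field K] {S : Set K} (hS : S.Infinite)
    {a₀ a₁ a₂ a₃ a₄ a₅ a₆ a₇ a₈ : K}
    (h : ∀ z ∈ S, a₀ + a₁ * z + a₂ * z ^ 2 + a₃ * z ^ 3 + a₄ * z ^ 4 + a₅ * z ^ 5 + a₆ * z ^ 6
      + a₇ * z ^ 7 + a₈ * z ^ 8 = 0) :
    a₀ = 0 ∧ a₁ = 0 ∧ a₂ = 0 ∧ a₃ = 0 ∧ a₄ = 0 ∧ a₅ = 0 ∧ a₆ = 0 ∧ a₇ = 0 ∧ a₈ = 0 := by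
  have hp : C a₀ + C a₁ * X + C a₂ * X ^ 2 + C a₃ * X ^ 3 + C a₄ * X ^ 4 + C a₅ * X ^ 5
      + C a₆ * X ^ 6 + C a₇ * X ^ 7 + C a₈ * X ^ 8 = 0 :=
    eq_zero_of_infinite_isRoot _ (hS.mono fun z hz => by
      simpa [IsRoot] using h z hz)
  have hc := fun i => congrArg (fun p => coeff p i) hp
  refine ⟨?_, ?_, ?_, ?_, ?_, ?_, ?_, ?_, ?_⟩
  · simpa [coeff_X, coeff_C] using hc 0
  · simpa [coeff_X, coeff_C] using hc 1
  · simpa [coeff_X, coeff_C] using hc 2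
  · simpa [coeff_X, coeff_C] using hc 3
  · simpa [coeff_X, coeff_C] using hc 4
  · simpa [coeff_X, coeff_C] using hc 5
  · simpa [coeff_X, coeff_C] using hc 6
  · simpa [coeff_X, coeff_C] using hc 7
  · simpa [coeff_X, coeff_C] using hc 8

open Polynomial in
/-- If the square of `V` has degree less than `2 n`, then `V` has no coefficient in degree `n`. -/
theorem coeff_eq_zero_of_sq {K : Type*} [Field K] {S : Set K} (hS : S.Infinite) {U V : K[X]} {n : ℕ}
    (h : ∀ z ∈ S, U.eval z = V.eval z ^ 2) (hU : U.natDegree < 2 * n) : V.coeff n = 0 := by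
  have hUV : U = V ^ 2 := eq_of_infinite_eval_eq _ _ (hS.mono fun z hz => by
    simpa using h z hz)
  rw [hUV, natDegree_pow] at hU
  exact coeff_eq_zero_of_natDegree_lt (by omega)

open Polynomial in
/-- The Weingarten relation with nonzero constant `κ`: its right-hand side has degree `8`, unless
`A = 0`, and its left-hand side has degree at most `4`. -/
theorem laurent_leading_eq_zero {K : Type*} [Field K] {S : Set K} (hS : S.Infinite)
    {k p₀ p₁ p₂ q₀ q₁ q₂ l A B G ε κ : K} (hε : ε ≠ 0) (hκ : κ ≠ 0)
    (h : ∀ z ∈ S, z ≠ 0 ∧ k * (p₀ + p₁ * z + p₂ * z⁻¹) ^ 2 * (ε * (G - (l + A * z + B * z⁻¹) ^ 2)) =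
      (κ * (ε * (G - (l + A * z + B * z⁻¹) ^ 2)) ^ 2 - (q₀ + q₁ * z + q₂ * z⁻¹)) ^ 2) : A = 0 := by
  have key := coeff_eq_zero_of_sq (n := 8) hS
    (U := C k * (C p₀ * X + C p₁ * X ^ 2 + C p₂) ^ 2 *
      (C ε * (C G * X ^ 2 - (C l * X + C A * X ^ 2 + C B) ^ 2)) * X ^ 4)
    (V := C κ * (C ε * (C G * X ^ 2 - (C l * X + C A * X ^ 2 + C B) ^ 2)) ^ 2 -
      (C q₀ * X + C q₁ * X ^ 2 + C q₂) * X ^ 3) ?_ ?_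
  · have hc : (C κ * (C ε * (C G * X ^ 2 - (C l * X + C A * X ^ 2 + C B) ^ 2)) ^ 2 -
        (C q₀ * X + C q₁ * X ^ 2 + C q₂) * X ^ 3).coeff 8 = κ * (ε * (0 - A ^ 2)) ^ 2 := by
      compute_degree!
    rw [hc] at key
    simpa [hε, hκ] using key
  · intro z hz
    obtain ⟨hz0, hz⟩ := h z hz
    simp only [eval_mul, eval_sub, eval_add, eval_pow, eval_C, eval_X]
    have h1 : p₀ * z + p₁ * z ^ 2 + p₂ = z * (p₀ + p₁ * z + p₂ * z⁻¹) := by field_simp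
    have h2 : q₀ * z + q₁ * z ^ 2 + q₂ = z * (q₀ + q₁ * z + q₂ * z⁻¹) := by field_simp
    have h3 : ε * (G * z ^ 2 - (l * z + A * z ^ 2 + B) ^ 2) =
        z ^ 2 * (ε * (G - (l + A * z + B * z⁻¹) ^ 2)) := by field_simp
    rw [h1, h2, h3]
    linear_combination z ^ 8 * hz
  · refine lt_of_le_of_lt (b := 12) ?_ (by norm_num)
    compute_degree!

/-- The version of `laurent_leading_eq_zero` for both ends of the Laurent polynomial. -/
theorem laurent_const_ne_zero {K : Type*} [Field K] {S : Set K} (hS : S.Infinite)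
    {k p₀ p₁ p₂ q₀ q₁ q₂ l A B G ε κ : K} (hε : ε ≠ 0) (hκ : κ ≠ 0)
    (h : ∀ z ∈ S, z ≠ 0 ∧ k * (p₀ + p₁ * z + p₂ * z⁻¹) ^ 2 * (ε * (G - (l + A * z + B * z⁻¹) ^ 2)) =
      (κ * (ε * (G - (l + A * z + B * z⁻¹) ^ 2)) ^ 2 - (q₀ + q₁ * z + q₂ * z⁻¹)) ^ 2) :
    A = 0 ∧ B = 0 := by
  refine ⟨laurent_leading_eq_zero hS hε hκ h, laurent_leading_eq_zero (k := k) (p₀ := p₀) (p₁ := p₂)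
    (p₂ := p₁) (q₀ := q₀) (q₁ := q₂) (q₂ := q₁) (l := l) (A := B) (B := A) (G := G)
    (hS.image inv_injective.injOn) hε hκ ?_⟩
  rintro _ ⟨z, hz, rfl⟩
  obtain ⟨hz0, hz⟩ := h z hz
  refine ⟨inv_ne_zero hz0, ?_⟩
  rw [inv_inv, add_right_comm p₀, add_right_comm l, add_right_comm q₀]
  exact hz

/-- The Weingarten relation with constant `0`: comparison of the coefficients, in the order of
increasing degree from `-4` to `4`. -/
theorem laurent_sq {K : Type*} [Field K] {S : Set K} (hS : S.Infinite)
    {η p₀ p₁ p₂ q₀ q₁ q₂ l A B G : K}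
    (h : ∀ z ∈ S, z ≠ 0 ∧ η * (p₀ + p₁ * z + p₂ * z⁻¹) ^ 2 * ((l + A * z + B * z⁻¹) ^ 2 - G) =
      (q₀ + q₁ * z + q₂ * z⁻¹) ^ 2) :
    η * p₂ ^ 2 * B ^ 2 = 0 ∧
    η * (2 * p₀ * p₂ * B ^ 2 + p₂ ^ 2 * (2 * l * B)) = 0 ∧
    η * ((p₀ ^ 2 + 2 * p₁ * p₂) * B ^ 2 + 2 * p₀ * p₂ * (2 * l * B)
      + p₂ ^ 2 * (l ^ 2 + 2 * A * B - G)) = q₂ ^ 2 ∧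
    η * (2 * p₀ * p₁ * B ^ 2 + (p₀ ^ 2 + 2 * p₁ * p₂) * (2 * l * B)
      + 2 * p₀ * p₂ * (l ^ 2 + 2 * A * B - G) + p₂ ^ 2 * (2 * l * A)) = 2 * q₀ * q₂ ∧
    η * (p₁ ^ 2 * B ^ 2 + 2 * p₀ * p₁ * (2 * l * B) + (p₀ ^ 2 + 2 * p₁ * p₂) *
      (l ^ 2 + 2 * A * B - G) + 2 * p₀ * p₂ * (2 * l * A) + p₂ ^ 2 * A ^ 2) =
      q₀ ^ 2 + 2 * q₁ * q₂ ∧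
    η * (2 * p₀ * p₂ * A ^ 2 + (p₀ ^ 2 + 2 * p₁ * p₂) * (2 * l * A)
      + 2 * p₀ * p₁ * (l ^ 2 + 2 * A * B - G) + p₁ ^ 2 * (2 * l * B)) = 2 * q₀ * q₁ ∧
    η * ((p₀ ^ 2 + 2 * p₁ * p₂) * A ^ 2 + 2 * p₀ * p₁ * (2 * l * A)
      + p₁ ^ 2 * (l ^ 2 + 2 * A * B - G)) = q₁ ^ 2 ∧
    η * (2 * p₀ * p₁ * A ^ 2 + p₁ ^ 2 * (2 * l * A)) = 0 ∧
    η * p₁ ^ 2 * A ^ 2 = 0 := by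
  have key := coeffs_eq_zero_of_infinite hS
    (a₀ := η * p₂ ^ 2 * B ^ 2)
    (a₁ := η * (2 * p₀ * p₂ * B ^ 2 + p₂ ^ 2 * (2 * l * B)))
    (a₂ := η * ((p₀ ^ 2 + 2 * p₁ * p₂) * B ^ 2 + 2 * p₀ * p₂ * (2 * l * B)
      + p₂ ^ 2 * (l ^ 2 + 2 * A * B - G)) - q₂ ^ 2)
    (a₃ := η * (2 * p₀ * p₁ * B ^ 2 + (p₀ ^ 2 + 2 * p₁ * p₂) * (2 * l * B)
      + 2 * p₀ * p₂ * (l ^ 2 + 2 * A * B - G) + p₂ ^ 2 * (2 * l * A)) - 2 * q₀ * q₂)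
    (a₄ := η * (p₁ ^ 2 * B ^ 2 + 2 * p₀ * p₁ * (2 * l * B) + (p₀ ^ 2 + 2 * p₁ * p₂) *
      (l ^ 2 + 2 * A * B - G) + 2 * p₀ * p₂ * (2 * l * A) + p₂ ^ 2 * A ^ 2) -
      (q₀ ^ 2 + 2 * q₁ * q₂))
    (a₅ := η * (2 * p₀ * p₂ * A ^ 2 + (p₀ ^ 2 + 2 * p₁ * p₂) * (2 * l * A)
      + 2 * p₀ * p₁ * (l ^ 2 + 2 * A * B - G) + p₁ ^ 2 * (2 * l * B)) - 2 * q₀ * q₁)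
    (a₆ := η * ((p₀ ^ 2 + 2 * p₁ * p₂) * A ^ 2 + 2 * p₀ * p₁ * (2 * l * A)
      + p₁ ^ 2 * (l ^ 2 + 2 * A * B - G)) - q₁ ^ 2)
    (a₇ := η * (2 * p₀ * p₁ * A ^ 2 + p₁ ^ 2 * (2 * l * A)))
    (a₈ := η * p₁ ^ 2 * A ^ 2) ?_
  · simpa only [sub_eq_zero] using key
  · intro z hz
    obtain ⟨hz0, hz⟩ := h z hz
    have h1 : p₀ * z + p₁ * z ^ 2 + p₂ = z * (p₀ + p₁ * z + p₂ * z⁻¹) := by field_simp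
    have h2 : q₀ * z + q₁ * z ^ 2 + q₂ = z * (q₀ + q₁ * z + q₂ * z⁻¹) := by field_simp
    have h3 : l * z + A * z ^ 2 + B = z * (l + A * z + B * z⁻¹) := by field_simp
    have e : η * (p₀ * z + p₁ * z ^ 2 + p₂) ^ 2 * ((l * z + A * z ^ 2 + B) ^ 2 - G * z ^ 2) =
        z ^ 2 * (q₀ * z + q₁ * z ^ 2 + q₂) ^ 2 := by
      rw [h1, h2, h3]
      linear_combination z ^ 4 * hz
    linear_combination e

/-! ### The Weingarten relation on a conic -/

/-- Points of the unit circle are complex numbers `z` with `z⁻¹` equal to the conjugate of `z`. -/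
theorem unit_circle_param {C S : ℝ} (h : C ^ 2 + S ^ 2 = 1) :
    (⟨C, S⟩ : ℂ) ≠ 0 ∧ ((⟨C, S⟩ : ℂ))⁻¹ = ⟨C, -S⟩ := by
  have h1 : (⟨C, S⟩ : ℂ) * ⟨C, -S⟩ = 1 := by
    apply Complex.ext
    · simp; linarith
    · simp; ring
  exact ⟨left_ne_zero_of_mul_eq_one h1, inv_eq_of_mul_eq_one_right h1⟩

theorem unit_circle_linear (x₀ x₁ x₂ : ℝ) {C S : ℝ} (h : C ^ 2 + S ^ 2 = 1) :
    ((x₀ + x₁ * C + x₂ * S : ℝ) : ℂ) =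
      x₀ + ⟨x₁ / 2, -x₂ / 2⟩ * (⟨C, S⟩ : ℂ) + ⟨x₁ / 2, x₂ / 2⟩ * (⟨C, S⟩ : ℂ)⁻¹ := by
  rw [(unit_circle_param h).2]
  apply Complex.ext
  · simp; ring
  · simp; ring

theorem infinite_complex_image {T : Set (ℝ × ℝ)} (hT : T.Infinite) :
    ((fun w : ℝ × ℝ => (⟨w.1, w.2⟩ : ℂ)) '' T).Infinite :=
  hT.image (Function.Injective.injOn fun a b h => by
    simp only [Complex.mk.injEq] at h
    exact Prod.ext h.1 h.2)

/-- On the unit circle, the Weingarten relation with nonzero constant forces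
`λ = l + k₁ w₁ + k₂ w₂` to be constant. -/
theorem elliptic_const_ne_zero {T : Set (ℝ × ℝ)} (hT : T.Infinite)
    {a b k π₀ π₁ π₂ χ₀ χ₁ χ₂ l k₁ k₂ G : ℝ} (hk : k ≠ 0)
    (h : ∀ w ∈ T, w.1 ^ 2 + w.2 ^ 2 = 1 ∧
      a * (π₀ + π₁ * w.1 + π₂ * w.2) ^ 2 * ((l + k₁ * w.1 + k₂ * w.2) ^ 2 - G) =
      4 * (k * ((l + k₁ * w.1 + k₂ * w.2) ^ 2 - G) ^ 2 - b * (χ₀ + χ₁ * w.1 + χ₂ * w.2)) ^ 2) :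
    k₁ = 0 ∧ k₂ = 0 := by
  have key := laurent_leading_eq_zero (infinite_complex_image hT)
    (k := a) (p₀ := π₀) (p₁ := ⟨π₁ / 2, -π₂ / 2⟩) (p₂ := ⟨π₁ / 2, π₂ / 2⟩)
    (q₀ := 2 * b * χ₀) (q₁ := 2 * b * ⟨χ₁ / 2, -χ₂ / 2⟩) (q₂ := 2 * b * ⟨χ₁ / 2, χ₂ / 2⟩)
    (l := l) (A := ⟨k₁ / 2, -k₂ / 2⟩) (B := ⟨k₁ / 2, k₂ / 2⟩) (G := G) (ε := -1) (κ := 2 * k)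
    (by norm_num) (by simpa using hk) ?_
  · rw [Complex.ext_iff] at key
    simp only [Complex.zero_re, Complex.zero_im] at key
    exact ⟨by linarith [key.1], by linarith [key.2]⟩
  · rintro _ ⟨w, hw, rfl⟩
    obtain ⟨h1, h2⟩ := h w hw
    refine ⟨(unit_circle_param h1).1, ?_⟩
    have h3 := congrArg (fun x : ℝ => (x : ℂ)) h2
    have e1 := unit_circle_linear π₀ π₁ π₂ h1
    have e2 := unit_circle_linear χ₀ χ₁ χ₂ h1
    have e3 := unit_circle_linear l k₁ k₂ h1
    simp only [Complex.ofReal_mul, Complex.ofReal_pow, Complex.ofReal_sub] at h3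
    rw [e1, e2, e3] at h3
    push_cast at h3
    have e4 : 2 * b * χ₀ + 2 * b * ⟨χ₁ / 2, -χ₂ / 2⟩ * (⟨w.1, w.2⟩ : ℂ) +
        2 * b * ⟨χ₁ / 2, χ₂ / 2⟩ * (⟨w.1, w.2⟩ : ℂ)⁻¹ = 2 * b * (χ₀ +
        ⟨χ₁ / 2, -χ₂ / 2⟩ * (⟨w.1, w.2⟩ : ℂ) + ⟨χ₁ / 2, χ₂ / 2⟩ * (⟨w.1, w.2⟩ : ℂ)⁻¹) := by ring
    rw [e4]
    generalize (π₀ + _ + _ : ℂ) = P at h3 ⊢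
    generalize (χ₀ + _ + _ : ℂ) = Q at h3 ⊢
    generalize (l + _ + _ : ℂ) = R at h3 ⊢
    linear_combination h3

/-- On the unit circle, the Weingarten relation with constant zero forces both sides to vanish, unless
`λ = l + k₁ w₁ + k₂ w₂` is constant. Over the complex numbers `λ² - G` may be a square up to a constant factor, so the
proof uses that the coefficients in opposite degrees are conjugate. -/
theorem elliptic_const_zero {T : Set (ℝ × ℝ)} (hT : T.Infinite)
    {η π₀ π₁ π₂ χ₀ χ₁ χ₂ l k₁ k₂ G : ℝ} (hη : 0 < η) (hG : 0 < G) (hk : k₁ ^ 2 + k₂ ^ 2 ≠ 0)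
    (h : ∀ w ∈ T, w.1 ^ 2 + w.2 ^ 2 = 1 ∧
      η * (π₀ + π₁ * w.1 + π₂ * w.2) ^ 2 * ((l + k₁ * w.1 + k₂ * w.2) ^ 2 - G) =
      (χ₀ + χ₁ * w.1 + χ₂ * w.2) ^ 2) :
    (π₀ = 0 ∧ π₁ = 0 ∧ π₂ = 0) ∧ χ₀ = 0 ∧ χ₁ = 0 ∧ χ₂ = 0 := by
  obtain ⟨-, -, -, -, c4, c5, c6, -, c8⟩ := laurent_sq (infinite_complex_image hT)
    (η := η) (p₀ := π₀) (p₁ := ⟨π₁ / 2, -π₂ / 2⟩) (p₂ := ⟨π₁ / 2, π₂ / 2⟩)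
    (q₀ := χ₀) (q₁ := ⟨χ₁ / 2, -χ₂ / 2⟩) (q₂ := ⟨χ₁ / 2, χ₂ / 2⟩)
    (l := l) (A := ⟨k₁ / 2, -k₂ / 2⟩) (B := ⟨k₁ / 2, k₂ / 2⟩) (G := G) (by
      rintro _ ⟨w, hw, rfl⟩
      obtain ⟨h1, h2⟩ := h w hw
      refine ⟨(unit_circle_param h1).1, ?_⟩
      have h3 := congrArg (fun x : ℝ => (x : ℂ)) h2
      have e1 := unit_circle_linear π₀ π₁ π₂ h1
      have e2 := unit_circle_linear χ₀ χ₁ χ₂ h1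
      have e3 := unit_circle_linear l k₁ k₂ h1
      simp only [Complex.ofReal_mul, Complex.ofReal_pow, Complex.ofReal_sub] at h3
      rw [e1, e2, e3] at h3
      exact h3)
  have hA : (⟨k₁ / 2, -k₂ / 2⟩ : ℂ) ≠ 0 := fun h0 => hk (by
    rw [Complex.ext_iff] at h0
    simp only [Complex.zero_re, Complex.zero_im] at h0
    have e1 : k₁ = 0 := by linarith [h0.1]
    have e2 : k₂ = 0 := by linarith [h0.2]
    simp [e1, e2])
  have hη' : (η : ℂ) ≠ 0 := by exact_mod_cast hη.ne'
  have hp : (⟨π₁ / 2, -π₂ / 2⟩ : ℂ) = 0 := by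
    simpa [hη', hA] using c8
  obtain ⟨hp1, hp2⟩ := Complex.ext_iff.1 hp
  simp only [Complex.zero_re, Complex.zero_im] at hp1 hp2
  have hπ1 : π₁ = 0 := by linarith
  have hπ2 : π₂ = 0 := by linarith
  subst hπ1 hπ2
  -- the remaining coefficients, split into real and imaginary parts
  have r4 := congrArg Complex.re c4
  have r5 := congrArg Complex.re c5
  have i5 := congrArg Complex.im c5
  have r6 := congrArg Complex.re c6
  have i6 := congrArg Complex.im c6
  simp [pow_two] at r4 r5 i5 r6 i6
  have hsum : χ₁ ^ 2 + χ₂ ^ 2 = η * π₀ ^ 2 * (k₁ ^ 2 + k₂ ^ 2) := by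
    refine (pow_left_inj₀ (by positivity) (by positivity) two_ne_zero).1 ?_
    have e1 : χ₁ ^ 2 - χ₂ ^ 2 = η * π₀ ^ 2 * (k₁ ^ 2 - k₂ ^ 2) := by linear_combination -4 * r6
    have e2 : χ₁ * χ₂ = η * π₀ ^ 2 * (k₁ * k₂) := by linear_combination 2 * i6
    linear_combination (χ₁ ^ 2 - χ₂ ^ 2 + η * π₀ ^ 2 * (k₁ ^ 2 - k₂ ^ 2)) * e1 +
      4 * (χ₁ * χ₂ + η * π₀ ^ 2 * (k₁ * k₂)) * e2
  have hzero : η * π₀ ^ 2 * (l ^ 2 - G) = χ₀ ^ 2 := by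
    linear_combination r4 + (1 / 2) * hsum
  have e3 : χ₀ * χ₁ = η * π₀ ^ 2 * l * k₁ := by linear_combination -r5
  have e4 : χ₀ * χ₂ = η * π₀ ^ 2 * l * k₂ := by linear_combination i5
  have e5 : χ₀ ^ 2 * (χ₁ ^ 2 + χ₂ ^ 2) = (η * π₀ ^ 2) ^ 2 * l ^ 2 * (k₁ ^ 2 + k₂ ^ 2) := by
    linear_combination (χ₀ * χ₁ + η * π₀ ^ 2 * l * k₁) * e3 + (χ₀ * χ₂ + η * π₀ ^ 2 * l * k₂) * e4
  have e6 : (η * π₀ ^ 2) ^ 2 * (k₁ ^ 2 + k₂ ^ 2) * G = 0 := by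
    rw [hsum, ← hzero] at e5
    linear_combination -e5
  have hπ0 : π₀ = 0 := by
    simpa [hη.ne', hG.ne', hk] using e6
  subst hπ0
  have f0 : χ₀ = 0 := by
    have : χ₀ ^ 2 = 0 := by rw [← hzero]; ring
    simpa using this
  have f12 : χ₁ ^ 2 + χ₂ ^ 2 = 0 := by rw [hsum]; ring
  have f1 : χ₁ = 0 :=
    pow_eq_zero_iff two_ne_zero |>.1 (by linarith [sq_nonneg χ₁, sq_nonneg χ₂])
  have f2 : χ₂ = 0 :=
    pow_eq_zero_iff two_ne_zero |>.1 (by linarith [sq_nonneg χ₁, sq_nonneg χ₂])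
  exact ⟨⟨rfl, rfl, rfl⟩, f0, f1, f2⟩

/-- The Weingarten relation, read along a circle in a spacelike plane, forces the component
`(κ₁, κ₂)` of the velocity of the center in this plane to vanish. -/
theorem elliptic_rigidity {T : Set (ℝ × ℝ)} (hT : T.Infinite)
    {a b k h r κ₁ κ₂ ρ₁ π₀ π₁ π₂ : ℝ} (habk : k ≠ 0 ∨ a ≠ 0 ∧ b ≠ 0) (hh : h ≠ 0) (hr : 0 < r)
    (H : ∀ w ∈ T, w.1 ^ 2 + w.2 ^ 2 = 1 ∧
      0 < (ρ₁ / 2 + r * κ₁ * w.1 + r * κ₂ * w.2) ^ 2 - r ^ 2 * h ^ 2 ∧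
      a ^ 2 * (π₀ + π₁ * w.1 + π₂ * w.2) ^ 2 *
        ((ρ₁ / 2 + r * κ₁ * w.1 + r * κ₂ * w.2) ^ 2 - r ^ 2 * h ^ 2) =
      4 * (k * ((ρ₁ / 2 + r * κ₁ * w.1 + r * κ₂ * w.2) ^ 2 - r ^ 2 * h ^ 2) ^ 2 -
        b * h * ((π₀ - h * (r ^ 2 * (κ₁ ^ 2 + κ₂ ^ 2 - h ^ 2) + ρ₁ ^ 2 / 4)) +
          (π₁ - h * ρ₁ * (r * κ₁)) * w.1 + (π₂ - h * ρ₁ * (r * κ₂)) * w.2)) ^ 2) :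
    κ₁ = 0 ∧ κ₂ = 0 := by
  by_cases hk : k = 0
  · obtain ⟨ha, hb⟩ := habk.resolve_left (not_not.2 hk)
    subst hk
    by_contra hcon
    have hne : (r * κ₁) ^ 2 + (r * κ₂) ^ 2 ≠ 0 := fun h0 => hcon (by
      have e1 : (r * κ₁) ^ 2 = 0 := by linarith [sq_nonneg (r * κ₁), sq_nonneg (r * κ₂)]
      have e2 : (r * κ₂) ^ 2 = 0 := by linarith [sq_nonneg (r * κ₁), sq_nonneg (r * κ₂)]
      exact ⟨by simpa [hr.ne'] using e1, by simpa [hr.ne'] using e2⟩)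
    obtain ⟨⟨p0, p1, p2⟩, q0, q1, q2⟩ := elliptic_const_zero hT (η := a ^ 2)
      (χ₀ := 2 * b * h * (π₀ - h * (r ^ 2 * (κ₁ ^ 2 + κ₂ ^ 2 - h ^ 2) + ρ₁ ^ 2 / 4)))
      (χ₁ := 2 * b * h * (π₁ - h * ρ₁ * (r * κ₁))) (χ₂ := 2 * b * h * (π₂ - h * ρ₁ * (r * κ₂)))
      (G := r ^ 2 * h ^ 2) (by positivity) (by positivity) hne (fun w hw => by
        obtain ⟨w1, -, w2⟩ := H w hw
        exact ⟨w1, w2.trans (by ring)⟩)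
    have hb2 : 2 * b * h ≠ 0 := mul_ne_zero (mul_ne_zero two_ne_zero hb) hh
    replace q0 := (mul_eq_zero.1 q0).resolve_left hb2
    replace q1 := (mul_eq_zero.1 q1).resolve_left hb2
    replace q2 := (mul_eq_zero.1 q2).resolve_left hb2
    rw [p0] at q0
    rw [p1] at q1
    rw [p2] at q2
    have hρ1 : ρ₁ = 0 := by
      by_contra hρ1
      exact hcon ⟨by simpa [hρ1, hr.ne', hh] using q1, by simpa [hρ1, hr.ne', hh] using q2⟩
    have hc0 : κ₁ ^ 2 + κ₂ ^ 2 - h ^ 2 = 0 := by simpa [hρ1, hr.ne', hh] using q0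
    -- now `H = K = 0` along the circle, but then `Δ` is nonpositive
    obtain ⟨w, hw⟩ := hT.nonempty
    obtain ⟨w1, w2, -⟩ := H w hw
    rw [hρ1] at w2
    have hle : (κ₁ * w.1 + κ₂ * w.2) ^ 2 ≤ h ^ 2 := by
      have : (κ₁ * w.1 + κ₂ * w.2) ^ 2 + (κ₁ * w.2 - κ₂ * w.1) ^ 2 = h ^ 2 := by
        linear_combination (κ₁ ^ 2 + κ₂ ^ 2) * w1 + hc0
      linarith [sq_nonneg (κ₁ * w.2 - κ₂ * w.1)]
    have := mul_le_mul_of_nonneg_left hle (sq_nonneg r)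
    linarith
  · obtain ⟨k1, k2⟩ := elliptic_const_ne_zero hT hk
      (fun w hw => ⟨(H w hw).1, (H w hw).2.2⟩)
    exact ⟨by simpa [hr.ne'] using k1, by simpa [hr.ne'] using k2⟩

/-- The branches of the hyperbola are parametrized by `z = C + S`, with `z⁻¹ = C - S`. -/
theorem hyperbola_param {C S : ℝ} (h : C ^ 2 - S ^ 2 = 1) :
    C + S ≠ 0 ∧ (C + S)⁻¹ = C - S := by
  have h1 : (C + S) * (C - S) = 1 := by linarith
  exact ⟨left_ne_zero_of_mul_eq_one h1, inv_eq_of_mul_eq_one_right h1⟩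

theorem hyperbola_linear (x₀ x₁ x₂ : ℝ) {C S : ℝ} (h : C ^ 2 - S ^ 2 = 1) :
    x₀ + x₁ * C + x₂ * S = x₀ + (x₁ + x₂) / 2 * (C + S) + (x₁ - x₂) / 2 * (C + S)⁻¹ := by
  rw [(hyperbola_param h).2]; ring

theorem infinite_hyperbola_image {T : Set (ℝ × ℝ)} (hT : T.Infinite)
    (h : ∀ w ∈ T, w.1 ^ 2 - w.2 ^ 2 = 1) :
    ((fun w : ℝ × ℝ => w.1 + w.2) '' T).Infinite :=
  hT.image fun a ha b hb hab => by
    have h1 : a.1 + a.2 = b.1 + b.2 := hab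
    have h2 : a.1 - a.2 = b.1 - b.2 := by
      rw [← (hyperbola_param (h a ha)).2, ← (hyperbola_param (h b hb)).2, h1]
    exact Prod.ext (by linarith) (by linarith)

/-- On the hyperbola, the Weingarten relation with nonzero constant forces
`λ = l + k₁ w₁ + k₂ w₂` to be constant. -/
theorem hyperbolic_const_ne_zero {T : Set (ℝ × ℝ)} (hT : T.Infinite)
    {a b k π₀ π₁ π₂ χ₀ χ₁ χ₂ l k₁ k₂ G : ℝ} (hk : k ≠ 0)
    (h : ∀ w ∈ T, w.1 ^ 2 - w.2 ^ 2 = 1 ∧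
      a * (π₀ + π₁ * w.1 + π₂ * w.2) ^ 2 * (G - (l + k₁ * w.1 + k₂ * w.2) ^ 2) =
      4 * (k * (G - (l + k₁ * w.1 + k₂ * w.2) ^ 2) ^ 2 - b * (χ₀ + χ₁ * w.1 + χ₂ * w.2)) ^ 2) :
    k₁ = 0 ∧ k₂ = 0 := by
  have key := laurent_const_ne_zero (infinite_hyperbola_image hT fun w hw => (h w hw).1)
    (k := a) (p₀ := π₀) (p₁ := (π₁ + π₂) / 2) (p₂ := (π₁ - π₂) / 2)
    (q₀ := 2 * b * χ₀) (q₁ := 2 * b * ((χ₁ + χ₂) / 2)) (q₂ := 2 * b * ((χ₁ - χ₂) / 2))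
    (l := l) (A := (k₁ + k₂) / 2) (B := (k₁ - k₂) / 2) (G := G) (ε := 1) (κ := 2 * k)
    (by norm_num) (by simpa using hk) ?_
  · exact ⟨by linarith [key.1, key.2], by linarith [key.1, key.2]⟩
  · rintro _ ⟨w, hw, rfl⟩
    obtain ⟨h1, h2⟩ := h w hw
    refine ⟨(hyperbola_param h1).1, ?_⟩
    rw [hyperbola_linear π₀ π₁ π₂ h1, hyperbola_linear χ₀ χ₁ χ₂ h1,
      hyperbola_linear l k₁ k₂ h1] at h2
    have e4 : 2 * b * χ₀ + 2 * b * ((χ₁ + χ₂) / 2) * (w.1 + w.2) +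
        2 * b * ((χ₁ - χ₂) / 2) * (w.1 + w.2)⁻¹ = 2 * b * (χ₀ + (χ₁ + χ₂) / 2 * (w.1 + w.2) +
        (χ₁ - χ₂) / 2 * (w.1 + w.2)⁻¹) := by ring
    simp only [e4]
    generalize π₀ + _ + _ = P at h2 ⊢
    generalize χ₀ + _ + _ = Q at h2 ⊢
    generalize l + _ + _ = R at h2 ⊢
    linear_combination h2

theorem eq_zero_of_neg_mul_sq {K x y : ℝ} (hK : 0 < K) (h : -K * x ^ 2 = y ^ 2) : x = 0 ∧ y = 0 := by
  have hx : 0 ≤ K * x ^ 2 := by positivity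
  have h1 : K * x ^ 2 = 0 := by nlinarith [sq_nonneg y]
  have h2 : y ^ 2 = 0 := by rw [← h]; linarith
  exact ⟨by simpa [hK.ne'] using h1, by simpa using h2⟩

/-- The leading coefficients of the two sides have opposite signs, so both sides vanish. -/
theorem laurent_neg_sq {S : Set ℝ} (hS : S.Infinite) {η p₀ p₁ p₂ q₀ q₁ q₂ l A B G : ℝ}
    (hη : 0 < η) (hA : A ≠ 0)
    (h : ∀ z ∈ S, z ≠ 0 ∧ -η * (p₀ + p₁ * z + p₂ * z⁻¹) ^ 2 * ((l + A * z + B * z⁻¹) ^ 2 - G) =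
      (q₀ + q₁ * z + q₂ * z⁻¹) ^ 2) :
    (p₀ = 0 ∧ p₁ = 0 ∧ p₂ = 0) ∧ q₀ = 0 ∧ q₁ = 0 ∧ q₂ = 0 := by
  obtain ⟨-, -, c2, -, c4, -, c6, -, c8⟩ := laurent_sq hS h
  have hK : 0 < η * A ^ 2 := by positivity
  have hp1 : p₁ = 0 := by simpa [hη.ne', hA] using c8
  subst hp1
  obtain ⟨hp0, hq1⟩ := eq_zero_of_neg_mul_sq hK (x := p₀) (y := q₁) (by linear_combination c6)
  subst hp0 hq1
  obtain ⟨hp2, hq0⟩ := eq_zero_of_neg_mul_sq hK (x := p₂) (y := q₀) (by linear_combination c4)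
  subst hp2 hq0
  have hq2 : q₂ ^ 2 = 0 := by linear_combination -c2
  exact ⟨⟨rfl, rfl, rfl⟩, rfl, rfl, by simpa using hq2⟩

/-- On the hyperbola, the Weingarten relation with constant zero forces both sides to vanish, unless
`λ = l + k₁ w₁ + k₂ w₂` is constant. -/
theorem hyperbolic_const_zero {T : Set (ℝ × ℝ)} (hT : T.Infinite)
    {η π₀ π₁ π₂ χ₀ χ₁ χ₂ l k₁ k₂ G : ℝ} (hη : 0 < η) (hk : ¬(k₁ = 0 ∧ k₂ = 0))
    (h : ∀ w ∈ T, w.1 ^ 2 - w.2 ^ 2 = 1 ∧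
      η * (π₀ + π₁ * w.1 + π₂ * w.2) ^ 2 * (G - (l + k₁ * w.1 + k₂ * w.2) ^ 2) =
      (χ₀ + χ₁ * w.1 + χ₂ * w.2) ^ 2) :
    (π₀ = 0 ∧ π₁ = 0 ∧ π₂ = 0) ∧ χ₀ = 0 ∧ χ₁ = 0 ∧ χ₂ = 0 := by
  have hinf := infinite_hyperbola_image hT fun w hw => (h w hw).1
  have key : ∀ z ∈ (fun w : ℝ × ℝ => w.1 + w.2) '' T, z ≠ 0 ∧
      -η * (π₀ + (π₁ + π₂) / 2 * z + (π₁ - π₂) / 2 * z⁻¹) ^ 2 *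
        ((l + (k₁ + k₂) / 2 * z + (k₁ - k₂) / 2 * z⁻¹) ^ 2 - G) =
      (χ₀ + (χ₁ + χ₂) / 2 * z + (χ₁ - χ₂) / 2 * z⁻¹) ^ 2 := by
    rintro _ ⟨w, hw, rfl⟩
    obtain ⟨h1, h2⟩ := h w hw
    refine ⟨(hyperbola_param h1).1, ?_⟩
    rw [hyperbola_linear π₀ π₁ π₂ h1, hyperbola_linear χ₀ χ₁ χ₂ h1,
      hyperbola_linear l k₁ k₂ h1] at h2
    simp only
    generalize π₀ + _ + _ = P at h2 ⊢
    generalize χ₀ + _ + _ = Q at h2 ⊢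
    generalize l + _ + _ = R at h2 ⊢
    linear_combination h2
  by_cases hA : (k₁ + k₂) / 2 = 0
  · have hB : (k₁ - k₂) / 2 ≠ 0 := fun hB => hk ⟨by linarith, by linarith⟩
    obtain ⟨⟨p0, p1, p2⟩, q0, q1, q2⟩ := laurent_neg_sq (hinf.image inv_injective.injOn)
      (p₀ := π₀) (p₁ := (π₁ - π₂) / 2) (p₂ := (π₁ + π₂) / 2) (q₀ := χ₀) (q₁ := (χ₁ - χ₂) / 2)
      (q₂ := (χ₁ + χ₂) / 2) (l := l) (B := (k₁ + k₂) / 2) (G := G) hη hB (by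
        rintro _ ⟨z, hz, rfl⟩
        obtain ⟨hz0, hz⟩ := key z hz
        refine ⟨inv_ne_zero hz0, ?_⟩
        rw [inv_inv, add_right_comm π₀, add_right_comm l, add_right_comm χ₀]
        exact hz)
    exact ⟨⟨p0, by linarith, by linarith⟩, q0, by linarith, by linarith⟩
  · obtain ⟨⟨p0, p1, p2⟩, q0, q1, q2⟩ := laurent_neg_sq hinf hη hA key
    exact ⟨⟨p0, by linarith, by linarith⟩, q0, by linarith, by linarith⟩

/-- The Weingarten relation, read along a circle in a timelike plane, forces the component
`(κ₂, κ₃)` of the velocity of the center in this plane to vanish. -/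
theorem hyperbolic_rigidity {T : Set (ℝ × ℝ)} (hT : T.Infinite)
    {a b k h r κ₂ κ₃ ρ₁ π₀ π₁ π₂ : ℝ} (habk : k ≠ 0 ∨ a ≠ 0 ∧ b ≠ 0) (hh : h ≠ 0) (hr : 0 < r)
    (H : ∀ w ∈ T, w.1 ^ 2 - w.2 ^ 2 = 1 ∧
      0 < r ^ 2 * h ^ 2 - (ρ₁ / 2 + r * κ₃ * w.1 + r * κ₂ * w.2) ^ 2 ∧
      a ^ 2 * (π₀ + π₁ * w.1 + π₂ * w.2) ^ 2 *
        (r ^ 2 * h ^ 2 - (ρ₁ / 2 + r * κ₃ * w.1 + r * κ₂ * w.2) ^ 2) =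
      4 * (k * (r ^ 2 * h ^ 2 - (ρ₁ / 2 + r * κ₃ * w.1 + r * κ₂ * w.2) ^ 2) ^ 2 -
        b * h * ((π₀ + h * (-r ^ 2 * (h ^ 2 + κ₂ ^ 2 - κ₃ ^ 2) + ρ₁ ^ 2 / 4)) +
          (π₁ + h * ρ₁ * (r * κ₃)) * w.1 + (π₂ + h * ρ₁ * (r * κ₂)) * w.2)) ^ 2) :
    κ₂ = 0 ∧ κ₃ = 0 := by
  by_cases hk : k = 0
  · obtain ⟨ha, hb⟩ := habk.resolve_left (not_not.2 hk)
    subst hk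
    by_contra hcon
    have hne : ¬(r * κ₃ = 0 ∧ r * κ₂ = 0) := by
      rintro ⟨h1, h2⟩
      exact hcon ⟨by simpa [hr.ne'] using h2, by simpa [hr.ne'] using h1⟩
    obtain ⟨⟨p0, p1, p2⟩, q0, q1, q2⟩ := hyperbolic_const_zero hT (η := a ^ 2)
      (χ₀ := 2 * b * h * (π₀ + h * (-r ^ 2 * (h ^ 2 + κ₂ ^ 2 - κ₃ ^ 2) + ρ₁ ^ 2 / 4)))
      (χ₁ := 2 * b * h * (π₁ + h * ρ₁ * (r * κ₃))) (χ₂ := 2 * b * h * (π₂ + h * ρ₁ * (r * κ₂)))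
      (G := r ^ 2 * h ^ 2) (by positivity) hne (fun w hw => by
        obtain ⟨w1, -, w2⟩ := H w hw
        exact ⟨w1, w2.trans (by ring)⟩)
    have hb2 : 2 * b * h ≠ 0 := mul_ne_zero (mul_ne_zero two_ne_zero hb) hh
    replace q0 := (mul_eq_zero.1 q0).resolve_left hb2
    replace q1 := (mul_eq_zero.1 q1).resolve_left hb2
    replace q2 := (mul_eq_zero.1 q2).resolve_left hb2
    rw [p0] at q0
    rw [p1] at q1
    rw [p2] at q2
    have hρ1 : ρ₁ = 0 := by
      by_contra hρ1
      exact hcon ⟨by simpa [hρ1, hr.ne', hh] using q2, by simpa [hρ1, hr.ne', hh] using q1⟩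
    have hc0 : h ^ 2 + κ₂ ^ 2 - κ₃ ^ 2 = 0 := by simpa [hρ1, hr.ne', hh] using q0
    -- now `H = K = 0` along the circle, but then `Δ` is nonpositive
    obtain ⟨w, hw⟩ := hT.nonempty
    obtain ⟨w1, w2, -⟩ := H w hw
    rw [hρ1] at w2
    have hle : h ^ 2 ≤ (κ₃ * w.1 + κ₂ * w.2) ^ 2 := by
      have : (κ₃ * w.1 + κ₂ * w.2) ^ 2 - (κ₂ * w.1 + κ₃ * w.2) ^ 2 = h ^ 2 := by
        linear_combination (κ₃ ^ 2 - κ₂ ^ 2) * w1 - hc0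
      linarith [sq_nonneg (κ₂ * w.1 + κ₃ * w.2)]
    have := mul_le_mul_of_nonneg_left hle (sq_nonneg r)
    linarith
  · obtain ⟨k1, k2⟩ := hyperbolic_const_ne_zero hT hk
      (fun w hw => ⟨(H w hw).1, (H w hw).2.2⟩)
    exact ⟨by simpa [hr.ne'] using k2, by simpa [hr.ne'] using k1⟩

open Polynomial in
/-- On the parabola, the right-hand side of the Weingarten relation with nonzero constant has degree
`8`, unless `Δ` has degree at most one, and the left-hand side has degree at most `6`. -/
theorem parabolic_leading_eq_zero {T : Set ℝ} (hT : T.Infinite)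
    {a b k π₀ π₁ π₂ χ₀ χ₁ χ₂ d₀ d₁ d₂ : ℝ} (hk : k ≠ 0)
    (h : ∀ s ∈ T, a * (π₀ + π₁ * s + π₂ * s ^ 2) ^ 2 * (d₀ + d₁ * s + d₂ * s ^ 2) =
      4 * (k * (d₀ + d₁ * s + d₂ * s ^ 2) ^ 2 - b * (χ₀ + χ₁ * s + χ₂ * s ^ 2)) ^ 2) : d₂ = 0 := by
  have key := coeff_eq_zero_of_sq (n := 4) hT
    (U := C a * (C π₀ + C π₁ * X + C π₂ * X ^ 2) ^ 2 * (C d₀ + C d₁ * X + C d₂ * X ^ 2))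
    (V := C (2 * k) * (C d₀ + C d₁ * X + C d₂ * X ^ 2) ^ 2 -
      C (2 * b) * (C χ₀ + C χ₁ * X + C χ₂ * X ^ 2)) ?_ ?_
  · have hc : (C (2 * k) * (C d₀ + C d₁ * X + C d₂ * X ^ 2) ^ 2 -
      C (2 * b) * (C χ₀ + C χ₁ * X + C χ₂ * X ^ 2)).coeff 4 = 2 * k * d₂ ^ 2 := by
      compute_degree!
    rw [hc] at key
    simpa [hk] using key
  · intro s hs
    have hs' := h s hs
    simp only [eval_mul, eval_sub, eval_add, eval_pow, eval_C, eval_X]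
    generalize π₀ + _ + _ = P at hs' ⊢
    generalize χ₀ + _ + _ = Q at hs' ⊢
    generalize d₀ + _ + _ = R at hs' ⊢
    linear_combination hs'
  · refine lt_of_le_of_lt (b := 6) ?_ (by norm_num)
    compute_degree!

open Polynomial in
/-- On the parabola, if `P₁`, `P₂` and `Δ` have degree at most one, then the Weingarten relation with
nonzero constant forces `Δ` to be constant. -/
theorem parabolic_linear_eq_zero {T : Set ℝ} (hT : T.Infinite)
    {a b k π₀ π₁ χ₀ χ₁ d₀ d₁ : ℝ} (hk : k ≠ 0)
    (h : ∀ s ∈ T, a * (π₀ + π₁ * s) ^ 2 * (d₀ + d₁ * s) =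
      4 * (k * (d₀ + d₁ * s) ^ 2 - b * (χ₀ + χ₁ * s)) ^ 2) : d₁ = 0 := by
  have key := coeff_eq_zero_of_sq (n := 2) hT
    (U := C a * (C π₀ + C π₁ * X) ^ 2 * (C d₀ + C d₁ * X))
    (V := C (2 * k) * (C d₀ + C d₁ * X) ^ 2 - C (2 * b) * (C χ₀ + C χ₁ * X)) ?_ ?_
  · have hc : (C (2 * k) * (C d₀ + C d₁ * X) ^ 2 -
      C (2 * b) * (C χ₀ + C χ₁ * X)).coeff 2 = 2 * k * d₁ ^ 2 := by
      compute_degree!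
    rw [hc] at key
    simpa [hk] using key
  · intro s hs
    have hs' := h s hs
    simp only [eval_mul, eval_sub, eval_add, eval_pow, eval_C, eval_X]
    generalize π₀ + _ = P at hs' ⊢
    generalize χ₀ + _ = Q at hs' ⊢
    generalize d₀ + _ = R at hs' ⊢
    linear_combination hs'
  · refine lt_of_le_of_lt (b := 3) ?_ (by norm_num)
    compute_degree!

/-- If `P₁` and `P₂` have degree at most one and `Δ` has degree one, then `η P₁² Δ = P₂²` forces `P₁`
and `P₂` to be constant (even zero), since the degree of the left-hand side is odd. -/
theorem parabolic_linear_const_zero {T : Set ℝ} (hT : T.Infinite)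
    {η π₀ π₁ χ₀ χ₁ d₀ d₁ : ℝ} (hη : 0 < η) (hd : d₁ ≠ 0)
    (h : ∀ s ∈ T, η * (π₀ + π₁ * s) ^ 2 * (d₀ + d₁ * s) = (χ₀ + χ₁ * s) ^ 2) :
    π₁ = 0 ∧ χ₁ = 0 := by
  obtain ⟨-, c1, c2, c3, -⟩ := coeffs_eq_zero_of_infinite hT
    (a₀ := η * π₀ ^ 2 * d₀ - χ₀ ^ 2)
    (a₁ := η * (π₀ ^ 2 * d₁ + 2 * π₀ * π₁ * d₀) - 2 * χ₀ * χ₁)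
    (a₂ := η * (π₁ ^ 2 * d₀ + 2 * π₀ * π₁ * d₁) - χ₁ ^ 2)
    (a₃ := η * π₁ ^ 2 * d₁) (a₄ := 0) (a₅ := 0) (a₆ := 0) (a₇ := 0) (a₈ := 0) (fun s hs => by
      linear_combination h s hs)
  have hπ : π₁ = 0 := by simpa [hη.ne', hd] using c3
  subst hπ
  have hχ : χ₁ ^ 2 = 0 := by linear_combination -c2
  exact ⟨rfl, by simpa using hχ⟩

/-- On the parabola, the Weingarten relation with constant zero, `η P₁² Δ = P₂²`, forces `Δ` to have
degree at most one. This uses the relation `P₁ = P₂ + g + w Δ`, and that `g` is a multiple of the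
discriminant of `Δ`. -/
theorem parabolic_const_zero {T : Set ℝ} (hT : T.Infinite)
    {η π₀ π₁ π₂ χ₀ χ₁ χ₂ d₀ d₁ d₂ g w h : ℝ} (hη : 0 < η) (hh : h ≠ 0)
    (hπ₀ : π₀ = χ₀ + g + w * d₀) (hπ₁ : π₁ = χ₁ + w * d₁) (hπ₂ : π₂ = χ₂ + w * d₂)
    (hdisc : d₁ ^ 2 - 4 * d₂ * d₀ = 4 * h * g) (hd₂ : d₂ = h * (w - h))
    (hpos : ∃ s, 0 < d₀ + d₁ * s + d₂ * s ^ 2)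
    (H : ∀ s ∈ T, η * (π₀ + π₁ * s + π₂ * s ^ 2) ^ 2 * (d₀ + d₁ * s + d₂ * s ^ 2) =
      (χ₀ + χ₁ * s + χ₂ * s ^ 2) ^ 2) : d₂ = 0 := by
  by_contra hd
  obtain ⟨c0, c1, c2, c3, c4, c5, c6, -⟩ := coeffs_eq_zero_of_infinite hT
    (a₀ := η * π₀ ^ 2 * d₀ - χ₀ ^ 2)
    (a₁ := η * (π₀ ^ 2 * d₁ + 2 * π₀ * π₁ * d₀) - 2 * χ₀ * χ₁)
    (a₂ := η * (π₀ ^ 2 * d₂ + 2 * π₀ * π₁ * d₁ + (π₁ ^ 2 + 2 * π₀ * π₂) * d₀)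
      - (χ₁ ^ 2 + 2 * χ₀ * χ₂))
    (a₃ := η * (2 * π₀ * π₁ * d₂ + (π₁ ^ 2 + 2 * π₀ * π₂) * d₁ + 2 * π₁ * π₂ * d₀) - 2 * χ₁ * χ₂)
    (a₄ := η * ((π₁ ^ 2 + 2 * π₀ * π₂) * d₂ + 2 * π₁ * π₂ * d₁ + π₂ ^ 2 * d₀) - χ₂ ^ 2)
    (a₅ := η * (2 * π₁ * π₂ * d₂ + π₂ ^ 2 * d₁)) (a₆ := η * π₂ ^ 2 * d₂) (a₇ := 0) (a₈ := 0)
    (fun s hs => by linear_combination H s hs)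
  have hπ2 : π₂ = 0 := by simpa [hη.ne', hd] using c6
  rw [hπ2] at hπ₂
  subst hπ2
  obtain ⟨s, hs⟩ := hpos
  by_cases hw : w = 0
  · subst hw
    have hχ2 : χ₂ = 0 := by linarith
    have hd' : d₂ = -h ^ 2 := by rw [hd₂]; ring
    have hh2 : 0 < h ^ 2 := by positivity
    have hK : 0 < η * h ^ 2 := by positivity
    subst hχ2 hd'
    have hp1 : π₁ = 0 := (eq_zero_of_neg_mul_sq hK (x := π₁) (y := 0) (by linear_combination c4)).1
    subst hp1
    obtain ⟨hp0, hχ1⟩ := eq_zero_of_neg_mul_sq hK (x := π₀) (y := χ₁) (by linear_combination c2)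
    subst hp0 hχ1
    have hχ0 : χ₀ = 0 := by
      have : χ₀ ^ 2 = 0 := by linear_combination -c0
      simpa using this
    have hg : g = 0 := by rw [hχ0] at hπ₀; linarith
    rw [hg] at hdisc
    nlinarith [sq_nonneg (d₁ - 2 * h ^ 2 * s)]
  · have hχ2 : χ₂ = -w * d₂ := by linarith
    have hχ2' : χ₂ ≠ 0 := by rw [hχ2]; exact mul_ne_zero (neg_ne_zero.2 hw) hd
    have hp1 : π₁ ≠ 0 := by
      rintro rfl
      refine hχ2' ?_
      have : χ₂ ^ 2 = 0 := by linear_combination -c4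
      simpa using this
    have e4 : η * π₁ ^ 2 * d₂ = χ₂ ^ 2 := by linear_combination c4
    -- `P₂` vanishes at the root of the linear polynomial `P₁`
    have hroot : χ₀ * π₁ ^ 2 - χ₁ * π₀ * π₁ + χ₂ * π₀ ^ 2 = 0 := by
      have : (χ₀ * π₁ ^ 2 - χ₁ * π₀ * π₁ + χ₂ * π₀ ^ 2) ^ 2 = 0 := by
        linear_combination -π₁ ^ 4 * c0 + π₁ ^ 3 * π₀ * c1 - π₁ ^ 2 * π₀ ^ 2 * c2
          + π₁ * π₀ ^ 3 * c3 - π₀ ^ 4 * c4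
      simpa using this
    -- hence the other factor of `P₂` squares to a multiple of `Δ`
    have e3 : η * π₁ ^ 3 * d₁ = 2 * χ₂ * (χ₁ * π₁ - χ₂ * π₀) := by
      linear_combination π₁ * c3 - 2 * π₀ * e4
    have e2 : η * π₁ ^ 4 * d₀ = (χ₁ * π₁ - χ₂ * π₀) ^ 2 := by
      linear_combination π₁ ^ 2 * c2 - 2 * π₀ * e3 - π₀ ^ 2 * e4 + 2 * χ₂ * hroot
    have hdisc0 : d₁ ^ 2 - 4 * d₂ * d₀ = 0 := by
      have : (η * π₁ ^ 3) ^ 2 * (d₁ ^ 2 - 4 * d₂ * d₀) = 0 := by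
        linear_combination (η * π₁ ^ 3 * d₁ + 2 * χ₂ * (χ₁ * π₁ - χ₂ * π₀)) * e3
          - 4 * η * π₁ ^ 2 * d₂ * e2 - 4 * (χ₁ * π₁ - χ₂ * π₀) ^ 2 * e4
      simpa [hη.ne', hp1] using this
    have hg : g = 0 := by
      rw [hdisc0] at hdisc
      simpa [hh] using hdisc.symm
    -- so that `Δ` vanishes at the root of `P₁`, and this is a double root of `P₂`
    have hΔ0 : d₂ * π₀ ^ 2 - d₁ * π₀ * π₁ + d₀ * π₁ ^ 2 = 0 := by
      have : w * (d₂ * π₀ ^ 2 - d₁ * π₀ * π₁ + d₀ * π₁ ^ 2) = 0 := by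
        linear_combination (-hroot) - π₁ ^ 2 * hπ₀ + π₀ * π₁ * hπ₁ - π₀ ^ 2 * hπ₂ - π₁ ^ 2 * hg
      simpa [hw] using this
    have hv : 2 * d₂ * π₀ = d₁ * π₁ := by
      have : (2 * d₂ * π₀ - d₁ * π₁) ^ 2 = 0 := by
        linear_combination 4 * d₂ * hΔ0 + π₁ ^ 2 * hdisc0
      have := pow_eq_zero_iff two_ne_zero |>.1 this
      linarith
    refine hp1 ?_
    have : χ₂ ^ 2 * π₁ ^ 2 = 0 := by
      have h1 : d₁ * χ₂ = 2 * d₂ * χ₁ - d₁ * χ₂ := by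
        have : χ₂ * π₁ * (d₁ * χ₂ - (2 * d₂ * χ₁ - d₁ * χ₂)) = 0 := by
          linear_combination (-d₁ * π₁) * e4 + d₂ * e3 - χ₂ ^ 2 * hv
        have := (mul_eq_zero.1 this).resolve_left (mul_ne_zero hχ2' hp1)
        linarith
      have h2 : d₂ * π₁ = 0 := by rw [hχ2] at h1; linear_combination d₂ * hπ₁ - (1 / 2) * h1
      rw [(mul_eq_zero.1 h2).resolve_left hd]; ring
    simpa [hχ2'] using this

/-! ### Families of spheres through the parameter curves -/

section

open Filter Topology

section Slices

variable {F : Type*} [NormedAddCommGroup F] [NormedSpace ℝ F] {D : Set (ℝ × ℝ)}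

theorem isOpen_fst_image (hD : IsOpen D) : IsOpen (Prod.fst '' D) := isOpenMap_fst D hD

theorem eventually_mem_fst (hD : IsOpen D) {q : ℝ × ℝ} (hq : q ∈ D) :
    ∀ᶠ s in 𝓝 q.1, (s, q.2) ∈ D :=
  (Continuous.prodMk_left q.2).continuousAt.eventually_mem (hD.mem_nhds hq)

theorem eventually_mem_snd (hD : IsOpen D) {q : ℝ × ℝ} (hq : q ∈ D) :
    ∀ᶠ s in 𝓝 q.2, (q.1, s) ∈ D :=
  (Continuous.prodMk_right q.1).continuousAt.eventually_mem (hD.mem_nhds hq)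

theorem hasDerivAt_fst (hD : IsOpen D) {f : ℝ × ℝ → F} (hf : ContDiffOn ℝ ∞ f D) {q : ℝ × ℝ}
    (hq : q ∈ D) : HasDerivAt (fun s => f (s, q.2)) (fderiv ℝ f q (1, 0)) q.1 := by
  have h1 : HasFDerivAt f (fderiv ℝ f q) (q.1, q.2) :=
    ((hf.contDiffAt (hD.mem_nhds hq)).differentiableAt (by simp)).hasFDerivAt
  exact h1.comp_hasDerivAt q.1 ((hasDerivAt_id q.1).prodMk (hasDerivAt_const q.1 q.2))

theorem hasDerivAt_snd (hD : IsOpen D) {f : ℝ × ℝ → F} (hf : ContDiffOn ℝ ∞ f D) {q : ℝ × ℝ}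
    (hq : q ∈ D) : HasDerivAt (fun s => f (q.1, s)) (fderiv ℝ f q (0, 1)) q.2 := by
  have h1 : HasFDerivAt f (fderiv ℝ f q) (q.1, q.2) :=
    ((hf.contDiffAt (hD.mem_nhds hq)).differentiableAt (by simp)).hasFDerivAt
  exact h1.comp_hasDerivAt q.2 ((hasDerivAt_const q.2 q.1).prodMk (hasDerivAt_id q.2))

theorem contDiffOn_fderiv_apply (hD : IsOpen D) {f : ℝ × ℝ → F} (hf : ContDiffOn ℝ ∞ f D)
    (w : ℝ × ℝ) : ContDiffOn ℝ ∞ (fun q => fderiv ℝ f q w) D :=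
  (hf.fderiv_of_isOpen hD (by simp)).clm_apply contDiffOn_const

/-- A function of `u` is smooth if it is smooth as a function on the parameter domain. -/
theorem contDiffOn_of_comp_fst (hD : IsOpen D) {f : ℝ → F} {g : ℝ × ℝ → F}
    (hg : ContDiffOn ℝ ∞ g D) (h : ∀ q ∈ D, f q.1 = g q) : ContDiffOn ℝ ∞ f (Prod.fst '' D) := by
  rintro _ ⟨q, hq, rfl⟩
  have h1 : ContDiffAt ℝ ∞ (fun s : ℝ => g (s, q.2)) q.1 :=
    ContDiffAt.comp (f := fun s : ℝ => (s, q.2)) q.1 (hg.contDiffAt (hD.mem_nhds hq))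
      (contDiffAt_id.prodMk contDiffAt_const)
  refine (h1.congr_of_eventuallyEq ?_).contDiffWithinAt
  filter_upwards [eventually_mem_fst hD hq] with s hs
  exact h _ hs

theorem hasDerivAt_deriv {I : Set ℝ} (hI : IsOpen I) {f : ℝ → F} (hf : ContDiffOn ℝ ∞ f I) {u : ℝ}
    (hu : u ∈ I) : HasDerivAt f (deriv f u) u :=
  ((hf.contDiffAt (hI.mem_nhds hu)).differentiableAt (by simp)).hasDerivAt

theorem contDiffOn_deriv {I : Set ℝ} (hI : IsOpen I) {f : ℝ → F} (hf : ContDiffOn ℝ ∞ f I) :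
    ContDiffOn ℝ ∞ (deriv f) I :=
  hf.deriv_of_isOpen hI (by simp)

end Slices

/-- A smooth family of spheres `⟨x - c u, x - c u⟩ = ρ u` and parallel planes `⟨x, n⟩ = h u` which
contain the parameter curves of the surface. -/
structure SphereFamily (D : Set (ℝ × ℝ)) (X : ℝ × ℝ → E31) (n : E31) (c : ℝ → E31)
    (h ρ : ℝ → ℝ) : Prop where
  smooth_c : ContDiffOn ℝ ∞ c (Prod.fst '' D)
  smooth_h : ContDiffOn ℝ ∞ h (Prod.fst '' D)
  smooth_ρ : ContDiffOn ℝ ∞ ρ (Prod.fst '' D)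
  plane : ∀ q ∈ D, mink (X q) n = h q.1
  sphere : ∀ q ∈ D, mink (X q - c q.1) (X q - c q.1) = ρ q.1

namespace IsSpacelikeSurface

variable {D : Set (ℝ × ℝ)} {X : ℝ × ℝ → E31}

theorem contDiffOn_du (hM : IsSpacelikeSurface D X) : ContDiffOn ℝ ∞ (du X) D :=
  contDiffOn_fderiv_apply hM.isOpen hM.smooth _

theorem contDiffOn_dv (hM : IsSpacelikeSurface D X) : ContDiffOn ℝ ∞ (dv X) D :=
  contDiffOn_fderiv_apply hM.isOpen hM.smooth _

theorem mink_comb_pos (hM : IsSpacelikeSurface D X) {q : ℝ × ℝ} (hq : q ∈ D) {x y : ℝ}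
    (h : (x, y) ≠ 0) :
    0 < x ^ 2 * ffE X q + 2 * x * y * ffF X q + y ^ 2 * ffG X q := by
  have h1 := hM.spacelike q hq (x, y) h
  have h2 : fderiv ℝ X q (x, y) = x • du X q + y • dv X q := by
    rw [du, dv, ← map_smul, ← map_smul, ← map_add]
    simp
  rw [h2] at h1
  simp only [mink_add_left, mink_add_right, mink_smul_left, mink_smul_right] at h1
  rw [mink_comm (dv X q) (du X q)] at h1
  unfold ffE ffF ffG
  linarith

theorem ffG_pos (hM : IsSpacelikeSurface D X) {q : ℝ × ℝ} (hq : q ∈ D) : 0 < ffG X q := by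
  simpa using hM.mink_comb_pos hq (x := 0) (y := 1) (by simp)

theorem det_pos (hM : IsSpacelikeSurface D X) {q : ℝ × ℝ} (hq : q ∈ D) :
    0 < ffE X q * ffG X q - ffF X q ^ 2 := by
  have hG := hM.ffG_pos hq
  have h := hM.mink_comb_pos hq (x := ffG X q) (y := -ffF X q) (by simp [hG.ne'])
  refine pos_of_mul_pos_right (a := ffG X q) ?_ hG.le
  linarith

theorem hasDerivAt_X_fst (hM : IsSpacelikeSurface D X) {q : ℝ × ℝ} (hq : q ∈ D) :
    HasDerivAt (fun s => X (s, q.2)) (du X q) q.1 := hasDerivAt_fst hM.isOpen hM.smooth hq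

theorem hasDerivAt_X_snd (hM : IsSpacelikeSurface D X) {q : ℝ × ℝ} (hq : q ∈ D) :
    HasDerivAt (fun s => X (q.1, s)) (dv X q) q.2 := hasDerivAt_snd hM.isOpen hM.smooth hq

/-- Infinitely many points of the surface lie on each parameter curve. -/
theorem infinite_curve (hM : IsSpacelikeSurface D X) {q : ℝ × ℝ} (hq : q ∈ D) :
    {x | ∃ v, (q.1, v) ∈ D ∧ X (q.1, v) = x}.Infinite := by
  obtain ⟨δ, hδ, hball⟩ := Metric.eventually_nhds_iff_ball.1 (eventually_mem_snd hM.isOpen hq)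
  have hcont : ContinuousOn (fun s => X (q.1, s)) (Metric.ball q.2 δ) := fun s hs =>
    (hM.hasDerivAt_X_snd (q := (q.1, s)) (hball s hs)).continuousAt.continuousWithinAt
  have hconn : IsPreconnected ((fun s => X (q.1, s)) '' Metric.ball q.2 δ) :=
    (convex_ball q.2 δ).isPreconnected.image _ hcont
  have hnt : ((fun s => X (q.1, s)) '' Metric.ball q.2 δ).Nontrivial := by
    rw [← Set.not_subsingleton_iff]
    intro hs
    have hconst : (fun s => X (q.1, s)) =ᶠ[𝓝 q.2] fun _ => X q := by
      filter_upwards [Metric.ball_mem_nhds q.2 hδ] with s hs'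
      exact hs ⟨s, hs', rfl⟩ ⟨q.2, Metric.mem_ball_self hδ, rfl⟩
    have h0 : dv X q = 0 :=
      (hM.hasDerivAt_X_snd hq).unique ((hasDerivAt_const q.2 (X q)).congr_of_eventuallyEq hconst)
    have hG := hM.ffG_pos hq
    rw [ffG, h0] at hG
    simp [mink] at hG
  refine (hconn.infinite_of_nontrivial hnt).mono ?_
  rintro _ ⟨s, hs, rfl⟩
  exact ⟨s, hball s hs, rfl⟩

/-- First and second derivatives along a curve in the intersection of a sphere and a plane. -/
theorem vertical_jet (hM : IsSpacelikeSurface D X) {n : E31} {c : ℝ → E31} {h ρ : ℝ → ℝ}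
    (hh : ∀ q ∈ D, mink (X q) n = h q.1)
    (hρ : ∀ q ∈ D, mink (X q - c q.1) (X q - c q.1) = ρ q.1) {q : ℝ × ℝ} (hq : q ∈ D) :
    mink (dv X q) n = 0 ∧ mink (dv (dv X) q) n = 0 ∧ mink (dv X q) (X q - c q.1) = 0 ∧
      mink (dv (dv X) q) (X q - c q.1) + mink (dv X q) (dv X q) = 0 := by
  have h1 : ∀ q ∈ D, mink (dv X q) n = 0 := fun q hq => by
    have := hasDerivAt_mink (hM.hasDerivAt_X_snd hq) (hasDerivAt_const q.2 n)
    have e := this.unique ((hasDerivAt_const q.2 (h q.1)).congr_of_eventuallyEq (by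
      filter_upwards [eventually_mem_snd hM.isOpen hq] with s hs
      exact hh _ hs))
    simpa [mink] using e
  have h2 : ∀ q ∈ D, mink (dv X q) (X q - c q.1) = 0 := fun q hq => by
    have hd := (hM.hasDerivAt_X_snd hq).sub_const (c q.1)
    have e := (hasDerivAt_mink hd hd).unique
      ((hasDerivAt_const q.2 (ρ q.1)).congr_of_eventuallyEq (by
      filter_upwards [eventually_mem_snd hM.isOpen hq] with s hs
      exact hρ _ hs))
    rw [mink_comm (X (q.1, q.2) - c q.1)] at e
    simp only [Prod.mk.eta] at e
    linarith
  have hvv : HasDerivAt (fun s => dv X (q.1, s)) (dv (dv X) q) q.2 :=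
    hasDerivAt_snd hM.isOpen hM.contDiffOn_dv hq
  refine ⟨h1 q hq, ?_, h2 q hq, ?_⟩
  · have e := (hasDerivAt_mink hvv (hasDerivAt_const q.2 n)).unique
      ((hasDerivAt_const q.2 (0 : ℝ)).congr_of_eventuallyEq (by
      filter_upwards [eventually_mem_snd hM.isOpen hq] with s hs
      exact h1 _ hs))
    simpa [mink] using e
  · exact (hasDerivAt_mink hvv ((hM.hasDerivAt_X_snd hq).sub_const (c q.1))).unique
      ((hasDerivAt_const q.2 (0 : ℝ)).congr_of_eventuallyEq (by
      filter_upwards [eventually_mem_snd hM.isOpen hq] with s hs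
      exact h2 _ hs))

end IsSpacelikeSurface

theorem SphereFamily.circleJet {D : Set (ℝ × ℝ)} {X : ℝ × ℝ → E31} {n : E31} {c : ℝ → E31}
    {h ρ : ℝ → ℝ} (S : SphereFamily D X n c h ρ) (hM : IsSpacelikeSurface D X) {q : ℝ × ℝ}
    (hq : q ∈ D) :
    CircleJet n (X q - c q.1) (du X q) (dv X q) (du (du X) q) (dv (du X) q) (dv (dv X) q)
      (deriv c q.1) (deriv (deriv c) q.1) (deriv h q.1) (deriv (deriv h) q.1)
      (deriv ρ q.1) (deriv (deriv ρ) q.1) := by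
  have hI := isOpen_fst_image hM.isOpen
  have hmem : ∀ {q}, q ∈ D → q.1 ∈ Prod.fst '' D := fun hq => ⟨_, hq, rfl⟩
  obtain ⟨v1, v2, v3, v4⟩ := hM.vertical_jet S.plane S.sphere hq
  have u1 : ∀ q ∈ D, mink (du X q) n = deriv h q.1 := fun q hq => by
    have e := (hasDerivAt_mink (hM.hasDerivAt_X_fst hq) (hasDerivAt_const q.1 n)).unique
      ((hasDerivAt_deriv hI S.smooth_h (hmem hq)).congr_of_eventuallyEq (by
      filter_upwards [eventually_mem_fst hM.isOpen hq] with s hs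
      exact S.plane _ hs))
    simpa [mink] using e
  have u2 : ∀ q ∈ D, mink (du X q - deriv c q.1) (X q - c q.1) = deriv ρ q.1 / 2 := fun q hq => by
    have hd := (hM.hasDerivAt_X_fst hq).sub (hasDerivAt_deriv hI S.smooth_c (hmem hq))
    have e := (hasDerivAt_mink hd hd).unique
      ((hasDerivAt_deriv hI S.smooth_ρ (hmem hq)).congr_of_eventuallyEq (by
      filter_upwards [eventually_mem_fst hM.isOpen hq] with s hs
      exact S.sphere _ hs))
    simp only [Pi.sub_apply, Prod.mk.eta] at e
    rw [mink_comm (X q - c q.1)] at e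
    linarith
  have huu : HasDerivAt (fun s => du X (s, q.2)) (du (du X) q) q.1 :=
    hasDerivAt_fst hM.isOpen hM.contDiffOn_du hq
  have huv : HasDerivAt (fun s => du X (q.1, s)) (dv (du X) q) q.2 :=
    hasDerivAt_snd hM.isOpen hM.contDiffOn_du hq
  have hc1 := hasDerivAt_deriv hI S.smooth_c (hmem hq)
  have hc2 := hasDerivAt_deriv hI (contDiffOn_deriv hI S.smooth_c) (hmem hq)
  have hh2 := hasDerivAt_deriv hI (contDiffOn_deriv hI S.smooth_h) (hmem hq)
  have hρ2 := hasDerivAt_deriv hI (contDiffOn_deriv hI S.smooth_ρ) (hmem hq)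
  refine ⟨u1 q hq, v1, ?_, ?_, v2, u2 q hq, v3, ?_, ?_, v4⟩
  · have e := (hasDerivAt_mink huu (hasDerivAt_const q.1 n)).unique
      (hh2.congr_of_eventuallyEq (by
      filter_upwards [eventually_mem_fst hM.isOpen hq] with s hs
      exact u1 _ hs))
    simpa [mink] using e
  · have e := (hasDerivAt_mink huv (hasDerivAt_const q.2 n)).unique
      ((hasDerivAt_const q.2 (deriv h q.1)).congr_of_eventuallyEq (by
      filter_upwards [eventually_mem_snd hM.isOpen hq] with s hs
      exact u1 _ hs))
    simpa [mink] using e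
  · exact (hasDerivAt_mink (huu.sub hc2) ((hM.hasDerivAt_X_fst hq).sub hc1)).unique
      ((hρ2.div_const 2).congr_of_eventuallyEq (by
      filter_upwards [eventually_mem_fst hM.isOpen hq] with s hs
      exact u2 _ hs))
  · exact (hasDerivAt_mink (huv.sub_const (deriv c q.1))
      ((hM.hasDerivAt_X_snd hq).sub_const (c q.1))).unique
      ((hasDerivAt_const q.2 (deriv ρ q.1 / 2)).congr_of_eventuallyEq (by
      filter_upwards [eventually_mem_snd hM.isOpen hq] with s hs
      exact u2 _ hs))

end

/-! ### Smooth dependence of the centers, and the Weingarten relation -/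

section

variable {D : Set (ℝ × ℝ)} {X : ℝ × ℝ → E31}

/-- If the planes are not lightlike, the centers of the circles depend smoothly on the parameter. -/
theorem sphereFamily_of_center (hM : IsSpacelikeSurface D X) {n : E31} (hn : mink n n ≠ 0)
    {c : ℝ → E31} {ρ : ℝ → ℝ} (hplane : ∀ q ∈ D, mink (X q - c q.1) n = 0)
    (hsphere : ∀ q ∈ D, mink (X q - c q.1) (X q - c q.1) = ρ q.1) :
    SphereFamily D X n c (fun u => mink (c u) n) ρ := by
  have hh : ∀ q ∈ D, mink (X q) n = mink (c q.1) n := fun q hq => by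
    have := hplane q hq; rw [mink_sub_left] at this; linarith
  have key : ∀ q ∈ D, mink (dv (dv X) q) (lcross n (dv X q)) ≠ 0 ∧
      c q.1 = X q + (ffG X q / mink (dv (dv X) q) (lcross n (dv X q))) • lcross n (dv X q) := by
    intro q hq
    have hG := hM.ffG_pos hq
    obtain ⟨v1, -, v3, v4⟩ := hM.vertical_jet (h := fun u => mink (c u) n) hh hsphere hq
    obtain ⟨t, ht⟩ := exists_eq_smul_lcross (n := n) (Z := dv X q) (w := X q - c q.1)
      (by rw [mink_comm, v1, ← ffG]; simpa using ⟨hn, hG.ne'⟩) (hplane q hq)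
      (by rw [mink_comm]; exact v3)
    rw [ht, mink_smul_right, ← ffG] at v4
    have h0 : mink (dv (dv X) q) (lcross n (dv X q)) ≠ 0 := fun h0 => by
      rw [h0] at v4; linarith
    refine ⟨h0, ?_⟩
    have ht' : ffG X q / mink (dv (dv X) q) (lcross n (dv X q)) = -t := by
      rw [div_eq_iff h0]; linarith
    rw [ht', neg_smul, ← ht]; abel
  have hlc : ContDiffOn ℝ ∞ (fun q => lcross n (dv X q)) D := contDiffOn_const.lcross hM.contDiffOn_dv
  have hvv : ContDiffOn ℝ ∞ (dv (dv X)) D := contDiffOn_fderiv_apply hM.isOpen hM.contDiffOn_dv _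
  have hc : ContDiffOn ℝ ∞ c (Prod.fst '' D) :=
    contDiffOn_of_comp_fst hM.isOpen (hM.smooth.add
      (((hM.contDiffOn_dv.mink hM.contDiffOn_dv).div (hvv.mink hlc) fun q hq => (key q hq).1).smul
        hlc)) fun q hq => (key q hq).2
  have hcD : ContDiffOn ℝ ∞ (fun q : ℝ × ℝ => X q - c q.1) D :=
    hM.smooth.sub (hc.comp contDiffOn_fst fun q hq => ⟨q, hq, rfl⟩)
  exact ⟨hc, hc.mink contDiffOn_const, contDiffOn_of_comp_fst hM.isOpen (hcD.mink hcD)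
    fun q hq => (hsphere q hq).symm, hh, hsphere⟩

/-- If the planes are lightlike, the vertices of the light cones through the circles depend smoothly
on the parameter. -/
theorem sphereFamily_of_vertex (hM : IsSpacelikeSurface D X) {n e : E31} (hn : mink n n = 0)
    (he : mink e e = 0) (hen : mink e n = 1) {c : ℝ → E31} {m : ℝ → ℝ} (hm : ∀ q ∈ D, m q.1 ≠ 0)
    (hplane : ∀ q ∈ D, mink (X q - c q.1) n = m q.1)
    (hsphere : ∀ q ∈ D, mink (X q - c q.1) (X q - c q.1) = 0) :
    SphereFamily D X n c (fun u => mink (c u) n + m u) (fun _ => 0) := by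
  have hh : ∀ q ∈ D, mink (X q) n = mink (c q.1) n + m q.1 := fun q hq => by
    have := hplane q hq; rw [mink_sub_left] at this; linarith
  -- the lightlike vector orthogonal to `X_v` with `⟨W, n⟩ = 1`
  set W : ℝ × ℝ → E31 := fun q => e - (mink e (dv X q) / ffG X q) • dv X q
    + (mink e (dv X q) ^ 2 / (2 * ffG X q)) • n with hW
  have key : ∀ q ∈ D, mink (dv (dv X) q) (W q) ≠ 0 ∧
      c q.1 = X q + (ffG X q / mink (dv (dv X) q) (W q)) • W q := by
    intro q hq
    have hG := hM.ffG_pos hq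
    obtain ⟨v1, -, v3, v4⟩ := hM.vertical_jet (h := fun u => mink (c u) n + m u) (ρ := fun _ => 0)
      hh hsphere hq
    have hGv : mink (dv X q) (dv X q) = ffG X q := rfl
    have v1' : mink n (dv X q) = 0 := by rw [mink_comm]; exact v1
    have hne : mink n e = 1 := by rw [mink_comm]; exact hen
    have w1 : mink n (W q) = 1 := by
      simp only [hW, mink_add_right, mink_sub_right, mink_smul_right, hn, v1', hne]; ring
    have w2 : mink (dv X q) (W q) = 0 := by
      simp only [hW, mink_add_right, mink_sub_right, mink_smul_right, v1, hGv,
        mink_comm (dv X q) e]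
      field_simp; ring
    have w3 : mink (W q) (W q) = 0 := by
      simp only [hW, mink_add_right, mink_sub_right, mink_smul_right, mink_add_left, mink_sub_left,
        mink_smul_left, he, hn, hen, hne, v1, v1', hGv, mink_comm (dv X q) e]
      field_simp; ring
    have hgram : mink n (W q) ^ 2 - mink n n * mink (W q) (W q) = 1 := by rw [w1, hn]; ring
    obtain ⟨t, ht⟩ := exists_eq_smul_lcross (w := dv X q) (by rw [hgram]; exact one_ne_zero) v1 w2
    have ht0 : t ≠ 0 := by
      rintro rfl
      rw [← hGv, ht] at hG
      simp [mink] at hG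
    have hZT : mink (X q - c q.1) (lcross n (W q)) = 0 := by
      rw [ht, mink_smul_left, mink_comm] at v3
      exact (mul_eq_zero.1 v3).resolve_left ht0
    have hexp := gram_expansion n (W q) (X q - c q.1)
    rw [hgram, hZT, hn, w1, w3, hplane q hq] at hexp
    have hexp' : X q - c q.1 = mink (X q - c q.1) (W q) • n + m q.1 • W q := by
      rw [one_smul] at hexp
      conv_lhs => rw [hexp]
      module
    have hZW : mink (X q - c q.1) (W q) = 0 := by
      have h1 := hsphere q hq
      have h2 : mink (X q - c q.1) (X q - c q.1) =
          2 * m q.1 * mink (X q - c q.1) (W q) := by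
        conv_lhs => rw [hexp', mink_add_left, mink_smul_left, mink_smul_left, ← hexp',
          mink_comm n, hplane q hq, mink_comm (W q)]
        ring
      rw [h1] at h2
      simpa [hm q hq] using h2.symm
    rw [hZW, zero_smul, zero_add] at hexp'
    rw [hexp', mink_smul_right, hGv] at v4
    have h0 : mink (dv (dv X) q) (W q) ≠ 0 := fun h0 => by
      rw [h0] at v4; linarith
    refine ⟨h0, ?_⟩
    have ht' : ffG X q / mink (dv (dv X) q) (W q) = -m q.1 := by
      rw [div_eq_iff h0]; linarith
    rw [ht', neg_smul, ← hexp']; abel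
  have hGs : ContDiffOn ℝ ∞ (ffG X) D := hM.contDiffOn_dv.mink hM.contDiffOn_dv
  have hes : ContDiffOn ℝ ∞ (fun q => mink e (dv X q)) D := contDiffOn_const.mink hM.contDiffOn_dv
  have hWs : ContDiffOn ℝ ∞ W D :=
    (contDiffOn_const.sub ((hes.div hGs fun q hq => (hM.ffG_pos hq).ne').smul
      hM.contDiffOn_dv)).add (((hes.pow 2).div (contDiffOn_const.mul hGs) fun q hq =>
        (mul_pos two_pos (hM.ffG_pos hq)).ne').smul contDiffOn_const)
  have hvv : ContDiffOn ℝ ∞ (dv (dv X)) D := contDiffOn_fderiv_apply hM.isOpen hM.contDiffOn_dv _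
  have hc : ContDiffOn ℝ ∞ c (Prod.fst '' D) :=
    contDiffOn_of_comp_fst hM.isOpen (hM.smooth.add
      ((hGs.div (hvv.mink hWs) fun q hq => (key q hq).1).smul hWs)) fun q hq => (key q hq).2
  exact ⟨hc, contDiffOn_of_comp_fst hM.isOpen (hM.smooth.mink contDiffOn_const)
    fun q hq => (hh q hq).symm, contDiffOn_const, hh, hsphere⟩

/-- The Weingarten relation along a surface that is foliated by circles. -/
theorem SphereFamily.weingarten {n : E31} {c : ℝ → E31} {h ρ : ℝ → ℝ}
    (S : SphereFamily D X n c h ρ) (hM : IsSpacelikeSurface D X) {a b k : ℝ}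
    (hW : ∀ q ∈ D, a * meanCurvature X q + b * gaussCurvature X q = k) {q : ℝ × ℝ} (hq : q ∈ D)
    (hG : mink n (X q - c q.1) ^ 2 - mink n n * mink (X q - c q.1) (X q - c q.1) ≠ 0) :
    0 < normalSq n (X q - c q.1) (deriv c q.1) (deriv h q.1) (deriv ρ q.1) ∧
    a ^ 2 * meanNum n (X q - c q.1) (deriv c q.1) (deriv (deriv c) q.1) (deriv h q.1)
      (deriv (deriv h) q.1) (deriv ρ q.1) (deriv (deriv ρ) q.1) ^ 2 *
      normalSq n (X q - c q.1) (deriv c q.1) (deriv h q.1) (deriv ρ q.1) =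
    4 * (k * normalSq n (X q - c q.1) (deriv c q.1) (deriv h q.1) (deriv ρ q.1) ^ 2 -
      b * deriv h q.1 * gaussNum n (X q - c q.1) (deriv c q.1) (deriv (deriv c) q.1) (deriv h q.1)
      (deriv (deriv h) q.1) (deriv ρ q.1) (deriv (deriv ρ) q.1)) ^ 2 := by
  obtain ⟨h1, ⟨σ, hσ, h2⟩, h3⟩ := (S.circleJet hM hq).curvatures hG (hM.det_pos hq)
  have h4 := hW q hq
  rw [h2, h3] at h4
  exact ⟨h1, weingarten_sq h1 hσ h4⟩

/-- Where the planes are stationary, both curvatures vanish. -/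
theorem SphereFamily.curvatures_eq_zero {n : E31} {c : ℝ → E31} {h ρ : ℝ → ℝ}
    (S : SphereFamily D X n c h ρ) (hM : IsSpacelikeSurface D X) {q : ℝ × ℝ} (hq : q ∈ D)
    (hG : mink n (X q - c q.1) ^ 2 - mink n n * mink (X q - c q.1) (X q - c q.1) ≠ 0)
    (h1 : deriv h q.1 = 0) (h2 : deriv (deriv h) q.1 = 0) :
    meanCurvature X q = 0 ∧ gaussCurvature X q = 0 := by
  obtain ⟨-, ⟨σ, -, h3⟩, h4⟩ := (S.circleJet hM hq).curvatures hG (hM.det_pos hq)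
  rw [h3, h4, meanNum, h1, h2]
  simp

theorem normalSq_of_center {n Z c₁ : E31} {h₁ ρ₁ : ℝ} (hZ : mink n Z = 0) :
    normalSq n Z c₁ h₁ ρ₁ = -mink Z Z * h₁ ^ 2 - mink n n * (ρ₁ / 2 + mink c₁ Z) ^ 2 := by
  rw [normalSq, radial, hZ]; ring

/-- If `c` is the center, the numerator of the mean curvature is affine in `Z` on each circle. -/
theorem meanNum_of_center {n Z c₁ c₂ : E31} {h₁ h₂ ρ₁ ρ₂ : ℝ} (hZ : mink n Z = 0)
    (hc : mink c₁ n = h₁) :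
    meanNum n Z c₁ c₂ h₁ h₂ ρ₁ ρ₂ = -mink n n * mink Z Z * (ρ₁ / 2 + mink c₁ Z) * h₂ -
      h₁ * (-mink n n * mink Z Z * (ρ₂ / 2 + mink c₂ Z - mink c₁ c₁)
        + mink n n * (ρ₁ / 2 + mink c₁ Z) * ρ₁) := by
  rw [meanNum, normalSq, radial, hZ, hc]; ring

/-- If `c` is the center, the difference of the numerators is affine in `⟨c₁, Z⟩` on each circle: the
squares of `⟨c₁, Z⟩` cancel. -/
theorem gaussNum_of_center {n Z c₁ c₂ : E31} {h₁ h₂ ρ₁ ρ₂ : ℝ} (hZ : mink n Z = 0)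
    (hc : mink c₁ n = h₁) :
    gaussNum n Z c₁ c₂ h₁ h₂ ρ₁ ρ₂ = meanNum n Z c₁ c₂ h₁ h₂ ρ₁ ρ₂ +
      h₁ * mink n n * (mink Z Z * mink c₁ c₁ + ρ₁ ^ 2 / 4 + ρ₁ * mink c₁ Z) := by
  rw [gaussNum, normalSq, radial, hZ, hc]; ring

theorem normalSq_of_vertex {n Z c₁ : E31} {h₁ : ℝ} (hn : mink n n = 0) (hZ : mink Z Z = 0) :
    normalSq n Z c₁ h₁ 0 = 2 * mink n Z * h₁ * mink c₁ Z := by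
  rw [normalSq, radial, hZ, hn]; ring

theorem gaussNum_of_vertex {n Z c₁ c₂ : E31} {h₁ h₂ : ℝ} (hn : mink n n = 0) (hZ : mink Z Z = 0) :
    gaussNum n Z c₁ c₂ h₁ h₂ 0 0 = mink n Z ^ 2 * (mink c₁ Z * h₂ - h₁ * mink c₂ Z) := by
  rw [gaussNum, meanNum, normalSq, radial, hZ, hn]; ring

theorem meanNum_of_vertex {n Z c₁ c₂ : E31} {h₁ h₂ : ℝ} (hn : mink n n = 0) (hZ : mink Z Z = 0) :
    meanNum n Z c₁ c₂ h₁ h₂ 0 0 = gaussNum n Z c₁ c₂ h₁ h₂ 0 0 + h₁ * mink n Z ^ 2 * mink c₁ c₁ +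
      (h₁ - mink c₁ n) * normalSq n Z c₁ h₁ 0 := by
  rw [gaussNum, meanNum, normalSq, radial, hZ, hn]; ring

end

/-! ### The velocity of the centers -/

section

variable {D : Set (ℝ × ℝ)} {X : ℝ × ℝ → E31}

/-- For circles in spacelike planes, the centers move orthogonally to the planes where the planes are
not stationary. -/
theorem elliptic_deriv_center {n e₁ e₂ e₃ : E31} {c : ℝ → E31} {ρ : ℝ → ℝ} {r t a b k : ℝ}
    (hM : IsSpacelikeSurface D X) (S : SphereFamily D X n c (fun u => mink (c u) n) ρ)
    (hW : ∀ q ∈ D, a * meanCurvature X q + b * gaussCurvature X q = k)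
    (habk : k ≠ 0 ∨ a ≠ 0 ∧ b ≠ 0) {q : ℝ × ℝ} (hq : q ∈ D) (hf : IsFrame e₁ e₂ e₃) (hr : 0 < r)
    (hn : n = t • e₃) (ht : t ^ 2 = 1)
    (hX : ∀ v, (q.1, v) ∈ D → X (q.1, v) ∈ ellipticCircle (c q.1) e₁ e₂ r)
    (hh : deriv (fun u => mink (c u) n) q.1 = mink (deriv c q.1) n)
    (hh0 : deriv (fun u => mink (c u) n) q.1 ≠ 0) : ∃ s : ℝ, deriv c q.1 = s • n := by
  set h₁ := deriv (fun u => mink (c u) n) q.1 with hh₁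
  set h₂ := deriv (deriv (fun u => mink (c u) n)) q.1
  set ρ₁ := deriv ρ q.1
  set ρ₂ := deriv (deriv ρ) q.1
  set c₁ := deriv c q.1
  set c₂ := deriv (deriv c) q.1
  have ht0 : t ≠ 0 := by rintro rfl; norm_num at ht
  have hnn : mink n n = -1 := by
    rw [hn, mink_smul_left, mink_smul_right, hf.m33]; linarith
  have hc11 : mink c₁ c₁ = mink c₁ e₁ ^ 2 + mink c₁ e₂ ^ 2 - h₁ ^ 2 := by
    rw [hf.mink_eq, hh, hn, mink_smul_right, mul_pow, ht]; ring
  have hinf : ((fun x => (mink (x - c q.1) e₁ / r, mink (x - c q.1) e₂ / r)) ''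
      {x | ∃ v, (q.1, v) ∈ D ∧ X (q.1, v) = x}).Infinite := by
    refine (hM.infinite_curve hq).image ?_
    rintro _ ⟨v, hv, rfl⟩ _ ⟨v', hv', rfl⟩ hvv
    obtain ⟨z1, -⟩ := (mem_ellipticCircle_iff hf hr).1 (hX v hv)
    obtain ⟨z2, -⟩ := (mem_ellipticCircle_iff hf hr).1 (hX v' hv')
    simp only [Prod.mk.injEq, div_left_inj' hr.ne'] at hvv
    refine sub_left_injective (b := c q.1) ?_
    change X (q.1, v) - c q.1 = X (q.1, v') - c q.1
    rw [hf.expand (X (q.1, v) - c q.1), hf.expand (X (q.1, v') - c q.1), z1, z2, hvv.1, hvv.2]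
  have hfin : mink c₁ e₁ = 0 ∧ mink c₁ e₂ = 0 := by
    refine elliptic_rigidity hinf (a := a) (b := b) (k := k) (h := h₁) (r := r) (ρ₁ := ρ₁)
      (π₀ := r ^ 2 * (ρ₁ / 2) * h₂ - h₁ * (r ^ 2 * (ρ₂ / 2 - mink c₁ c₁) - ρ₁ / 2 * ρ₁))
      (π₁ := r ^ 2 * (r * mink c₁ e₁) * h₂ -
        h₁ * (r ^ 2 * (r * mink c₂ e₁) - r * mink c₁ e₁ * ρ₁))
      (π₂ := r ^ 2 * (r * mink c₁ e₂) * h₂ -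
        h₁ * (r ^ 2 * (r * mink c₂ e₂) - r * mink c₁ e₂ * ρ₁)) habk hh0 hr ?_
    rintro _ ⟨_, ⟨v, hv, rfl⟩, rfl⟩
    obtain ⟨z3, zz⟩ := (mem_ellipticCircle_iff hf hr).1 (hX v hv)
    have hnZ : mink n (X (q.1, v) - c q.1) = 0 := by
      rw [hn, mink_smul_left, mink_comm, z3, mul_zero]
    have hlin : ∀ w, mink w (X (q.1, v) - c q.1) =
        r * mink w e₁ * (mink (X (q.1, v) - c q.1) e₁ / r) +
        r * mink w e₂ * (mink (X (q.1, v) - c q.1) e₂ / r) := fun w => by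
      rw [hf.mink_eq w, z3]; field_simp; ring
    obtain ⟨g1, g2⟩ := S.weingarten hM hW hv (by
      simp only [hnZ, hnn, zz]; nlinarith)
    simp only at g1 g2
    rw [gaussNum_of_center hnZ hh.symm, meanNum_of_center hnZ hh.symm,
      normalSq_of_center hnZ, hnn, zz, hlin c₁, hlin c₂] at g2
    rw [normalSq_of_center hnZ, hnn, zz, hlin c₁] at g1
    have hsq := zz
    rw [hf.mink_eq, z3] at hsq
    rw [← hc11]
    refine ⟨?_, ?_, ?_⟩
    · simp only [div_pow]
      field_simp
      linarith
    · convert g1 using 1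
      ring
    · convert g2 using 1
      · congr 1
        · congr 2; ring
        · ring
      · congr 3
        · congr 2; ring
        · congr 1; ring
  refine ⟨-mink c₁ e₃ / t, ?_⟩
  conv_lhs => rw [hf.expand c₁, hfin.1, hfin.2]
  rw [hn, smul_smul, div_mul_cancel₀ _ ht0]
  module

/-- For circles in timelike planes, the centers move orthogonally to the planes. -/
theorem hyperbolic_deriv_center {n e₁ e₂ e₃ : E31} {c : ℝ → E31} {ρ : ℝ → ℝ} {r t a b k : ℝ}
    (hM : IsSpacelikeSurface D X) (S : SphereFamily D X n c (fun u => mink (c u) n) ρ)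
    (hW : ∀ q ∈ D, a * meanCurvature X q + b * gaussCurvature X q = k)
    (habk : k ≠ 0 ∨ a ≠ 0 ∧ b ≠ 0) {q : ℝ × ℝ} (hq : q ∈ D) (hf : IsFrame e₁ e₂ e₃) (hr : 0 < r)
    (hn : n = t • e₁) (ht : t ^ 2 = 1)
    (hX : ∀ v, (q.1, v) ∈ D → X (q.1, v) ∈ hyperbolicCircle (c q.1) e₂ e₃ r)
    (hh : deriv (fun u => mink (c u) n) q.1 = mink (deriv c q.1) n) :
    ∃ s : ℝ, deriv c q.1 = s • n := by
  set h₁ := deriv (fun u => mink (c u) n) q.1 with hh₁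
  set h₂ := deriv (deriv (fun u => mink (c u) n)) q.1
  set ρ₁ := deriv ρ q.1
  set ρ₂ := deriv (deriv ρ) q.1
  set c₁ := deriv c q.1
  set c₂ := deriv (deriv c) q.1
  have ht0 : t ≠ 0 := by rintro rfl; norm_num at ht
  have hnn : mink n n = 1 := by
    rw [hn, mink_smul_left, mink_smul_right, hf.m11]; linarith
  have hc11 : mink c₁ c₁ = h₁ ^ 2 + mink c₁ e₂ ^ 2 - mink c₁ e₃ ^ 2 := by
    rw [hf.mink_eq, hh, hn, mink_smul_right, mul_pow, ht]; ring
  have hinf : ((fun x => (-mink (x - c q.1) e₃ / r, mink (x - c q.1) e₂ / r)) ''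
      {x | ∃ v, (q.1, v) ∈ D ∧ X (q.1, v) = x}).Infinite := by
    refine (hM.infinite_curve hq).image ?_
    rintro _ ⟨v, hv, rfl⟩ _ ⟨v', hv', rfl⟩ hvv
    obtain ⟨z1, -⟩ := (mem_hyperbolicCircle_iff hf hr).1 (hX v hv)
    obtain ⟨z2, -⟩ := (mem_hyperbolicCircle_iff hf hr).1 (hX v' hv')
    simp only [Prod.mk.injEq, div_left_inj' hr.ne', neg_inj] at hvv
    refine sub_left_injective (b := c q.1) ?_
    change X (q.1, v) - c q.1 = X (q.1, v') - c q.1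
    rw [hf.expand (X (q.1, v) - c q.1), hf.expand (X (q.1, v') - c q.1), z1, z2, hvv.1, hvv.2]
  have hh0 : h₁ ≠ 0 := by
    intro h0
    obtain ⟨z3, zz, -⟩ := (mem_hyperbolicCircle_iff hf hr).1 (hX q.2 hq)
    have hnZ : mink n (X (q.1, q.2) - c q.1) = 0 := by
      rw [hn, mink_smul_left, mink_comm, z3, mul_zero]
    have g1 := (S.weingarten hM hW (q := (q.1, q.2)) hq (by
      simp only [hnZ, hnn, zz]; nlinarith)).1
    simp only at g1
    rw [normalSq_of_center hnZ, hnn, ← hh₁, h0] at g1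
    linarith [sq_nonneg (deriv ρ q.1 / 2 + mink (deriv c q.1) (X (q.1, q.2) - c q.1))]
  have hfin : mink c₁ e₂ = 0 ∧ mink c₁ e₃ = 0 := by
    refine hyperbolic_rigidity hinf (a := a) (b := b) (k := k) (h := h₁) (r := r) (ρ₁ := ρ₁)
      (π₀ := r ^ 2 * (ρ₁ / 2) * h₂ - h₁ * (r ^ 2 * (ρ₂ / 2 - mink c₁ c₁) + ρ₁ / 2 * ρ₁))
      (π₁ := r ^ 2 * (r * mink c₁ e₃) * h₂ -
        h₁ * (r ^ 2 * (r * mink c₂ e₃) + r * mink c₁ e₃ * ρ₁))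
      (π₂ := r ^ 2 * (r * mink c₁ e₂) * h₂ -
        h₁ * (r ^ 2 * (r * mink c₂ e₂) + r * mink c₁ e₂ * ρ₁)) habk hh0 hr ?_
    rintro _ ⟨_, ⟨v, hv, rfl⟩, rfl⟩
    obtain ⟨z3, zz, -⟩ := (mem_hyperbolicCircle_iff hf hr).1 (hX v hv)
    have hnZ : mink n (X (q.1, v) - c q.1) = 0 := by
      rw [hn, mink_smul_left, mink_comm, z3, mul_zero]
    have hlin : ∀ w, mink w (X (q.1, v) - c q.1) =
        r * mink w e₃ * (-mink (X (q.1, v) - c q.1) e₃ / r) +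
        r * mink w e₂ * (mink (X (q.1, v) - c q.1) e₂ / r) := fun w => by
      rw [hf.mink_eq w, z3]; field_simp; ring
    obtain ⟨g1, g2⟩ := S.weingarten hM hW hv (by
      simp only [hnZ, hnn, zz]; nlinarith)
    simp only at g1 g2
    rw [gaussNum_of_center hnZ hh.symm, meanNum_of_center hnZ hh.symm,
      normalSq_of_center hnZ, hnn, zz, hlin c₁, hlin c₂] at g2
    rw [normalSq_of_center hnZ, hnn, zz, hlin c₁] at g1
    have hsq := zz
    rw [hf.mink_eq, z3] at hsq
    rw [← hc11]
    refine ⟨?_, ?_, ?_⟩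
    · simp only [div_pow]
      field_simp
      linarith
    · convert g1 using 1
      ring
    · convert g2 using 1
      · congr 1
        · congr 2; ring
        · ring
      · congr 3
        · congr 2; ring
        · congr 1; ring
  refine ⟨mink c₁ e₁ / t, ?_⟩
  conv_lhs => rw [hf.expand c₁, hfin.1, hfin.2]
  rw [hn, smul_smul, div_mul_cancel₀ _ ht0]
  module

/-- The Weingarten relation along the parabola in which a lightlike plane meets the light cone. The
set `T` consists of the parameters of the points of the surface; `π`, `χ` and `d` are the coefficients
of `P₁`, `P₂` and `Δ`. -/
theorem parabolic_relation {n e₁ e₂ e₃ : E31} {c : ℝ → E31} {h : ℝ → ℝ} {r t a b k : ℝ}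
    (hM : IsSpacelikeSurface D X) (S : SphereFamily D X n c h (fun _ => 0))
    (hW : ∀ q ∈ D, a * meanCurvature X q + b * gaussCurvature X q = k)
    {q : ℝ × ℝ} (hq : q ∈ D) (hf : IsFrame e₁ e₂ e₃) (hr : 0 < r)
    (hn : n = t • (e₂ + e₃)) (ht : t ≠ 0)
    (hX : ∀ v, (q.1, v) ∈ D → X (q.1, v) ∈ parabolicCircle (c q.1) e₁ e₂ e₃ r) :
    ∃ (T : Set ℝ) (π₀ π₁ π₂ χ₀ χ₁ χ₂ d₀ d₁ d₂ g : ℝ), T.Infinite ∧ deriv h q.1 ≠ 0 ∧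
      π₀ = χ₀ + g + (deriv h q.1 - mink (deriv c q.1) n) * d₀ ∧
      π₁ = χ₁ + (deriv h q.1 - mink (deriv c q.1) n) * d₁ ∧
      π₂ = χ₂ + (deriv h q.1 - mink (deriv c q.1) n) * d₂ ∧
      d₁ ^ 2 - 4 * d₂ * d₀ = 4 * deriv h q.1 * g ∧
      d₂ = -deriv h q.1 * mink (deriv c q.1) n ∧
      (d₁ = 0 → mink (deriv c q.1) e₁ = 0) ∧
      (mink (deriv c q.1) n = 0 → mink (deriv (deriv c) q.1) n = 0 → χ₂ = 0) ∧
      ∀ s ∈ T, 0 < d₀ + d₁ * s + d₂ * s ^ 2 ∧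
        a ^ 2 * (π₀ + π₁ * s + π₂ * s ^ 2) ^ 2 * (d₀ + d₁ * s + d₂ * s ^ 2) =
        4 * (k * (d₀ + d₁ * s + d₂ * s ^ 2) ^ 2 -
          b * deriv h q.1 * (χ₀ + χ₁ * s + χ₂ * s ^ 2)) ^ 2 := by
  set h₁ := deriv h q.1 with hh₁
  set h₂ := deriv (deriv h) q.1
  set c₁ := deriv c q.1
  set c₂ := deriv (deriv c) q.1
  have hr' := hr.ne'
  have hnn : mink n n = 0 := by
    simp only [hn, mink_smul_left, mink_smul_right, mink_add_left, mink_add_right, hf.m22, hf.m33,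
      hf.m23, mink_comm e₃ e₂]; ring
  have hc11 : mink c₁ c₁ =
      mink c₁ e₁ ^ 2 + mink c₁ (e₂ + e₃) * mink c₁ (e₂ - e₃) := by
    rw [hf.mink_eq, mink_add_right, mink_sub_right]; ring
  have hp : mink c₁ n = t * mink c₁ (e₂ + e₃) := by rw [hn, mink_smul_right]
  have hZ : ∀ v, (q.1, v) ∈ D → mink n (X (q.1, v) - c q.1) = -t / r ∧
      mink (X (q.1, v) - c q.1) (X (q.1, v) - c q.1) = 0 := fun v hv => by
    obtain ⟨z1, z2⟩ := (mem_parabolicCircle_iff hf hr).1 (hX v hv)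
    refine ⟨?_, z2⟩
    rw [mink_comm, hn, mink_smul_right, z1]; ring
  have hlin : ∀ v, (q.1, v) ∈ D → X (q.1, v) - c q.1 =
      mink (X (q.1, v) - c q.1) e₁ • e₁ +
        (r * mink (X (q.1, v) - c q.1) e₁ ^ 2 / 2) • (e₂ + e₃) - (1 / (2 * r)) • (e₂ - e₃) := by
    intro v hv
    obtain ⟨s, hs⟩ := hX v hv
    simp only at hs
    have : mink (X (q.1, v) - c q.1) e₁ = s := by
      rw [← hs, add_sub_cancel_left]
      simp only [mink_add_left, mink_sub_left, mink_smul_left, hf.m11, hf.m12, hf.m13,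
        mink_comm e₂ e₁, mink_comm e₃ e₁]
      ring
    rw [this]
    conv_lhs => rw [← hs, add_sub_cancel_left]
  have hlin' : ∀ v, (q.1, v) ∈ D → ∀ w, mink w (X (q.1, v) - c q.1) =
      -mink w (e₂ - e₃) / (2 * r) + mink w e₁ * mink (X (q.1, v) - c q.1) e₁ +
        r * mink w (e₂ + e₃) / 2 * mink (X (q.1, v) - c q.1) e₁ ^ 2 := by
    intro v hv w
    conv_lhs => rw [hlin v hv]
    rw [mink_sub_right, mink_add_right, mink_smul_right, mink_smul_right, mink_smul_right]
    ring
  have hinf : ((fun x => mink (x - c q.1) e₁) ''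
      {x | ∃ v, (q.1, v) ∈ D ∧ X (q.1, v) = x}).Infinite := by
    refine (hM.infinite_curve hq).image ?_
    rintro _ ⟨v, hv, rfl⟩ _ ⟨v', hv', rfl⟩ hvv
    simp only at hvv
    refine sub_left_injective (b := c q.1) ?_
    change X (q.1, v) - c q.1 = X (q.1, v') - c q.1
    rw [hlin v hv, hlin v' hv', hvv]
  have hwein : ∀ v, (q.1, v) ∈ D → _ := fun v hv => S.weingarten hM hW hv (by
      simp only [(hZ v hv).1, hnn]
      have := sq_pos_of_ne_zero (div_ne_zero (neg_ne_zero.2 ht) hr')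
      nlinarith)
  have hh0 : h₁ ≠ 0 := by
    intro h0
    have g1 := (hwein q.2 hq).1
    simp only [deriv_const'] at g1
    rw [normalSq_of_vertex hnn (hZ q.2 hq).2, ← hh₁, h0] at g1
    simp at g1
  refine ⟨_, _, _, _,
    (-t / r) ^ 2 * (-mink c₁ (e₂ - e₃) / (2 * r) * h₂ - h₁ * (-mink c₂ (e₂ - e₃) / (2 * r))),
    (-t / r) ^ 2 * (mink c₁ e₁ * h₂ - h₁ * mink c₂ e₁),
    (-t / r) ^ 2 * (r * mink c₁ (e₂ + e₃) / 2 * h₂ - h₁ * (r * mink c₂ (e₂ + e₃) / 2)),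
    2 * (-t / r) * h₁ * (-mink c₁ (e₂ - e₃) / (2 * r)), 2 * (-t / r) * h₁ * mink c₁ e₁,
    2 * (-t / r) * h₁ * (r * mink c₁ (e₂ + e₃) / 2), h₁ * (-t / r) ^ 2 * mink c₁ c₁,
    hinf, hh0, rfl, rfl, rfl, ?_, ?_, ?_, ?_, ?_⟩
  · rw [hc11]; field_simp; ring
  · rw [hp]; field_simp
  · intro h0
    simpa [ht, hr', hh0] using h0
  · intro h1 h2
    rw [hn, mink_smul_right] at h1 h2
    rw [(mul_eq_zero.1 h1).resolve_left ht, (mul_eq_zero.1 h2).resolve_left ht]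
    ring
  · rintro _ ⟨_, ⟨v, hv, rfl⟩, rfl⟩
    obtain ⟨hm, hzz⟩ := hZ v hv
    obtain ⟨g1, g2⟩ := hwein v hv
    simp only [deriv_const', deriv_const] at g1 g2
    rw [meanNum_of_vertex hnn hzz, gaussNum_of_vertex hnn hzz, normalSq_of_vertex hnn hzz, hm,
      hlin' v hv c₁, hlin' v hv c₂] at g2
    rw [normalSq_of_vertex hnn hzz, hm, hlin' v hv c₁] at g1
    constructor
    · convert g1 using 1
      ring
    · convert g2 using 1
      · congr 1
        · congr 2; ring
        · ring
      · congr 3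
        · congr 2; ring
        · congr 1; ring

/-- For circles in lightlike planes, the vertices move parallel to the planes. -/
theorem parabolic_deriv_vertex_normal {n e₁ e₂ e₃ : E31} {c : ℝ → E31} {h : ℝ → ℝ} {r t a b k : ℝ}
    (hM : IsSpacelikeSurface D X) (S : SphereFamily D X n c h (fun _ => 0))
    (hW : ∀ q ∈ D, a * meanCurvature X q + b * gaussCurvature X q = k)
    (habk : k ≠ 0 ∨ a ≠ 0 ∧ b ≠ 0)
    {q : ℝ × ℝ} (hq : q ∈ D) (hf : IsFrame e₁ e₂ e₃) (hr : 0 < r)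
    (hn : n = t • (e₂ + e₃)) (ht : t ≠ 0)
    (hX : ∀ v, (q.1, v) ∈ D → X (q.1, v) ∈ parabolicCircle (c q.1) e₁ e₂ e₃ r) :
    mink (deriv c q.1) n = 0 := by
  obtain ⟨T, π₀, π₁, π₂, χ₀, χ₁, χ₂, d₀, d₁, d₂, g, hT, hh, hπ₀, hπ₁, hπ₂, hdisc, hd₂, -, -, H⟩ :=
    parabolic_relation hM S hW hq hf hr hn ht hX
  suffices hd : d₂ = 0 by
    rw [hd₂] at hd
    exact (mul_eq_zero.1 hd).resolve_left (neg_ne_zero.2 hh)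
  by_cases hk : k = 0
  · obtain ⟨ha, hb⟩ := habk.resolve_left (not_not.2 hk)
    subst hk
    obtain ⟨s, hs⟩ := hT.nonempty
    refine parabolic_const_zero hT (η := a ^ 2 / (4 * b ^ 2 * deriv h q.1 ^ 2)) (by positivity) hh
      hπ₀ hπ₁ hπ₂ hdisc (by rw [hd₂]; ring) ⟨s, (H s hs).1⟩ fun s hs => ?_
    have := (H s hs).2
    field_simp
    linear_combination this
  · exact parabolic_leading_eq_zero hT hk (a := a ^ 2) (b := b * deriv h q.1)
      fun s hs => (H s hs).2

/-- For circles in lightlike planes, the vertices move along the lightlike direction. -/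
theorem parabolic_deriv_vertex {n e₁ e₂ e₃ : E31} {c : ℝ → E31} {h : ℝ → ℝ} {r t a b k : ℝ}
    (hM : IsSpacelikeSurface D X) (S : SphereFamily D X n c h (fun _ => 0))
    (hW : ∀ q ∈ D, a * meanCurvature X q + b * gaussCurvature X q = k)
    (habk : k ≠ 0 ∨ a ≠ 0 ∧ b ≠ 0)
    {q : ℝ × ℝ} (hq : q ∈ D) (hf : IsFrame e₁ e₂ e₃) (hr : 0 < r)
    (hn : n = t • (e₂ + e₃)) (ht : t ≠ 0)
    (hX : ∀ v, (q.1, v) ∈ D → X (q.1, v) ∈ parabolicCircle (c q.1) e₁ e₂ e₃ r)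
    (h1 : mink (deriv c q.1) n = 0) (h2 : mink (deriv (deriv c) q.1) n = 0) :
    ∃ s : ℝ, deriv c q.1 = s • n := by
  obtain ⟨T, π₀, π₁, π₂, χ₀, χ₁, χ₂, d₀, d₁, d₂, g, hT, hh, hπ₀, hπ₁, hπ₂, hdisc, hd₂, hd₁, hχ, H⟩ :=
    parabolic_relation hM S hW hq hf hr hn ht hX
  have hχ₂ := hχ h1 h2
  rw [h1, mul_zero] at hd₂
  rw [hχ₂, hd₂, mul_zero, add_zero] at hπ₂
  subst hχ₂ hd₂ hπ₂
  simp only [zero_mul, add_zero] at H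
  have hd : d₁ = 0 := by
    by_cases hk : k = 0
    · obtain ⟨ha, hb⟩ := habk.resolve_left (not_not.2 hk)
      subst hk
      by_contra hd
      obtain ⟨p1, q1⟩ := parabolic_linear_const_zero hT
        (η := a ^ 2 / (4 * b ^ 2 * deriv h q.1 ^ 2)) (π₀ := π₀) (π₁ := π₁) (χ₀ := χ₀) (χ₁ := χ₁)
        (d₀ := d₀) (by positivity) hd fun s hs => by
          have := (H s hs).2
          field_simp
          linear_combination this
      rw [p1, q1, h1, sub_zero, zero_add] at hπ₁
      exact (mul_ne_zero hh hd) hπ₁.symm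
    · exact parabolic_linear_eq_zero hT hk (a := a ^ 2) (b := b * deriv h q.1)
        fun s hs => (H s hs).2
  have he₁ := hd₁ hd
  rw [hn, mink_smul_right] at h1
  have h3 := (mul_eq_zero.1 h1).resolve_left ht
  rw [mink_add_right] at h3
  refine ⟨mink (deriv c q.1) e₂ / t, ?_⟩
  conv_lhs => rw [hf.expand (deriv c q.1), he₁, ← neg_eq_of_add_eq_zero_right h3]
  rw [hn, smul_smul, div_mul_cancel₀ _ ht]
  module

end

/-! ### Stationary planes -/

section

open Filter Topology

/-- A special case of the Grönwall inequality. -/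
theorem eventually_eq_zero_of_abs_deriv_le {f : ℝ → ℝ} {u K : ℝ}
    (hf : ∀ᶠ s in 𝓝 u, DifferentiableAt ℝ f s) (h0 : f u = 0)
    (hK : ∀ᶠ s in 𝓝 u, |deriv f s| ≤ K * |f s|) : ∀ᶠ s in 𝓝 u, f s = 0 := by
  obtain ⟨δ, hδ, hball⟩ := Metric.eventually_nhds_iff_ball.1 (hf.and hK)
  simp only [Real.ball_eq_Ioo] at hball
  filter_upwards [Metric.ball_mem_nhds u hδ] with s hs
  rw [Real.ball_eq_Ioo] at hs
  rcases le_total u s with hus | hus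
  · have hsub : ∀ x ∈ Set.Icc u s, x ∈ Set.Ioo (u - δ) (u + δ) := fun x hx =>
      ⟨by linarith [hx.1], by linarith [hx.2, hs.2]⟩
    exact eq_zero_of_abs_deriv_le_mul_abs_self_of_eq_zero_right (f := f) (f' := deriv f) (K := K)
      (fun x hx => (hball x (hsub x hx)).1.continuousAt.continuousWithinAt)
      (fun x hx => (hball x (hsub x ⟨hx.1, hx.2.le⟩)).1.hasDerivAt.hasDerivWithinAt) h0
      (fun x hx => (hball x (hsub x ⟨hx.1, hx.2.le⟩)).2) s ⟨hus, le_rfl⟩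
  · have hsub : ∀ x ∈ Set.Icc (-u) (-s), -x ∈ Set.Ioo (u - δ) (u + δ) := fun x hx =>
      ⟨by linarith [hx.2, hs.1], by linarith [hx.1]⟩
    have hd : ∀ x ∈ Set.Icc (-u) (-s), HasDerivAt (fun x => f (-x)) (-deriv f (-x)) x :=
      fun x hx =>
        ((hball _ (hsub x hx)).1.hasDerivAt.comp x (hasDerivAt_neg x)).congr_deriv (by ring)
    have := eq_zero_of_abs_deriv_le_mul_abs_self_of_eq_zero_right (f := fun x => f (-x))
      (f' := fun x => -deriv f (-x)) (K := K) (a := -u) (b := -s)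
      (fun x hx => (hd x hx).continuousAt.continuousWithinAt)
      (fun x hx => (hd x ⟨hx.1, hx.2.le⟩).hasDerivWithinAt) (by simpa using h0)
      (fun x hx => by
        rw [norm_neg]; exact (hball _ (hsub x ⟨hx.1, hx.2.le⟩)).2) (-s) ⟨by linarith, le_rfl⟩
    simpa using this

/-- A curve whose velocity is parallel to a fixed vector runs in a straight line. -/
theorem exists_line_of_deriv_parallel {I : Set ℝ} (hI : IsOpen I) (hI' : IsPreconnected I) {n : E31}
    (hn : n ≠ 0) {c : ℝ → E31} (hc : ContDiffOn ℝ ∞ c I)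
    (h : ∀ u ∈ I, ∃ s : ℝ, deriv c u = s • n) : ∃ p, ∀ u ∈ I, ∃ s : ℝ, c u = p + s • n := by
  obtain ⟨i, hi⟩ := Function.ne_iff.1 hn
  have hi : n i ≠ 0 := hi
  have hd : ∀ u ∈ I, HasDerivAt (fun u => c u - (c u i / n i) • n) 0 u := fun u hu => by
    have h1 := hasDerivAt_deriv hI hc hu
    have h2 := h1.sub (((hasDerivAt_pi.1 h1 i).div_const (n i)).smul_const n)
    refine h2.congr_deriv ?_
    obtain ⟨s, hs⟩ := h u hu
    rw [hs, Pi.smul_apply, smul_eq_mul, mul_div_cancel_right₀ _ hi, sub_self]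
  obtain ⟨p, hp⟩ := hI.exists_is_const_of_deriv_eq_zero hI'
    (fun u hu => (hd u hu).differentiableAt.differentiableWithinAt) fun u hu => (hd u hu).deriv
  exact ⟨p, fun u hu => ⟨_, sub_eq_iff_eq_add.1 (hp u hu)⟩⟩

variable {D : Set (ℝ × ℝ)} {X : ℝ × ℝ → E31}

theorem SphereFamily.deriv_mink {n : E31} {c : ℝ → E31} {h ρ : ℝ → ℝ}
    (S : SphereFamily D X n c h ρ) (hD : IsOpen D) {q : ℝ × ℝ} (hq : q ∈ D) :
    deriv (fun u => mink (c u) n) q.1 = mink (deriv c q.1) n := by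
  have := hasDerivAt_mink (hasDerivAt_deriv (isOpen_fst_image hD) S.smooth_c ⟨q, hq, rfl⟩)
    (hasDerivAt_const q.1 n)
  rw [this.deriv]
  simp [mink]

theorem continuousAt_mink {f g : ℝ → E31} {u : ℝ} (hf : ContinuousAt f u) (hg : ContinuousAt g u) :
    ContinuousAt (fun s => mink (f s) (g s)) u :=
  continuous_mink.continuousAt.comp (f := fun s => (f s, g s)) (hf.prodMk hg)

/-- If `a H + b K = 0` with `a ≠ 0`, and the spacelike planes are stationary at one value of the
parameter, then they coincide nearby: the relation bounds the second derivative of `h` by a multiple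
of the first one. -/
theorem eventually_stationary {n : E31} {c : ℝ → E31} {ρ : ℝ → ℝ} {a b : ℝ}
    (hM : IsSpacelikeSurface D X) (S : SphereFamily D X n c (fun u => mink (c u) n) ρ)
    (hnn : mink n n = -1) (hρ : ∀ q ∈ D, 0 < ρ q.1)
    (hW : ∀ q ∈ D, a * meanCurvature X q + b * gaussCurvature X q = 0) (ha : a ≠ 0)
    {q : ℝ × ℝ} (hq : q ∈ D) (h0 : deriv (fun u => mink (c u) n) q.1 = 0) :
    ∀ᶠ s in 𝓝 q.1, deriv (fun u => mink (c u) n) s = 0 := by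
  have hI := isOpen_fst_image hM.isOpen
  have hmem : ∀ {q}, q ∈ D → q.1 ∈ Prod.fst '' D := fun hq => ⟨_, hq, rfl⟩
  set h := fun u => mink (c u) n with hh
  have cont : ∀ {F : Type} [NormedAddCommGroup F] [NormedSpace ℝ F] {f : ℝ → F},
      ContDiffOn ℝ ∞ f (Prod.fst '' D) → ContinuousAt f q.1 := fun hf =>
    (hf.continuousOn).continuousAt (hI.mem_nhds (hmem hq))
  have hc1 := contDiffOn_deriv hI S.smooth_c
  have hh1 := contDiffOn_deriv hI S.smooth_h
  have hρ1 := contDiffOn_deriv hI S.smooth_ρ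
  set Z : ℝ → E31 := fun s => X (s, q.2) - c s with hZ
  have cZ : ContinuousAt Z q.1 := (hM.hasDerivAt_X_fst hq).continuousAt.sub (cont S.smooth_c)
  have cc1 := cont hc1
  have cc2 := cont (contDiffOn_deriv hI hc1)
  have ch1 := cont hh1
  have ch2 := cont (contDiffOn_deriv hI hh1)
  have cρ := cont S.smooth_ρ
  have cρ1 := cont hρ1
  have cρ2 := cont (contDiffOn_deriv hI hρ1)
  have cc1Z := continuousAt_mink cc1 cZ
  have cc2Z := continuousAt_mink cc2 cZ
  have cc11 := continuousAt_mink cc1 cc1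
  set l : ℝ → ℝ := fun s => deriv ρ s / 2 + mink (deriv c s) (Z s) with hl
  have cl : ContinuousAt l q.1 := (cρ1.div_const 2).add cc1Z
  set Δ : ℝ → ℝ := fun s => l s ^ 2 - ρ s * deriv h s ^ 2 with hΔ
  have cΔ : ContinuousAt Δ q.1 := (cl.pow 2).sub (cρ.mul (ch1.pow 2))
  set R : ℝ → ℝ := fun s => ρ s * (deriv (deriv ρ) s / 2 + mink (deriv (deriv c) s) (Z s) -
    mink (deriv c s) (deriv c s)) - l s * deriv ρ s with hR
  have cR : ContinuousAt R q.1 :=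
    (cρ.mul (((cρ2.div_const 2).add cc2Z).sub cc11)).sub (cl.mul cρ1)
  set P : ℝ → ℝ := fun s => ρ s * l s * deriv (deriv h) s - deriv h s * R s with hP
  have cP : ContinuousAt P q.1 := ((cρ.mul cl).mul ch2).sub (ch1.mul cR)
  set Q : ℝ → ℝ := fun s => P s - deriv h s * (ρ s * mink (deriv c s) (deriv c s)
    + deriv ρ s ^ 2 / 4 + deriv ρ s * mink (deriv c s) (Z s)) with hQ
  have cQ : ContinuousAt Q q.1 := cP.sub (ch1.mul
    (((cρ.mul cc11).add ((cρ1.pow 2).div_const 4)).add (cρ1.mul cc1Z)))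
  have rel : ∀ s, (s, q.2) ∈ D → 0 < Δ s ∧
      a ^ 2 * P s ^ 2 * Δ s = 4 * (b * deriv h s * Q s) ^ 2 := fun s hs => by
    have hnZ : mink n (Z s) = 0 := by
      have := S.plane _ hs
      rw [mink_comm, hZ, mink_sub_left, this, sub_self]
    have hzz : mink (Z s) (Z s) = ρ s := S.sphere _ hs
    have hp : mink (deriv c s) n = deriv h s := (S.deriv_mink hM.isOpen hs).symm
    obtain ⟨g1, g2⟩ := S.weingarten hM hW hs (by
      change mink n (Z s) ^ 2 - mink n n * mink (Z s) (Z s) ≠ 0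
      rw [hnZ, hnn, hzz]
      have := hρ _ hs
      simpa using this.ne')
    change 0 < normalSq n (Z s) (deriv c s) (deriv h s) (deriv ρ s) at g1
    change a ^ 2 * meanNum n (Z s) (deriv c s) (deriv (deriv c) s) (deriv h s) (deriv (deriv h) s)
      (deriv ρ s) (deriv (deriv ρ) s) ^ 2 * normalSq n (Z s) (deriv c s) (deriv h s) (deriv ρ s) =
      4 * (0 * normalSq n (Z s) (deriv c s) (deriv h s) (deriv ρ s) ^ 2 - b * deriv h s *
        gaussNum n (Z s) (deriv c s) (deriv (deriv c) s) (deriv h s) (deriv (deriv h) s)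
        (deriv ρ s) (deriv (deriv ρ) s)) ^ 2 at g2
    have e1 : normalSq n (Z s) (deriv c s) (deriv h s) (deriv ρ s) = Δ s := by
      rw [normalSq_of_center hnZ, hnn, hzz]; simp only [hΔ, hl]; ring
    have e2 : meanNum n (Z s) (deriv c s) (deriv (deriv c) s) (deriv h s) (deriv (deriv h) s)
        (deriv ρ s) (deriv (deriv ρ) s) = P s := by
      rw [meanNum_of_center hnZ hp, hnn, hzz]; simp only [hP, hR, hl]; ring
    have e3 : gaussNum n (Z s) (deriv c s) (deriv (deriv c) s) (deriv h s) (deriv (deriv h) s)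
        (deriv ρ s) (deriv (deriv ρ) s) = Q s := by
      rw [gaussNum_of_center hnZ hp, e2, hnn, hzz]; simp only [hQ]; ring
    rw [e1] at g1
    rw [e1, e2, e3] at g2
    exact ⟨g1, g2.trans (by ring)⟩
  -- the coefficient of `h''` in the relation, and the factor of `h'`
  set A : ℝ → ℝ := fun s => |a| * √(Δ s) * |ρ s * l s| with hA
  set B : ℝ → ℝ := fun s => |a| * √(Δ s) * |R s| + 2 * |b| * |Q s| with hB
  have cA : ContinuousAt A q.1 :=
    (continuousAt_const.mul (Real.continuous_sqrt.continuousAt.comp cΔ)).mul (cρ.mul cl).abs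
  have cB : ContinuousAt B q.1 :=
    ((continuousAt_const.mul (Real.continuous_sqrt.continuousAt.comp cΔ)).mul cR.abs).add
      (continuousAt_const.mul cQ.abs)
  have hA0 : 0 < A q.1 := by
    have h1 := (rel q.1 hq).1
    have h2 : l q.1 ≠ 0 := fun hl0 => by
      simp only [hΔ, hl0, h0] at h1
      norm_num at h1
    have h3 := (hρ q hq).ne'
    have h4 := Real.sqrt_pos.2 h1
    have h5 : 0 < |ρ q.1 * l q.1| := abs_pos.2 (mul_ne_zero h3 h2)
    simp only [hA]
    positivity
  have hbound : ∀ s, (s, q.2) ∈ D → |deriv (deriv h) s| * A s ≤ |deriv h s| * B s := fun s hs => by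
    obtain ⟨h1, h2⟩ := rel s hs
    have h3 : |a| * √(Δ s) * |P s| = 2 * |b| * |deriv h s| * |Q s| := by
      refine (pow_left_inj₀ (by positivity) (by positivity) two_ne_zero).1 ?_
      simp only [mul_pow, sq_abs, Real.sq_sqrt h1.le]
      linear_combination h2
    have h4 : |ρ s * l s| * |deriv (deriv h) s| ≤ |P s| + |deriv h s| * |R s| := by
      rw [← abs_mul, ← abs_mul]
      have : ρ s * l s * deriv (deriv h) s = P s + deriv h s * R s := by simp only [hP]; ring
      rw [this]
      exact abs_add_le _ _
    have h5 := mul_le_mul_of_nonneg_left h4 (by positivity : 0 ≤ |a| * √(Δ s))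
    simp only [hA, hB]
    linarith
  refine eventually_eq_zero_of_abs_deriv_le (K := 2 * (|B q.1| + 1) / A q.1) ?_ h0 ?_
  · filter_upwards [hI.mem_nhds (hmem hq)] with s hs
    exact (hasDerivAt_deriv hI hh1 hs).differentiableAt
  · filter_upwards [eventually_mem_fst hM.isOpen hq, cA.eventually_const_lt (half_lt_self hA0),
      cB.eventually_lt_const (lt_of_le_of_lt (le_abs_self (B q.1)) (lt_add_one _))]
      with s hs h1 h2
    have h3 := hbound s hs
    have h4 : |deriv (deriv h) s| * (A q.1 / 2) ≤ |deriv h s| * (|B q.1| + 1) :=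
      (mul_le_mul_of_nonneg_left h1.le (abs_nonneg _)).trans
        (h3.trans (mul_le_mul_of_nonneg_left h2.le (abs_nonneg _)))
    rw [div_mul_eq_mul_div, le_div_iff₀ hA0]
    linarith

/-- For circles in spacelike planes, the centers lie on an orthogonal line, unless the planes
coincide. -/
theorem elliptic_case {n : E31} {c : ℝ → E31} {ρ : ℝ → ℝ} {a b k : ℝ}
    (hM : IsSpacelikeSurface D X) (S : SphereFamily D X n c (fun u => mink (c u) n) ρ)
    (hnn : mink n n = -1) (hρ : ∀ q ∈ D, 0 < ρ q.1)
    (hW : ∀ q ∈ D, a * meanCurvature X q + b * gaussCurvature X q = k)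
    (habk : k ≠ 0 ∨ a ≠ 0 ∧ b ≠ 0)
    (hmove : ∀ u ∈ Prod.fst '' D, deriv (fun u => mink (c u) n) u ≠ 0 →
      ∃ s : ℝ, deriv c u = s • n) :
    (∀ u ∈ Prod.fst '' D, ∃ s : ℝ, deriv c u = s • n) ∨ ∀ q ∈ D, meanCurvature X q = 0 := by
  have hI := isOpen_fst_image hM.isOpen
  have hconn : IsPreconnected (Prod.fst '' D) :=
    hM.isConnected.isPreconnected.image _ continuous_fst.continuousOn
  set h := fun u => mink (c u) n with hh
  have hh1 := contDiffOn_deriv hI S.smooth_h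
  have hflat : ∀ q ∈ D, (∀ᶠ s in 𝓝 q.1, deriv h s = 0) →
      meanCurvature X q = 0 ∧ gaussCurvature X q = 0 := fun q hq he => by
    have hnZ : mink n (X q - c q.1) = 0 := by
      rw [mink_comm, mink_sub_left, S.plane q hq, sub_self]
    refine S.curvatures_eq_zero hM hq ?_ he.self_of_nhds ?_
    · rw [hnZ, hnn, S.sphere q hq]
      have := hρ q hq
      simpa using this.ne'
    · have : deriv h =ᶠ[𝓝 q.1] fun _ => 0 := he
      rw [this.deriv_eq, deriv_const]
  by_cases hk : k = 0
  · obtain ⟨ha, -⟩ := habk.resolve_left (not_not.2 hk)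
    subst hk
    by_cases hz : ∃ u ∈ Prod.fst '' D, deriv h u = 0
    · right
      obtain ⟨u, hu, hu0⟩ := hz
      have hsub : Prod.fst '' D ⊆ {x | ∀ᶠ s in 𝓝 x, deriv h s = 0} := by
        refine hconn.subset_of_closure_inter_subset isOpen_setOfPred_eventually_nhds ?_ ?_
        · obtain ⟨q, hq, rfl⟩ := hu
          exact ⟨q.1, ⟨q, hq, rfl⟩, eventually_stationary hM S hnn hρ hW ha hq hu0⟩
        · rintro _ ⟨hx, ⟨q, hq, rfl⟩⟩
          refine eventually_stationary hM S hnn hρ hW ha hq ?_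
          have hcl : q.1 ∈ closure {x | deriv h x = 0} :=
            closure_mono (fun x hx => hx.self_of_nhds) hx
          by_contra hne
          have hcont : ContinuousAt (deriv h) q.1 :=
            hh1.continuousOn.continuousAt (hI.mem_nhds ⟨q, hq, rfl⟩)
          obtain ⟨x, hx1, hx2⟩ := mem_closure_iff_nhds.1 hcl _ (hcont.eventually_ne hne)
          exact hx1 hx2
      exact fun q hq => (hflat q hq (hsub ⟨q, hq, rfl⟩)).1
    · left
      exact fun u hu => hmove u hu fun h0 => hz ⟨u, hu, h0⟩
  · left
    intro u hu
    have hcl : u ∈ closure {x | x ∈ Prod.fst '' D ∧ deriv h x ≠ 0} := by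
      by_contra hcl
      obtain ⟨q, hq, rfl⟩ := hu
      have he : ∀ᶠ s in 𝓝 q.1, deriv h s = 0 := by
        filter_upwards [isClosed_closure.isOpen_compl.mem_nhds hcl, hI.mem_nhds ⟨q, hq, rfl⟩]
          with s hs hsI
        by_contra hne
        exact hs (subset_closure ⟨hsI, hne⟩)
      obtain ⟨h1, h2⟩ := hflat q hq he
      have := hW q hq
      rw [h1, h2] at this
      exact hk (by linarith)
    have hcont : ContinuousAt (deriv c) u :=
      (contDiffOn_deriv hI S.smooth_c).continuousOn.continuousAt (hI.mem_nhds hu)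
    have hspan : deriv c u ∈ closure (Submodule.span ℝ {n} : Set E31) := by
      refine hcont.continuousWithinAt.mem_closure hcl fun x hx => ?_
      obtain ⟨s, hs⟩ := hmove x hx.1 hx.2
      rw [hs]
      exact Submodule.smul_mem _ _ (Submodule.mem_span_singleton_self n)
    rw [(Submodule.closed_of_finiteDimensional _).closure_eq] at hspan
    obtain ⟨s, hs⟩ := Submodule.mem_span_singleton.1 hspan
    exact ⟨s, hs.symm⟩

end

/-! ### The three types of planes -/

section

open Filter Topology

variable {D : Set (ℝ × ℝ)} {X : ℝ × ℝ → E31} {C : ℝ → Set E31}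

theorem IsCircleAbout.of_neg {n c : E31} {C : Set E31} (h : IsCircleAbout n c C)
    (hn : mink n n = -1) : ∃ (e₁ e₂ e₃ : E31) (r t : ℝ), IsFrame e₁ e₂ e₃ ∧ 0 < r ∧ t ^ 2 = 1 ∧
      n = t • e₃ ∧ C = ellipticCircle c e₁ e₂ r := by
  obtain ⟨e₁, e₂, e₃, r, t, hf, hr, -, ⟨h1, h2⟩ | ⟨h1, -⟩ | ⟨h1, -⟩⟩ := h
  · rw [h1, mink_smul_left, mink_smul_right, hf.m33] at hn
    exact ⟨e₁, e₂, e₃, r, t, hf, hr, by linarith, h1, h2⟩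
  · rw [h1, mink_smul_left, mink_smul_right, hf.m11] at hn
    nlinarith [sq_nonneg t]
  · rw [h1, mink_smul_left, mink_smul_right, mink_add_left, mink_add_right, mink_add_right, hf.m22,
      hf.m33, mink_comm e₃, hf.m23] at hn
    norm_num at hn

theorem IsCircleAbout.of_pos {n c : E31} {C : Set E31} (h : IsCircleAbout n c C)
    (hn : mink n n = 1) : ∃ (e₁ e₂ e₃ : E31) (r t : ℝ), IsFrame e₁ e₂ e₃ ∧ 0 < r ∧ t ^ 2 = 1 ∧
      n = t • e₁ ∧ C = hyperbolicCircle c e₂ e₃ r := by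
  obtain ⟨e₁, e₂, e₃, r, t, hf, hr, -, ⟨h1, -⟩ | ⟨h1, h2⟩ | ⟨h1, -⟩⟩ := h
  · rw [h1, mink_smul_left, mink_smul_right, hf.m33] at hn
    nlinarith [sq_nonneg t]
  · rw [h1, mink_smul_left, mink_smul_right, hf.m11] at hn
    exact ⟨e₁, e₂, e₃, r, t, hf, hr, by linarith, h1, h2⟩
  · rw [h1, mink_smul_left, mink_smul_right, mink_add_left, mink_add_right, mink_add_right, hf.m22,
      hf.m33, mink_comm e₃, hf.m23] at hn
    norm_num at hn

theorem IsCircleAbout.of_zero {n c : E31} {C : Set E31} (h : IsCircleAbout n c C)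
    (hn : mink n n = 0) : ∃ (e₁ e₂ e₃ : E31) (r t : ℝ), IsFrame e₁ e₂ e₃ ∧ 0 < r ∧ t ≠ 0 ∧
      n = t • (e₂ + e₃) ∧ C = parabolicCircle c e₁ e₂ e₃ r := by
  obtain ⟨e₁, e₂, e₃, r, t, hf, hr, ht, ⟨h1, -⟩ | ⟨h1, -⟩ | ⟨h1, h2⟩⟩ := h
  · rw [h1, mink_smul_left, mink_smul_right, hf.m33] at hn
    simp [ht] at hn
  · rw [h1, mink_smul_left, mink_smul_right, hf.m11] at hn
    simp [ht] at hn
  · exact ⟨e₁, e₂, e₃, r, t, hf, hr, ht, h1, h2⟩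

/-- A foliation by circles whose centers move along the normal of the planes is a surface of
revolution. -/
theorem isSurfaceOfRevolution_of_deriv_center (hM : IsSpacelikeSurface D X) {n : E31} (hn : n ≠ 0)
    {c : ℝ → E31} {h ρ : ℝ → ℝ} (S : SphereFamily D X n c h ρ)
    (hc : ∀ u ∈ Prod.fst '' D, IsCircleAbout n (c u) (C u))
    (hd : ∀ u ∈ Prod.fst '' D, ∃ s : ℝ, deriv c u = s • n) : IsSurfaceOfRevolution D C := by
  obtain ⟨p, hp⟩ := exists_line_of_deriv_parallel (isOpen_fst_image hM.isOpen)
    (hM.isConnected.isPreconnected.image _ continuous_fst.continuousOn) hn S.smooth_c hd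
  refine ⟨p, n, hn, fun Φ hΦ u hu => ?_⟩
  obtain ⟨s, hs⟩ := hp u hu
  exact (hc u hu).image_rotation hs hΦ

/-- A linear Weingarten surface foliated by circles in spacelike planes is a surface of revolution,
unless the relation is `H = 0` or `K = 0`, or the surface lies in one of the planes. -/
theorem revolution_of_spacelike_planes (hM : IsSpacelikeSurface D X) {n : E31} (hnn : mink n n = -1)
    {c : ℝ → E31} (hX : ∀ q ∈ D, X q ∈ C q.1)
    (hc : ∀ u ∈ Prod.fst '' D, IsCircleAbout n (c u) (C u)) {a b k : ℝ}
    (hW : ∀ q ∈ D, a * meanCurvature X q + b * gaussCurvature X q = k)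
    (habk : k ≠ 0 ∨ a ≠ 0 ∧ b ≠ 0) :
    IsSurfaceOfRevolution D C ∨ ∀ q ∈ D, meanCurvature X q = 0 := by
  have hn : n ≠ 0 := by rintro rfl; simp [mink] at hnn
  have hdata := fun u hu => (hc u hu).of_neg hnn
  choose! e₁ e₂ e₃ r t hf hr ht hnt hCu using hdata
  have hmem : ∀ {q}, q ∈ D → q.1 ∈ Prod.fst '' D := fun hq => ⟨_, hq, rfl⟩
  have hXc : ∀ q ∈ D, X q ∈ ellipticCircle (c q.1) (e₁ q.1) (e₂ q.1) (r q.1) := fun q hq =>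
    hCu q.1 (hmem hq) ▸ hX q hq
  have hsph := fun q hq => (mem_ellipticCircle_iff (hf q.1 (hmem hq)) (hr q.1 (hmem hq))).1 (hXc q hq)
  have S := sphereFamily_of_center hM (n := n) (c := c) (ρ := fun u => r u ^ 2)
    (by rw [hnn]; norm_num) (fun q hq => by
      rw [hnt q.1 (hmem hq), mink_smul_right, (hsph q hq).1, mul_zero]) (fun q hq => (hsph q hq).2)
  refine (elliptic_case hM S hnn (fun q hq => pow_pos (hr q.1 (hmem hq)) 2) hW habk ?_).imp
    (isSurfaceOfRevolution_of_deriv_center hM hn S hc) id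
  rintro _ ⟨q, hq, rfl⟩ h0
  exact elliptic_deriv_center hM S hW habk hq (hf q.1 (hmem hq)) (hr q.1 (hmem hq))
    (hnt q.1 (hmem hq)) (ht q.1 (hmem hq)) (fun v hv => hXc (q.1, v) hv)
    (S.deriv_mink hM.isOpen hq) h0

/-- A linear Weingarten surface foliated by circles in timelike planes is a surface of revolution,
unless the relation is `H = 0` or `K = 0`. -/
theorem revolution_of_timelike_planes (hM : IsSpacelikeSurface D X) {n : E31} (hnn : mink n n = 1)
    {c : ℝ → E31} (hX : ∀ q ∈ D, X q ∈ C q.1)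
    (hc : ∀ u ∈ Prod.fst '' D, IsCircleAbout n (c u) (C u)) {a b k : ℝ}
    (hW : ∀ q ∈ D, a * meanCurvature X q + b * gaussCurvature X q = k)
    (habk : k ≠ 0 ∨ a ≠ 0 ∧ b ≠ 0) : IsSurfaceOfRevolution D C := by
  have hn : n ≠ 0 := by rintro rfl; simp [mink] at hnn
  have hdata := fun u hu => (hc u hu).of_pos hnn
  choose! e₁ e₂ e₃ r t hf hr ht hnt hCu using hdata
  have hmem : ∀ {q}, q ∈ D → q.1 ∈ Prod.fst '' D := fun hq => ⟨_, hq, rfl⟩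
  have hXc : ∀ q ∈ D, X q ∈ hyperbolicCircle (c q.1) (e₂ q.1) (e₃ q.1) (r q.1) := fun q hq =>
    hCu q.1 (hmem hq) ▸ hX q hq
  have hsph := fun q hq =>
    (mem_hyperbolicCircle_iff (hf q.1 (hmem hq)) (hr q.1 (hmem hq))).1 (hXc q hq)
  have S := sphereFamily_of_center hM (n := n) (c := c) (ρ := fun u => -r u ^ 2)
    (by rw [hnn]; norm_num) (fun q hq => by
      rw [hnt q.1 (hmem hq), mink_smul_right, (hsph q hq).1, mul_zero])
    (fun q hq => (hsph q hq).2.1)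
  refine isSurfaceOfRevolution_of_deriv_center hM hn S hc ?_
  rintro _ ⟨q, hq, rfl⟩
  exact hyperbolic_deriv_center hM S hW habk hq (hf q.1 (hmem hq)) (hr q.1 (hmem hq))
    (hnt q.1 (hmem hq)) (ht q.1 (hmem hq)) (fun v hv => hXc (q.1, v) hv)
    (S.deriv_mink hM.isOpen hq)

/-- A linear Weingarten surface foliated by circles in lightlike planes is a surface of revolution,
unless the relation is `H = 0` or `K = 0`. -/
theorem revolution_of_lightlike_planes (hM : IsSpacelikeSurface D X) {n : E31} (hn : n ≠ 0)
    (hnn : mink n n = 0) {c : ℝ → E31} (hX : ∀ q ∈ D, X q ∈ C q.1)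
    (hc : ∀ u ∈ Prod.fst '' D, IsCircleAbout n (c u) (C u)) {a b k : ℝ}
    (hW : ∀ q ∈ D, a * meanCurvature X q + b * gaussCurvature X q = k)
    (habk : k ≠ 0 ∨ a ≠ 0 ∧ b ≠ 0) : IsSurfaceOfRevolution D C := by
  have hdata := fun u hu => (hc u hu).of_zero hnn
  choose! e₁ e₂ e₃ r t hf hr ht hnt hCu using hdata
  have hmem : ∀ {q}, q ∈ D → q.1 ∈ Prod.fst '' D := fun hq => ⟨_, hq, rfl⟩
  have hXc : ∀ q ∈ D, X q ∈ parabolicCircle (c q.1) (e₁ q.1) (e₂ q.1) (e₃ q.1) (r q.1) :=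
    fun q hq => hCu q.1 (hmem hq) ▸ hX q hq
  have hsph := fun q hq =>
    (mem_parabolicCircle_iff (hf q.1 (hmem hq)) (hr q.1 (hmem hq))).1 (hXc q hq)
  -- a second lightlike vector, transversal to the planes
  obtain ⟨e, he, hen⟩ : ∃ e, mink e e = 0 ∧ mink e n = 1 := by
    obtain ⟨q, hq⟩ := hM.isConnected.nonempty
    have hfq := hf q.1 (hmem hq)
    have htq := ht q.1 (hmem hq)
    refine ⟨(1 / (2 * t q.1)) • (e₂ q.1 - e₃ q.1), ?_, ?_⟩
    · simp only [mink_smul_left, mink_smul_right, mink_sub_left, mink_sub_right, hfq.m22, hfq.m23,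
        hfq.m33, mink_comm (e₃ q.1) (e₂ q.1)]
      ring
    · rw [hnt q.1 (hmem hq)]
      simp only [mink_smul_left, mink_smul_right, mink_sub_left, mink_add_right, hfq.m22, hfq.m23,
        hfq.m33, mink_comm (e₃ q.1) (e₂ q.1)]
      field_simp; ring
  have S := sphereFamily_of_vertex hM (c := c) (m := fun u => t u * (-1 / r u)) hnn he hen
    (fun q hq => mul_ne_zero (ht q.1 (hmem hq))
      (div_ne_zero (by norm_num) (hr q.1 (hmem hq)).ne'))
    (fun q hq => by rw [hnt q.1 (hmem hq), mink_smul_right, (hsph q hq).1])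
    (fun q hq => (hsph q hq).2)
  have hzero : ∀ q ∈ D, mink (deriv c q.1) n = 0 := fun q hq =>
    parabolic_deriv_vertex_normal hM S hW habk hq (hf q.1 (hmem hq)) (hr q.1 (hmem hq))
      (hnt q.1 (hmem hq)) (ht q.1 (hmem hq)) (fun v hv => hXc (q.1, v) hv)
  refine isSurfaceOfRevolution_of_deriv_center hM hn S hc ?_
  rintro _ ⟨q, hq, rfl⟩
  have hI := isOpen_fst_image hM.isOpen
  have hzero' : mink (deriv (deriv c) q.1) n = 0 := by
    have e := (hasDerivAt_mink (hasDerivAt_deriv hI (contDiffOn_deriv hI S.smooth_c) (hmem hq))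
      (hasDerivAt_const q.1 n)).unique ((hasDerivAt_const q.1 (0 : ℝ)).congr_of_eventuallyEq (by
        filter_upwards [eventually_mem_fst hM.isOpen hq] with s hs
        exact hzero _ hs))
    simpa [mink] using e
  exact parabolic_deriv_vertex hM S hW habk hq (hf q.1 (hmem hq)) (hr q.1 (hmem hq))
    (hnt q.1 (hmem hq)) (ht q.1 (hmem hq)) (fun v hv => hXc (q.1, v) hv) (hzero q hq) hzero'

end

end Minkowski

end

theorem theorem1p1 (D : Set (ℝ × ℝ)) (X : ℝ × ℝ → Minkowski.E31) (C : ℝ → Set Minkowski.E31)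
    (hM : Minkowski.IsSpacelikeSurface D X)
    (hC : Minkowski.IsCyclic D X C)
    (hP : Minkowski.CirclesInParallelPlanes D C)
    (hW : Minkowski.IsLinearWeingarten D X) :
    Minkowski.IsSurfaceOfRevolution D C ∨
      (∀ q ∈ D, Minkowski.meanCurvature X q = 0) ∨
      (∀ q ∈ D, Minkowski.gaussCurvature X q = 0) := by
  obtain ⟨a, b, k, hab, hW⟩ := hW
  by_cases habk : k ≠ 0 ∨ a ≠ 0 ∧ b ≠ 0
  · obtain ⟨P, hP2, hPC⟩ := hP
    obtain ⟨n, hn, hnP, hnn⟩ := Minkowski.exists_unit_normal P hP2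
    have hc := fun u hu => (hC.isCircle u hu).exists_isCircleAbout hn
      fun x hx y hy => hnP _ (hPC u hu x hx y hy)
    choose! c hc using hc
    rcases hnn with hnn | hnn | hnn
    · exact (Minkowski.revolution_of_spacelike_planes hM hnn hC.mem_circle hc hW habk).imp_right
        Or.inl
    · exact Or.inl (Minkowski.revolution_of_timelike_planes hM hnn hC.mem_circle hc hW habk)
    · exact Or.inl (Minkowski.revolution_of_lightlike_planes hM hn hnn hC.mem_circle hc hW habk)
  · -- one of the coefficients and the constant vanish, so the relation is `H = 0` or `K = 0`
    push Not at habk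
    obtain ⟨rfl, hab'⟩ := habk
    refine Or.inr ?_
    by_cases ha : a = 0
    · have hb : b ≠ 0 := fun hb => hab (by simp [ha, hb])
      exact Or.inr fun q hq => by simpa [ha, hb] using hW q hq
    · exact Or.inl fun q hq => by simpa [ha, hab' ha] using hW q hq
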